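/- **Theorem 2.1 (semi-global rigidity for Hamiltonian systems at a positive energy level).** Let $M$ and $\tilde M$ be smooth manifolds with boundary, of dimension $n\ge 2$, with the same boundary: $\partial M=\partial\tilde M$, with inclusions $\iota:\partial M\to M$ and $\tilde\iota:\partial M\to\tilde M$. For $(x,\xi)\in T^*M|_{\partial M}$ let $\iota^*(x,\xi)=(x,\xi')\in T^*\partial M$ be the restriction of $\xi$ to $T_x\partial M$. Let $\rho$ be a boundary defining function of $M$ ($\rho>0$ in the interior, $\rho=0$ and $d\rho\ne0$ on $\partial M$). Let $H\in C^\infty(T^*M\setminus0)$ be positive and positively homogeneous of degree two in the fibre variable, $X_H=H_\xi\partial_x-H_x\partial_\xi$, and $S^*M=\{H=1/2\}$; unit bicharacteristics are the integral curves of $X_H$ in $S^*M$. Let $\tilde\rho,\tilde H$ be such objects on $\tilde M$. Let $U,V\subset\partial M$ be open and disjoint and $x_0\in U$. Let $(x_0,\xi^0)\in S^*M$ be incoming and satisfy the transversality condition (A1), that is, $\langle d\rho,H_\xi\rangle>0$ there. Let $\mathcal U\subset T^*U$ be an open set with $(x_0,\xi^{0\prime})\in\mathcal U$ and $\mathcal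 O\subset T^*M$ an open neighbourhood of $(x_0,\xi^0)$ such that for every $(x,\xi')\in\mathcal U$: * there is exactly one $(x,\xi)\in\mathcal O\cap S^*M$ with $\iota^*(x,\xi)=(x,\xi')$, and $\langle d\rho,H_\xi\rangle>0$ at $(x,\xi)$; * the unit bicharacteristic issued from $(x,\xi)$ at time $0$ lies over the interior of $M$ for $0<s<\ell(x,\xi')$, with some $\ell(x,\xi')>0$, and at $s=\ell(x,\xi')$ it hits $V$ transversally, at a covector $(y,\eta)$ with $y\in V$ and $\langle d\rho,H_\xi\rangle\neq0$. Then $S(x,\xi')=\iota^*(y,\eta)$ is the local scattering relation and $\ell(x,\xi')$ the travel time on $\mathcal U$. Let $\Gamma\subset T^*M\setminus0$ be the conic set of all $(y,\lambda\eta)$, where $\lambda>0$ and $(y,\eta)$ lies on the unit bicharacteristic in $T^*M$ issued, for times $s\ge0$, from some $(x,\xi)\in\mathcal O\cap S^*M$ with $\iota^*(x,\xi)\in\mathcal U$, and let $\Gamma_U,\Gamma_V$ be the sets of points of $\Gamma$ with base point in $U$, resp. $V$. Assume the same for $\tilde H$, with the same $U,V,x_0,\mathcal U$, a covector $(x_0,\tilde\xi^0)$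 and a neighbourhood $\tilde{\mathcal O}$ of it, and denote the resulting objects by $\tilde S,\tilde\ell,\tilde\Gamma,\tilde\Gamma_U,\tilde\Gamma_V$. If $S=\tilde S$ and $\ell=\tilde\ell$ on $\mathcal U$, then there is a homogeneous canonical transformation $\kappa:\Gamma\to\tilde\Gamma$ (a diffeomorphism of $\Gamma$ onto $\tilde\Gamma$, smooth up to the boundary with its inverse, which commutes with the dilations $(x,\xi)\mapsto(x,\lambda\xi)$, $\lambda>0$, and preserves the symplectic form $d\xi\wedge dx$) such that $$\kappa^*\tilde H=H\ \text{ on }\Gamma,\qquad \kappa(\Gamma_U)=\tilde\Gamma_U,\qquad \kappa(\Gamma_V)=\tilde\Gamma_V,\qquad \tilde\iota^*\circ\kappa=\iota^*\ \text{ on }\Gamma_U\cup\Gamma_V .$$ -/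

import Mathlib

open Set Bundle
open scoped Manifold ContDiff Topology

noncomputable section

section CotangentBundle

variable {n : ℕ} {A : Type*} [TopologicalSpace A]
  (I : ModelWithCorners ℝ (EuclideanSpace ℝ (Fin n)) A)
  (M : Type*) [TopologicalSpace M] [ChartedSpace A M]

/-- The space `ℝⁿ` on which an `n`-dimensional manifold is modelled. -/
abbrev ModelVec (n : ℕ) : Type := EuclideanSpace ℝ (Fin n)

/-- The dual of `ℝⁿ`, the model fibre of the cotangent bundle. -/
abbrev ModelCovec (n : ℕ) : Type := EuclideanSpace ℝ (Fin n) →L[ℝ] ℝ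

/-- The cotangent bundle `T*M`, with the topology and the smooth structure of Mathlib's bundle of
continuous linear maps from the tangent bundle to the trivial line bundle. A point is a pair
`⟨x, ξ⟩` with `ξ` a linear form on the tangent space at `x`. Its chart at a point over `x₀` is
`(x, ξ)`, with `x` read in the chart of `M` at `x₀` and `ξ` in the dual linear coordinates. -/
abbrev CotangentBundle : Type _ :=
  TotalSpace (ModelCovec n) (fun x : M ↦ TangentSpace I x →L[ℝ] Bundle.Trivial M ℝ x)

/-- The model with corners of `T*M`. -/
abbrev cotangentModel : ModelWithCorners ℝ (ModelVec n × ModelCovec n)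
    (ModelProd A (ModelCovec n)) :=
  I.prod 𝓘(ℝ, ModelCovec n)

variable {I M}

/-- `T*M ∖ 0`. -/
def nonzeroCovectors : Set (CotangentBundle I M) := {p | p.2 ≠ 0}

/-- The dilation `(x, ξ) ↦ (x, c ξ)`. -/
def dilation (c : ℝ) (p : CotangentBundle I M) : CotangentBundle I M := ⟨p.1, c • p.2⟩

variable [IsManifold I ∞ M]

/-- The symplectic form `σ = dξ ∧ dx` of `T*M` at `p`. Mathlib represents a tangent vector at `p`
by its components `(δx, δξ)` in the chart of `T*M` at `p`, that is, in canonical coordinates. -/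
def symplecticForm (p : CotangentBundle I M) (w w' : TangentSpace (cotangentModel I) p) : ℝ :=
  let a : ModelVec n × ModelCovec n := w
  let b : ModelVec n × ModelCovec n := w'
  a.2 b.1 - b.2 a.1

/-- The Hamiltonian vector field `X_F = F_ξ ∂_x - F_x ∂_ξ`, in the canonical coordinates at `p`. -/
def hamiltonianVectorField (F : CotangentBundle I M → ℝ) (p : CotangentBundle I M) :
    TangentSpace (cotangentModel I) p :=
  let dF : ModelVec n × ModelCovec n →L[ℝ] ℝ := mfderiv (cotangentModel I) 𝓘(ℝ, ℝ) F p
  ((WithLp.toLp 2 (fun i ↦ dF (0, EuclideanSpace.proj i)),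
    -(dF.comp (ContinuousLinearMap.inl ℝ (ModelVec n) (ModelCovec n)))) :
    ModelVec n × ModelCovec n)

/-- A positive Hamiltonian in `C^∞(T*M ∖ 0)`, positively homogeneous of degree two in the fibres.
Its values on the zero section are irrelevant. -/
structure IsPositiveHamiltonian (F : CotangentBundle I M → ℝ) : Prop where
  smooth : ContMDiffOn (cotangentModel I) 𝓘(ℝ, ℝ) ∞ F nonzeroCovectors
  pos : ∀ p ∈ nonzeroCovectors, 0 < F p
  homogeneous : ∀ p ∈ nonzeroCovectors, ∀ c : ℝ, 0 < c → F (dilation c p) = c ^ 2 * F p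

/-- The unit cosphere bundle `S*M = {F = 1/2}`. -/
def unitCosphere (F : CotangentBundle I M → ℝ) : Set (CotangentBundle I M) :=
  {p | p ∈ nonzeroCovectors ∧ F p = 1 / 2}

/-- `γ` is a bicharacteristic (Hamiltonian curve in `T*M ∖ 0`) on the time interval `s`. -/
def IsBicharacteristicOn (F : CotangentBundle I M → ℝ) (γ : ℝ → CotangentBundle I M)
    (s : Set ℝ) : Prop :=
  (∀ t ∈ s, γ t ∈ nonzeroCovectors) ∧
    IsMIntegralCurveOn (I := cotangentModel I) γ (hamiltonianVectorField F) s

/-- `⟨dρ, F_ξ⟩` at `p`, where `F_ξ = dπ (X_F)` is the velocity of the base point. -/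
def normalVelocity (ρ : M → ℝ) (F : CotangentBundle I M → ℝ) (p : CotangentBundle I M) : ℝ :=
  mfderiv I 𝓘(ℝ, ℝ) ρ p.proj
    (mfderiv (cotangentModel I) I (fun r : CotangentBundle I M ↦ r.proj) p
      (hamiltonianVectorField F p))

end CotangentBundle

section Boundary

variable {n : ℕ} {A : Type*} [TopologicalSpace A]
  (I : ModelWithCorners ℝ (EuclideanSpace ℝ (Fin n)) A)
  {M : Type*} [TopologicalSpace M] [ChartedSpace A M]

/-- A boundary defining function: smooth, positive in the interior, zero on the boundary, and with
non-zero differential there. -/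
structure IsBoundaryDefiningFunction (ρ : M → ℝ) : Prop where
  smooth : ContMDiff I 𝓘(ℝ, ℝ) ∞ ρ
  pos : ∀ x ∈ I.interior M, 0 < ρ x
  zero : ∀ x ∈ I.boundary M, ρ x = 0
  mfderiv_ne_zero : ∀ x ∈ I.boundary M, mfderiv I 𝓘(ℝ, ℝ) ρ x ≠ 0

variable (m : ℕ) {B : Type*} [TopologicalSpace B] [ChartedSpace (EuclideanSpace ℝ (Fin m)) B]

/-- `ι : B → M` exhibits the manifold `B` as the boundary of `M`. -/
structure IsBoundaryInclusion (ι : B → M) : Prop where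
  embedding : Manifold.IsSmoothEmbedding (𝓡 m) I ∞ ι
  range_eq : range ι = I.boundary M

variable {I} {m}

/-- `q = ι* p`: the covector `p ∈ T*M` has its base point on the boundary, and `q ∈ T*B` is its
restriction to the vectors tangent to the boundary. -/
def IsRestriction (ι : B → M) (p : CotangentBundle I M) (q : CotangentBundle (𝓡 m) B) : Prop :=
  ∃ (b : B) (ξ : TangentSpace I (ι b) →L[ℝ] ℝ),
    p = ⟨ι b, ξ⟩ ∧ q = ⟨b, ξ.comp (mfderiv (𝓡 m) I ι b)⟩

/-- The covectors in `Γ` with base point in the part `W` of the boundary. -/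
def overBoundary (ι : B → M) (Γ : Set (CotangentBundle I M)) (W : Set B) :
    Set (CotangentBundle I M) :=
  {p ∈ Γ | p.proj ∈ ι '' W}

variable [IsManifold I ∞ M] [IsManifold (𝓡 m) ∞ B]

/-- `S` and `ℓ` are, on `𝒰`, the scattering relation and the travel time of `F` from `U` to `V`
relative to the incoming covector `p₀`.

Here `𝒰 ⊆ T*U` is a neighbourhood of `ι* p₀` and `𝒪` is the neighbourhood of `p₀` in which the
equations `ι* p = q`, `F p = 1/2` are solved; the solution is unique for each `q ∈ 𝒰` and it
satisfies the transversality condition `⟨dρ, F_ξ⟩ > 0`. The bicharacteristic issued from it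
enters the interior and hits the boundary for the first time at time `ℓ q`, transversally, at a
point of `V` and at a covector with restriction `S q`. -/
structure IsLensData (ι : B → M) (ρ : M → ℝ) (F : CotangentBundle I M → ℝ) (U V : Set B)
    (p₀ : CotangentBundle I M) (𝒰 : Set (CotangentBundle (𝓡 m) B))
    (𝒪 : Set (CotangentBundle I M))
    (S : CotangentBundle (𝓡 m) B → CotangentBundle (𝓡 m) B)
    (ℓ : CotangentBundle (𝓡 m) B → ℝ) : Prop where
  base_unit : p₀ ∈ unitCosphere F
  base_incoming : 0 < normalVelocity ρ F p₀
  base_mem : p₀ ∈ 𝒪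
  base_restriction : ∃ q₀ ∈ 𝒰, IsRestriction ι p₀ q₀
  isOpen_dom : IsOpen 𝒰
  dom_over : ∀ q ∈ 𝒰, q.proj ∈ U
  isOpen_nhd : IsOpen 𝒪
  solvable : ∀ q ∈ 𝒰, ∃! p, p ∈ 𝒪 ∧ p ∈ unitCosphere F ∧ IsRestriction ι p q
  incoming : ∀ q ∈ 𝒰, ∀ p ∈ 𝒪, p ∈ unitCosphere F → IsRestriction ι p q →
    0 < normalVelocity ρ F p
  hits : ∀ q ∈ 𝒰, ∀ p ∈ 𝒪, p ∈ unitCosphere F → IsRestriction ι p q →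
    0 < ℓ q ∧ ∃ γ : ℝ → CotangentBundle I M,
      γ 0 = p ∧ IsBicharacteristicOn F γ (Icc 0 (ℓ q)) ∧
      (∀ t ∈ Ioo 0 (ℓ q), (γ t).proj ∈ I.interior M) ∧
      (γ (ℓ q)).proj ∈ ι '' V ∧ normalVelocity ρ F (γ (ℓ q)) ≠ 0 ∧
      IsRestriction ι (γ (ℓ q)) (S q)

/-- The conic set `Γ`: all `c • r` with `c > 0` and `r` on a unit bicharacteristic of `T*M` issued
from some unit covector in `𝒪` whose restriction to the boundary lies in `𝒰`. -/
def flowoutCone (ι : B → M) (F : CotangentBundle I M → ℝ) (𝒰 : Set (CotangentBundle (𝓡 m) B))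
    (𝒪 : Set (CotangentBundle I M)) : Set (CotangentBundle I M) :=
  {r | ∃ c : ℝ, 0 < c ∧ ∃ p ∈ 𝒪, p ∈ unitCosphere F ∧ (∃ q ∈ 𝒰, IsRestriction ι p q) ∧
    ∃ (T : ℝ) (γ : ℝ → CotangentBundle I M), 0 ≤ T ∧ γ 0 = p ∧
      IsBicharacteristicOn F γ (Icc 0 T) ∧ r = dilation c (γ T)}

end Boundary

section Canonical

variable {n : ℕ} {A : Type*} [TopologicalSpace A]
  {I : ModelWithCorners ℝ (EuclideanSpace ℝ (Fin n)) A}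
  {M : Type*} [TopologicalSpace M] [ChartedSpace A M] [IsManifold I ∞ M]
  {A' : Type*} [TopologicalSpace A'] {I' : ModelWithCorners ℝ (EuclideanSpace ℝ (Fin n)) A'}
  {M' : Type*} [TopologicalSpace M'] [ChartedSpace A' M'] [IsManifold I' ∞ M']

/-- `κ` restricts to a homogeneous canonical transformation from `Γ` onto `Γ'`: a diffeomorphism
that commutes with the dilations and preserves the symplectic forms. -/
structure IsHomogeneousCanonical (κ : CotangentBundle I M → CotangentBundle I' M')
    (Γ : Set (CotangentBundle I M)) (Γ' : Set (CotangentBundle I' M')) : Prop where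
  bijOn : BijOn κ Γ Γ'
  smooth : ContMDiffOn (cotangentModel I) (cotangentModel I') ∞ κ Γ
  smooth_inv : ∃ κ' : CotangentBundle I' M' → CotangentBundle I M,
    InvOn κ' κ Γ Γ' ∧ ContMDiffOn (cotangentModel I') (cotangentModel I) ∞ κ' Γ'
  homogeneous : ∀ p ∈ Γ, ∀ c : ℝ, 0 < c → κ (dilation c p) = dilation c (κ p)
  symplectic : ∀ p ∈ Γ, ∀ w w' : TangentSpace (cotangentModel I) p,
    symplecticForm (κ p)
      (mfderivWithin (cotangentModel I) (cotangentModel I') κ Γ p w)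
      (mfderivWithin (cotangentModel I) (cotangentModel I') κ Γ p w') = symplecticForm p w w'

end Canonical

end

/-! The cone Γ has global coordinates in which everything depends only on the common boundary data.
A point of Γ is determined by the triple (q, e, t): q is the restriction to the boundary of the
covector at which its bicharacteristic enters, e is the energy, and t is the time elapsed since
entrance. By homogeneity the admissible (q, e) are those with e > 0 and q/√(2e) ∈ 𝒰, and t runs over
[0, ℓ(q/√(2e))/√(2e)]. The Hamiltonian is e, a dilation by c acts by (cq, c²e, t/c), and the
symplectic form is σ − dt ∧ de with σ the form of the cotangent bundle of the boundary. The
coordinates of the two cones therefore have the same range, because the travel times agree, and κ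
sends each point to the point with the same coordinates. On Γ_U (t = 0) the restriction to the
boundary is q. On Γ_V (t maximal) it is the homogeneous extension of S, and only there do the
scattering relations enter.

The coordinates are injective because a ray meets the boundary only at its two ends, over the
disjoint sets U and V (`IsRayParam.injective`). At the entrance, transversality allows the covector
to be recovered smoothly from (q, e), and the recovery pulls the symplectic form back to σ since the
form ξ dx restricts to the boundary (`exists_initial_slice`). The flow preserves the symplectic
form, and dt ∧ de comes from differentiating in time (`IsFlowBox.normalForm`).

Smoothness up to the boundary is obtained by crossing it. In a chart the Hamiltonian extends past
the boundary to a C^(k+1) function, whose flow is C^k and symplectic (`exists_hamiltonian_flow`) and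
carries the bicharacteristics (`IsFlowBox.tracks`). Near each point of Γ this gives a C^k local
diffeomorphism A of (q, e, t) onto an open set of the full coordinate space. At both ends the normal
coordinate is strictly monotone in time, so A lands in the half-space exactly when 0 ≤ t ≤ ℓ
(`IsRayFamily.exists_normalForm`). No regularity of ℓ is assumed; the bounds on ℓ that are needed
come from the flow (`IsRayFamily.isRegularTime`). In charts κ is A' ∘ A⁻¹
(`IsRayParam.exists_transport_chart`). Although A depends on k, κ does not, so κ is smooth. -/

open Set Bundle
open scoped Manifold ContDiff Topology

noncomputable section

set_option synthInstance.maxHeartbeats 200000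

/-! ### Superposition operators on spaces of continuous maps -/

section Superposition

universe u

variable {K : Type*} [TopologicalSpace K] [CompactSpace K]

/-- The superposition operator `γ ↦ f ∘ γ` on continuous maps. -/
def superposition {E F : Type*} [TopologicalSpace E] [TopologicalSpace F] (f : C(E, F)) :
    C(K, E) → C(K, F) := fun γ ↦ f.comp γ

variable {E F : Type*} [NormedAddCommGroup E] [NormedSpace ℝ E]
  [NormedAddCommGroup F] [NormedSpace ℝ F]

/-- Pointwise application of a continuous family of linear maps, as a continuous linear map. -/
def pointwiseApply : C(K, E →L[ℝ] F) →L[ℝ] C(K, E) →L[ℝ] C(K, F) :=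
  LinearMap.mkContinuous₂
    (LinearMap.mk₂ ℝ (fun (A : C(K, E →L[ℝ] F)) (h : C(K, E)) ↦
        (⟨fun k ↦ A k (h k), by fun_prop⟩ : C(K, F)))
      (fun _ _ _ ↦ by ext; simp) (fun _ _ _ ↦ by ext; simp)
      (fun _ _ _ ↦ by ext; simp) (fun _ _ _ ↦ by ext; simp)) 1
    (fun A h ↦ by
      rw [one_mul, ContinuousMap.norm_le _ (by positivity)]
      intro k
      exact (A k).le_of_opNorm_le_of_le (A.norm_coe_le_norm k) (h.norm_coe_le_norm k))

@[simp]
theorem pointwiseApply_apply (A : C(K, E →L[ℝ] F)) (h : C(K, E)) (k : K) :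
    pointwiseApply A h k = A k (h k) := rfl

/-- Composition with f is continuous for the uniform metric because K is compact, so a single δ
serves all k without uniform continuity of f. -/
theorem exists_dist_comp_lt {E G : Type*} [NormedAddCommGroup E] [PseudoMetricSpace G]
    {f : E → G} (hf : Continuous f)
    (γ : C(K, E)) {c : ℝ} (hc : 0 < c) :
    ∃ δ > 0, ∀ g : C(K, E), dist g γ < δ → ∀ k, dist (f (g k)) (f (γ k)) < c := by
  have hcont : Continuous fun g : C(K, E) ↦ (⟨f, hf⟩ : C(E, G)).comp g :=
    ContinuousMap.continuous_postcomp _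
  obtain ⟨δ, hδ, hball⟩ := Metric.continuous_iff.1 hcont γ c hc
  exact ⟨δ, hδ, fun g hg k ↦ (ContinuousMap.dist_apply_le_dist k).trans_lt (hball g hg)⟩

/-- The mean value inequality bounds the remainder at k by the oscillation of f' near γ k, and
`exists_dist_comp_lt` makes this bound uniform in k. -/
theorem hasFDerivAt_superposition (f : C(E, F)) (f' : C(E, E →L[ℝ] F))
    (hf : ∀ x, HasFDerivAt f (f' x) x) (γ : C(K, E)) :
    HasFDerivAt (superposition f : C(K, E) → C(K, F))
      (pointwiseApply (superposition f' γ)) γ := by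
  rw [hasFDerivAt_iff_isLittleO_nhds_zero, Asymptotics.isLittleO_iff]
  intro c hc
  obtain ⟨δ, hδ, hball⟩ := exists_dist_comp_lt f'.continuous γ hc
  filter_upwards [Metric.ball_mem_nhds (0 : C(K, E)) hδ] with h hh
  rw [mem_ball_zero_iff] at hh
  rw [ContinuousMap.norm_le _ (by positivity)]
  intro k
  have hk : ‖h k‖ < δ := (h.norm_coe_le_norm k).trans_lt hh
  have key := (convex_ball (γ k) δ).norm_image_sub_le_of_norm_hasFDerivWithin_le'
    (f := f) (f' := f') (φ := f' (γ k)) (C := c) (x := γ k) (y := γ k + h k)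
    (fun x _ ↦ (hf x).hasFDerivWithinAt) ?_ (Metric.mem_ball_self hδ) (by simpa using hk)
  · have : ‖(f (γ k + h k) - f (γ k)) - f' (γ k) (h k)‖ ≤ c * ‖h k‖ := by simpa using key
    refine le_trans this ?_
    gcongr
    exact h.norm_coe_le_norm k
  · intro y hy
    -- The uniform estimate concerns curves near γ. The translate of γ by a constant that takes the
    -- value y at k transfers it to an arbitrary point y of the ball.
    have hd : dist (γ + ContinuousMap.const K (y - γ k)) γ < δ := by
      rw [dist_eq_norm, add_sub_cancel_left]
      exact ((ContinuousMap.norm_le _ (norm_nonneg _)).2 fun _ ↦ le_rfl).trans_lt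
        (by rwa [Metric.mem_ball, dist_eq_norm] at hy)
    simpa [dist_eq_norm] using (hball _ hd k).le

/-- The derivative is `pointwiseApply` after the superposition operator of f', so induction on n
applies with target `E →L[ℝ] F`. This change of target is why E and F share a universe. -/
theorem contDiff_superposition {E F : Type u} [NormedAddCommGroup E] [NormedSpace ℝ E]
    [NormedAddCommGroup F] [NormedSpace ℝ F] (n : ℕ) (f : C(E, F)) (hf : ContDiff ℝ n f) :
    ContDiff ℝ n (superposition f : C(K, E) → C(K, F)) := by
  induction n generalizing F with
  | zero =>
    exact contDiff_zero.2 (ContinuousMap.continuous_postcomp f)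
  | succ n ih =>
    obtain ⟨f', hf', hd⟩ := contDiff_succ_iff_hasFDerivAt.1 hf
    refine contDiff_succ_iff_hasFDerivAt.2 ⟨_, ?_, fun γ ↦
      hasFDerivAt_superposition f ⟨f', hf'.continuous⟩ hd γ⟩
    exact pointwiseApply.contDiff.comp (ih ⟨f', hf'.continuous⟩ hf')

end Superposition

/-! ### Smooth dependence of a flow on initial point and time -/

section LocalFlow

universe u

variable {E : Type u} [NormedAddCommGroup E] [NormedSpace ℝ E]

/-- The primitive `s ↦ ∫₀ˢ γ` of a continuous curve on the unit interval. -/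
def primitive : C(unitInterval, E) →L[ℝ] C(unitInterval, E) :=
  LinearMap.mkContinuous
    { toFun := fun γ ↦ ⟨fun s ↦ ∫ r in (0 : ℝ)..s, γ (projIcc 0 1 zero_le_one r), by
        have hc : Continuous fun r : ℝ ↦ γ (projIcc 0 1 zero_le_one r) := by fun_prop
        exact (intervalIntegral.continuous_primitive
          (fun a b ↦ hc.intervalIntegrable a b) 0).comp continuous_subtype_val⟩
      map_add' := fun γ δ ↦ by
        ext s
        have hc (γ : C(unitInterval, E)) :
            Continuous fun r : ℝ ↦ γ (projIcc 0 1 zero_le_one r) := by fun_prop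
        exact intervalIntegral.integral_add ((hc γ).intervalIntegrable _ _)
          ((hc δ).intervalIntegrable _ _)
      map_smul' := fun c γ ↦ by
        ext s
        exact intervalIntegral.integral_smul _ _ }
    1 (fun γ ↦ by
      rw [one_mul, ContinuousMap.norm_le _ (norm_nonneg _)]
      intro s
      refine (intervalIntegral.norm_integral_le_of_norm_le_const
        (fun r _ ↦ γ.norm_coe_le_norm _)).trans ?_
      have : |(s : ℝ) - 0| ≤ 1 := by
        rw [sub_zero, abs_of_nonneg s.2.1]; exact s.2.2
      exact mul_le_of_le_one_right (norm_nonneg _) this)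

/-- The integral equation `γ = x + t ∫ f(γ)` as a map. -/
def flowEquation (f : C(E, E)) (u : (E × ℝ) × C(unitInterval, E)) : C(unitInterval, E) :=
  u.2 - ContinuousMap.const _ u.1.1 - u.1.2 • primitive (superposition f u.2)

theorem contDiff_flowEquation {k : ℕ} (f : C(E, E)) (hf : ContDiff ℝ k f) :
    ContDiff ℝ k (flowEquation f) := by
  have h1 : ContDiff ℝ k (fun u : (E × ℝ) × C(unitInterval, E) ↦ ContinuousMap.const unitInterval u.1.1) :=
    (ContinuousLinearMap.const ℝ unitInterval (M := E)).contDiff.comp (contDiff_fst.comp contDiff_fst)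
  have h2 : ContDiff ℝ k (fun u : (E × ℝ) × C(unitInterval, E) ↦ primitive (superposition f u.2)) :=
    primitive.contDiff.comp ((contDiff_superposition k f hf).comp contDiff_snd)
  exact (contDiff_snd.sub h1).sub ((contDiff_snd.comp contDiff_fst).smul h2)

/-- Time is rescaled to [0, 1], so that a solution becomes a curve with γ = x + t ∫ f(γ), an
equation of class C^k in a Banach space with parameters (x, t). The implicit function theorem solves
it with C^k dependence, and its local uniqueness identifies the result with the Picard–Lindelöf
flow. -/
theorem exists_contDiff_flow [CompleteSpace E] {k : ℕ} (hk : k ≠ 0) (f : E → E)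
    (hf : ContDiff ℝ k f) (x₀ : E) :
    ∃ Φ : E × ℝ → E, ContDiffAt ℝ k Φ (x₀, 0) ∧ ∃ ε > 0, ∀ x ∈ Metric.ball x₀ ε,
      Φ (x, 0) = x ∧ ∀ t ∈ Ioo (-ε) ε, HasDerivAt (fun s ↦ Φ (x, s)) (f (Φ (x, t))) t := by
  have hkω : (k : WithTop ℕ∞) ≠ 0 := by exact_mod_cast hk
  have hone : (1 : WithTop ℕ∞) ≤ k := by exact_mod_cast Nat.one_le_iff_ne_zero.2 hk
  obtain ⟨ε, hε, a, r, L, K, hr, hpl⟩ := IsPicardLindelof.of_contDiffAt_one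
    (hf.contDiffAt (x := x₀) |>.of_le hone)
  obtain ⟨α, hα, hαc⟩ := (hpl 0).exists_forall_mem_closedBall_eq_hasDerivWithinAt_continuousOn
  simp only [zero_sub, zero_add] at hα hαc
  have hα0 : ∀ x ∈ Metric.closedBall x₀ r, α (x, 0) = x := fun x hx ↦ (hα x hx).1
  have hr' : (0 : ℝ) < r := hr
  have hder : ∀ x ∈ Metric.ball x₀ r, ∀ t ∈ Ioo (-ε) ε,
      HasDerivAt (fun s ↦ α (x, s)) (f (α (x, t))) t := fun x hx t ht ↦
    ((hα x (Metric.ball_subset_closedBall hx)).2 t (Ioo_subset_Icc_self ht)).hasDerivAt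
      (Icc_mem_nhds ht.1 ht.2)
  let fc : C(E, E) := ⟨f, hf.continuous⟩
  let u₀ : (E × ℝ) × C(unitInterval, E) := ((x₀, 0), ContinuousMap.const _ x₀)
  have hG : ContDiffAt ℝ k (flowEquation fc) u₀ := (contDiff_flowEquation fc hf).contDiffAt
  -- At t = 0 the integral term disappears, and the derivative of the equation in γ is the identity.
  have hinv : (fderiv ℝ (flowEquation fc) u₀ ∘L .inr ℝ (E × ℝ) C(unitInterval, E)).IsInvertible := by
    have h1 : HasFDerivAt (fun γ ↦ flowEquation fc ((x₀, 0), γ))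
        (fderiv ℝ (flowEquation fc) u₀ ∘L .inr ℝ (E × ℝ) C(unitInterval, E))
        (ContinuousMap.const _ x₀) :=
      ((hG.differentiableAt hkω).hasFDerivAt).comp (ContinuousMap.const unitInterval x₀)
        (hasFDerivAt_prodMk_right (x₀, (0 : ℝ)) (ContinuousMap.const unitInterval x₀))
    have h2 : HasFDerivAt (fun γ ↦ flowEquation fc ((x₀, 0), γ))
        (ContinuousLinearMap.id ℝ C(unitInterval, E)) (ContinuousMap.const _ x₀) := by
      have : (fun γ ↦ flowEquation fc ((x₀, 0), γ)) = fun γ ↦ γ - ContinuousMap.const _ x₀ := by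
        funext γ; simp [flowEquation]
      rw [this]
      exact (hasFDerivAt_id _).sub_const _
    rw [h1.unique h2]
    exact ⟨ContinuousLinearEquiv.refl ℝ _, rfl⟩
  have hG0 : flowEquation fc u₀ = 0 := by ext; simp [flowEquation, u₀]
  have hψ := hG.contDiffAt_implicitFunction hkω hinv
  have hiff := hG.eventually_apply_eq_iff_implicitFunction hkω hinv
  set ψ := hG.implicitFunction hkω hinv
  obtain ⟨δ, hδ, hδiff⟩ := Metric.eventually_nhds_iff_ball.1 hiff
  have hcat : ContinuousAt α (x₀, 0) := hαc.continuousAt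
    (prod_mem_nhds (Metric.closedBall_mem_nhds _ hr') (Icc_mem_nhds (by linarith) hε))
  -- Half of δ, because a pointwise bound yields only a non-strict bound on the uniform distance.
  obtain ⟨η, hη, hηball⟩ := Metric.continuousAt_iff.1 hcat (δ / 2) (by positivity)
  rw [hα0 x₀ (Metric.mem_closedBall_self hr'.le)] at hηball
  set θ := min (min η δ) (min r ε) with hθ
  have hθ0 : 0 < θ := by positivity
  have hθη : θ ≤ η := (min_le_left _ _).trans (min_le_left _ _)
  have hθδ : θ ≤ δ := (min_le_left _ _).trans (min_le_right _ _)
  have hθr : θ ≤ r := (min_le_right _ _).trans (min_le_left _ _)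
  have hθε : θ ≤ ε := (min_le_right _ _).trans (min_le_right _ _)
  -- The rescaled curve s ↦ α(x, ts) solves the equation and stays close to the constant curve, so
  -- it is the implicit function at (x, t); evaluation at s = 1 recovers α.
  have heq : ∀ x ∈ Metric.ball x₀ θ, ∀ t ∈ Ioo (-θ) θ, α (x, t) = ψ (x, t) 1 := by
    intro x hx t ht
    have habs : |t| < θ := abs_lt.2 ht
    have hts : ∀ s : unitInterval, |t * s| < θ := fun s ↦ by
      rw [abs_mul, abs_of_nonneg s.2.1]
      exact (mul_le_of_le_one_right (abs_nonneg _) s.2.2).trans_lt habs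
    have hxr : x ∈ Metric.ball x₀ r := Metric.ball_subset_ball hθr hx
    have hder' : ∀ s : unitInterval, HasDerivAt (fun s ↦ α (x, s)) (f (α (x, t * s))) (t * s) :=
      fun s ↦ hder x hxr _ ((abs_lt.1 ((hts s).trans_le hθε)))
    have hcs : Continuous fun s : unitInterval ↦ α (x, t * s) := by
      refine continuous_iff_continuousAt.2 fun s ↦ ?_
      exact ContinuousAt.comp (f := fun s : unitInterval ↦ t * (s : ℝ)) (hder' s).continuousAt
        (by fun_prop)
    let γ : C(unitInterval, E) := ⟨fun s ↦ α (x, t * s), hcs⟩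
    have hsol : flowEquation fc ((x, t), γ) = 0 := by
      ext s
      have hd : ∀ ρ ∈ Set.uIcc (0 : ℝ) s, HasDerivAt (fun ρ ↦ α (x, t * ρ))
          (t • f (γ (projIcc 0 1 zero_le_one ρ))) ρ := by
        intro ρ hρ
        rw [Set.uIcc_of_le s.2.1] at hρ
        have hρ1 : ρ ∈ Icc (0 : ℝ) 1 := ⟨hρ.1, hρ.2.trans s.2.2⟩
        rw [projIcc_of_mem _ hρ1]
        have h0 := hder' ⟨ρ, hρ1⟩
        have h1 : HasDerivAt (fun ρ : ℝ ↦ t * ρ) t ρ := by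
          simpa using (hasDerivAt_id ρ).const_mul t
        exact HasDerivAt.scomp ρ h0 h1
      have hcont : Continuous fun ρ : ℝ ↦ t • f (γ (projIcc 0 1 zero_le_one ρ)) := by
        have := hf.continuous
        fun_prop
      have hint := intervalIntegral.integral_eq_sub_of_hasDerivAt hd
        (hcont.intervalIntegrable _ _)
      rw [intervalIntegral.integral_smul, mul_zero,
        hα0 x (Metric.ball_subset_closedBall hxr)] at hint
      change α (x, t * s) - x - t • (∫ ρ in (0 : ℝ)..s, f (γ (projIcc 0 1 zero_le_one ρ))) = 0
      rw [hint]; simp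
    have hmem : ((x, t), γ) ∈ Metric.ball u₀ δ := by
      rw [Metric.mem_ball, Prod.dist_eq, Prod.dist_eq, max_lt_iff, max_lt_iff]
      refine ⟨⟨(Metric.mem_ball.1 hx).trans_le hθδ, ?_⟩, ?_⟩
      · simpa [u₀] using habs.trans_le hθδ
      · refine lt_of_le_of_lt ((ContinuousMap.dist_le (by positivity)).2 fun s ↦ ?_)
          (half_lt_self hδ)
        refine (hηball ?_).le
        rw [Prod.dist_eq, max_lt_iff]
        exact ⟨(Metric.mem_ball.1 hx).trans_le hθη, by simpa using (hts s).trans_le hθη⟩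
    have := (hδiff _ hmem).1 (by rw [hsol, hG0])
    change ψ (x, t) = γ at this
    rw [this]
    simp [γ]
  refine ⟨α, ?_, θ, hθ0, fun x hx ↦ ⟨hα0 x (Metric.ball_subset_closedBall
    (Metric.ball_subset_ball hθr hx)), fun t ht ↦ hder x (Metric.ball_subset_ball hθr hx) t
      ⟨by linarith [ht.1], by linarith [ht.2]⟩⟩⟩
  have hev : ContDiffAt ℝ k (fun v : E × ℝ ↦ ψ v 1) (x₀, 0) :=
    ContDiffAt.comp (g := (ContinuousMap.evalCLM ℝ (1 : unitInterval) : C(unitInterval, E) →L[ℝ] E))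
      (f := ψ) (x₀, 0) (ContinuousLinearMap.contDiff _).contDiffAt hψ
  refine hev.congr_of_eventuallyEq ?_
  filter_upwards [prod_mem_nhds (Metric.ball_mem_nhds x₀ hθ0) (Ioo_mem_nhds (neg_lt_zero.2 hθ0) hθ0)]
    with v hv
  exact heq v.1 hv.1 v.2 hv.2

end LocalFlow

/-! ### Extension of functions across the boundary of a half-space -/

section HalfSpaceExtension

universe u

variable {E : Type u} [NormedAddCommGroup E] [NormedSpace ℝ E] (L : E →L[ℝ] ℝ) (e : E)

/-- The extension of `f` from the half-space `0 ≤ L` by weighted reflections along `e`. -/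
def reflectExtend {F : Type*} [AddCommGroup F] [Module ℝ F] {N : ℕ} (a b : Fin N → ℝ) (f : E → F)
    (x : E) : F :=
  open Classical in
  if 0 ≤ L x then f x else ∑ j, a j • f (x - ((1 + b j) * L x) • e)

variable {L e}

section

variable {F : Type*} [AddCommGroup F] [Module ℝ F] {N : ℕ} {a b : Fin N → ℝ}

theorem reflectExtend_of_nonneg (f : E → F) {x : E} (hx : 0 ≤ L x) :
    reflectExtend L e a b f x = f x := if_pos hx

theorem reflectExtend_of_nonpos (ha : ∑ j, a j = 1) (f : E → F) {x : E} (hx : L x ≤ 0) :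
    reflectExtend L e a b f x = ∑ j, a j • f (x - ((1 + b j) * L x) • e) := by
  rcases hx.lt_or_eq with h | h
  · exact if_neg (not_le.2 h)
  · rw [reflectExtend_of_nonneg f h.ge]
    simp [h, ← Finset.sum_smul, ha]

end

theorem apply_reflect_nonneg (he : L e = 1) {b : ℝ} (hb : 0 < b) {x : E} (hx : L x ≤ 0) :
    0 ≤ L (x - ((1 + b) * L x) • e) := by
  simp only [map_sub, map_smul, he, smul_eq_mul, mul_one]
  nlinarith

theorem uniqueDiffOn_halfSpace (he : L e = 1) : UniqueDiffOn ℝ {x | 0 ≤ L x} := by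
  refine uniqueDiffOn_convex ?_ ⟨e, ?_⟩
  · exact (convex_Ici (0 : ℝ)).linear_preimage L.toLinearMap
  · refine mem_interior.2 ⟨{x | 0 < L x}, fun x (hx : 0 < L x) ↦ hx.le, isOpen_lt continuous_const
      L.continuous, ?_⟩
    simp [he]

/-- On the reflected point L takes the value −b_j L x, so the i-th moment condition on the weights
matches the i-th normal derivatives along the hyperplane. Differentiation replaces the weights a_j
by −a_j b_j in some of the terms, which shifts the moments by one and makes the induction on k work.
-/
theorem contDiff_reflectExtend (he : L e = 1) {N : ℕ} {b : Fin N → ℝ} (hb : ∀ j, 0 < b j) (k : ℕ)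
    {F : Type u} [NormedAddCommGroup F] [NormedSpace ℝ F] {a : Fin N → ℝ}
    (ha : ∀ i ≤ k, ∑ j, a j * (-b j) ^ i = 1) {f : E → F}
    (hf : ContDiffOn ℝ k f {x | 0 ≤ L x}) : ContDiff ℝ k (reflectExtend L e a b f) := by
  induction k generalizing F a with
  | zero =>
    have ha0 : ∑ j, a j = 1 := by simpa using ha 0 le_rfl
    refine contDiff_zero.2 ?_
    rw [← continuousOn_univ, show (univ : Set E) = {x | 0 ≤ L x} ∪ {x | L x ≤ 0} from
      (eq_univ_of_forall fun x ↦ le_total 0 (L x)).symm]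
    have hf0 : ContinuousOn f {x | 0 ≤ L x} := hf.continuousOn
    refine ContinuousOn.union_of_isClosed (hf0.congr fun x hx ↦ reflectExtend_of_nonneg f hx)
      (ContinuousOn.congr ?_ fun x hx ↦ reflectExtend_of_nonpos ha0 f hx)
      (isClosed_le continuous_const L.continuous) (isClosed_le L.continuous continuous_const)
    refine continuousOn_finsetSum _ fun j _ ↦ ContinuousOn.const_smul ?_ _
    exact hf0.comp (by fun_prop) fun x hx ↦ apply_reflect_nonneg he (hb j) hx
  | succ k ih =>
    have ha0 : ∑ j, a j = 1 := by simpa using ha 0 (Nat.zero_le _)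
    have ha' : ∀ i ≤ k, ∑ j, (-(a j * b j)) * (-b j) ^ i = 1 := fun i hi ↦ by
      rw [← ha (i + 1) (by omega)]
      exact Finset.sum_congr rfl fun j _ ↦ by ring
    have ha0' : ∑ j, -(a j * b j) = 1 := by simpa using ha' 0 (Nat.zero_le _)
    have hu := uniqueDiffOn_halfSpace he
    obtain ⟨hd, -, hf'⟩ := (contDiffOn_succ_iff_fderivWithin (n := k) hu).1
      (by exact_mod_cast hf)
    set D := fderivWithin ℝ f {x | 0 ≤ L x} with hD
    have hfe : ContDiffOn ℝ k (fun x ↦ D x e) {x | 0 ≤ L x} := hf'.clm_apply contDiffOn_const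
    -- The j-th reflected term has derivative D − (1 + b_j) L ⊗ D e, and summation gives this
    -- candidate. On the half-space the two terms in D e cancel and D remains.
    refine contDiff_succ_iff_hasFDerivAt.2 ⟨fun x ↦ reflectExtend L e a b D x +
      L.smulRight (reflectExtend L e (fun j ↦ -(a j * b j)) b (fun x ↦ D x e) x -
        reflectExtend L e a b (fun x ↦ D x e) x), ?_, fun x ↦ ?_⟩
    · refine (ih (fun i hi ↦ ha i (by omega)) hf').add ?_
      exact ((ContinuousLinearMap.smulRightL ℝ E F L).contDiff).comp
        ((ih ha' hfe).sub (ih (fun i hi ↦ ha i (by omega)) hfe))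
    · rw [← hasFDerivWithinAt_univ, show (univ : Set E) = {x | 0 ≤ L x} ∪ {x | L x ≤ 0} from
        (eq_univ_of_forall fun x ↦ le_total 0 (L x)).symm]
      refine HasFDerivWithinAt.union ?_ ?_
      · by_cases hx : 0 ≤ L x
        · simp only [reflectExtend_of_nonneg _ hx, sub_self]
          rw [show L.smulRight (0 : F) = 0 by ext; simp, add_zero]
          exact ((hd x hx).hasFDerivWithinAt).congr (fun y hy ↦ reflectExtend_of_nonneg f hy)
            (reflectExtend_of_nonneg f hx)
        · refine HasFDerivWithinAt.of_notMem_closure ?_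
          rwa [(isClosed_le continuous_const L.continuous).closure_eq]
      · by_cases hx : L x ≤ 0
        · simp only [reflectExtend_of_nonpos ha0 _ hx, reflectExtend_of_nonpos ha0' _ hx]
          refine HasFDerivWithinAt.congr ?_ (fun y hy ↦ reflectExtend_of_nonpos ha0 f hy)
            (reflectExtend_of_nonpos ha0 f hx)
          have hj : ∀ j, HasFDerivWithinAt (fun y ↦ f (y - ((1 + b j) * L y) • e))
              ((D (x - ((1 + b j) * L x) • e)).comp
                (ContinuousLinearMap.id ℝ E - ((1 + b j) • L).smulRight e)) {x | L x ≤ 0} x := by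
            intro j
            have hl : HasFDerivWithinAt (fun y ↦ y - ((1 + b j) * L y) • e)
                (ContinuousLinearMap.id ℝ E - ((1 + b j) • L).smulRight e) {x | L x ≤ 0} x := by
              exact (ContinuousLinearMap.id ℝ E - ((1 + b j) • L).smulRight e).hasFDerivWithinAt
            exact ((hd _ (apply_reflect_nonneg he (hb j) hx)).hasFDerivWithinAt).comp x hl
              fun y hy ↦ apply_reflect_nonneg he (hb j) hy
          have hs := HasFDerivWithinAt.fun_sum (u := Finset.univ)
            fun j _ ↦ (hj j).const_smul (a j)
          refine hs.congr_fderiv ?_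
          ext v
          simp only [sum_apply, smul_apply,
            ContinuousLinearMap.comp_apply, sub_apply,
            ContinuousLinearMap.id_apply, ContinuousLinearMap.smulRight_apply, smul_eq_mul,
            map_sub, map_smul, add_apply, ← Finset.sum_sub_distrib,
            Finset.smul_sum, ← Finset.sum_add_distrib]
          exact Finset.sum_congr rfl fun j _ ↦ by module
        · refine HasFDerivWithinAt.of_notMem_closure ?_
          rwa [(isClosed_le L.continuous continuous_const).closure_eq]

/-- The moment conditions are a Vandermonde system with the distinct nodes −1, …, −(k + 1). -/
theorem exists_reflection_weights (k : ℕ) :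
    ∃ a : Fin (k + 1) → ℝ, ∀ i ≤ k, ∑ j, a j * (-((j : ℝ) + 1)) ^ i = 1 := by
  let V := Matrix.vandermonde fun j : Fin (k + 1) ↦ -((j : ℝ) + 1)
  have hV : IsUnit V.det := by
    rw [isUnit_iff_ne_zero]
    refine Matrix.det_vandermonde_ne_zero_iff.2 fun i j hij ↦ ?_
    have : (i : ℝ) = j := by simpa using hij
    exact Fin.ext (by exact_mod_cast this)
  refine ⟨Matrix.vecMul 1 V⁻¹, fun i hi ↦ ?_⟩
  have h : Matrix.vecMul (Matrix.vecMul 1 V⁻¹) V = 1 := by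
    rw [Matrix.vecMul_vecMul, Matrix.nonsing_inv_mul _ hV, Matrix.vecMul_one]
  exact congrFun h ⟨i, by omega⟩

/-- A `C^k` function on a half-space is locally the restriction of a global `C^k` function. -/
theorem ContDiffWithinAt.exists_contDiff_extension [FiniteDimensional ℝ E] (he : L e = 1) {k : ℕ}
    {F : Type u} [NormedAddCommGroup F] [NormedSpace ℝ F] {f : E → F} {x₀ : E} (hx₀ : 0 ≤ L x₀)
    (hf : ContDiffWithinAt ℝ k f {x | 0 ≤ L x} x₀) :
    ∃ g : E → F, ContDiff ℝ k g ∧ g =ᶠ[𝓝[{x | 0 ≤ L x}] x₀] f := by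
  obtain ⟨u, hu, hxu, hfu⟩ := hf.contDiffOn' le_rfl (by simp)
  rw [insert_eq_of_mem (show x₀ ∈ {x | 0 ≤ L x} from hx₀)] at hfu
  obtain ⟨r, hr, hru⟩ := Metric.isOpen_iff.1 hu x₀ hxu
  -- Multiplied by χ, f becomes C^k on the whole half-space, as required for reflection, and is
  -- unchanged on the ball of radius r/3.
  let χ : ContDiffBump x₀ := ⟨r / 3, r / 2, by positivity, by linarith⟩
  have hχf : ContDiffOn ℝ k (fun x ↦ χ x • f x) {x | 0 ≤ L x} := by
    intro x hx
    by_cases hxr : x ∈ Metric.ball x₀ r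
    · exact χ.contDiff.contDiffWithinAt.smul
        ((hfu x ⟨hx, hru hxr⟩).mono_of_mem_nhdsWithin
          (inter_mem_nhdsWithin _ (hu.mem_nhds (hru hxr))))
    · have hx0 : (fun x ↦ χ x • f x) =ᶠ[𝓝 x] fun _ ↦ 0 := by
        have : (Metric.closedBall x₀ (r / 2))ᶜ ∈ 𝓝 x := by
          refine Metric.isClosed_closedBall.isOpen_compl.mem_nhds ?_
          simp only [Metric.mem_ball, not_lt] at hxr
          simp only [mem_compl_iff, Metric.mem_closedBall, not_le]
          linarith
        filter_upwards [this] with y hy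
        have hy' : r / 2 < Dist.dist y x₀ := by simpa using hy
        rw [χ.zero_of_le_dist hy'.le, zero_smul]
      exact (contDiffAt_const.congr_of_eventuallyEq hx0).contDiffWithinAt
  obtain ⟨a, ha⟩ := exists_reflection_weights k
  refine ⟨_, contDiff_reflectExtend he (fun j ↦ by positivity) k ha hχf, ?_⟩
  filter_upwards [self_mem_nhdsWithin, mem_nhdsWithin_of_mem_nhds
    (Metric.closedBall_mem_nhds x₀ χ.rIn_pos)] with x hx hxr
  rw [reflectExtend_of_nonneg _ hx, χ.one_of_mem_closedBall hxr, one_smul]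

end HalfSpaceExtension

/-! ### Auxiliary instances -/

section ShortcutInstances

/-- The topology of the cotangent bundle, as a shortcut for instance search. -/
abbrev cotangentTopology {n : ℕ} {A : Type*} [TopologicalSpace A]
    (I : ModelWithCorners ℝ (EuclideanSpace ℝ (Fin n)) A)
    (M : Type*) [TopologicalSpace M] [ChartedSpace A M] [IsManifold I ∞ M] :
    TopologicalSpace (CotangentBundle I M) := inferInstance

/-- The norm on linear endomorphisms of the model space, as a shortcut for instance search. -/
abbrev modelEndNorm (n n' : ℕ) : NormedAddCommGroup
    (ModelVec n × ModelCovec n →L[ℝ] ModelVec n' × ModelCovec n') := inferInstance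

theorem modelContinuousSMul (n : ℕ) : ContinuousSMul ℝ (ModelVec n × ModelCovec n) := inferInstance

end ShortcutInstances

attribute [local instance] cotangentTopology modelEndNorm modelContinuousSMul

/-! ### Linear symplectic algebra and Hamiltonian flows -/

section Symplectic

variable {n : ℕ}

/-- The standard symplectic form on `ℝⁿ × (ℝⁿ)*`. -/
def stdSymplectic (a b : ModelVec n × ModelCovec n) : ℝ := a.2 b.1 - b.2 a.1

theorem stdSymplectic_swap (a b : ModelVec n × ModelCovec n) :
    stdSymplectic a b = -stdSymplectic b a := by
  simp [stdSymplectic]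

theorem stdSymplectic_self (a : ModelVec n × ModelCovec n) : stdSymplectic a a = 0 := by
  simp [stdSymplectic]

theorem stdSymplectic_add_left (a a' b : ModelVec n × ModelCovec n) :
    stdSymplectic (a + a') b = stdSymplectic a b + stdSymplectic a' b := by
  simp [stdSymplectic]; ring

theorem stdSymplectic_smul_left (c : ℝ) (a b : ModelVec n × ModelCovec n) :
    stdSymplectic (c • a) b = c * stdSymplectic a b := by
  simp [stdSymplectic]; ring

theorem stdSymplectic_add_right (a b b' : ModelVec n × ModelCovec n) :
    stdSymplectic a (b + b') = stdSymplectic a b + stdSymplectic a b' := by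
  simp [stdSymplectic]; ring

theorem stdSymplectic_smul_right (c : ℝ) (a b : ModelVec n × ModelCovec n) :
    stdSymplectic a (c • b) = c * stdSymplectic a b := by
  simp [stdSymplectic]; ring

theorem eq_zero_of_stdSymplectic_eq_zero {a : ModelVec n × ModelCovec n}
    (h : ∀ b, stdSymplectic a b = 0) : a = 0 := by
  have h2 : a.2 = 0 := by
    ext v
    simpa [stdSymplectic] using h (v, 0)
  have h1 : a.1 = 0 := by
    ext i
    simpa [stdSymplectic] using h (0, EuclideanSpace.proj i)
  exact Prod.ext h1 h2

/-- The vector `(F_ξ, -F_x)` that represents the linear form `-(F_x, F_ξ)` through the symplectic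
form. -/
def hamiltonianVector : (ModelVec n × ModelCovec n →L[ℝ] ℝ) →L[ℝ] ModelVec n × ModelCovec n :=
  let T : (ModelVec n × ModelCovec n →L[ℝ] ℝ) →ₗ[ℝ] ModelVec n × ModelCovec n :=
    { toFun := fun A : ModelVec n × ModelCovec n →L[ℝ] ℝ ↦
        ((WithLp.toLp 2 (fun i ↦ A (0, EuclideanSpace.proj i)),
          -(A.comp (ContinuousLinearMap.inl ℝ (ModelVec n) (ModelCovec n)))) :
          ModelVec n × ModelCovec n)
      map_add' := fun A A' ↦ by
        refine Prod.ext ?_ ?_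
        · ext; simp
        · ext; simp; ring
      map_smul' := fun c A ↦ by
        refine Prod.ext ?_ ?_ <;> ext <;> simp }
  have hT : Continuous T := by
    refine Continuous.prodMk ?_ ?_
    · refine (PiLp.continuous_toLp 2 _).comp (continuous_pi fun i ↦ ?_)
      exact (ContinuousLinearMap.apply ℝ ℝ ((0, EuclideanSpace.proj i) :
        ModelVec n × ModelCovec n)).continuous
    · exact (((ContinuousLinearMap.compL ℝ (ModelVec n) (ModelVec n × ModelCovec n) ℝ).flip
        (ContinuousLinearMap.inl ℝ (ModelVec n) (ModelCovec n))).continuous).neg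
  ⟨T, hT⟩

theorem hamiltonianVector_apply (A : ModelVec n × ModelCovec n →L[ℝ] ℝ) :
    hamiltonianVector A = (WithLp.toLp 2 (fun i ↦ A (0, EuclideanSpace.proj i)),
        -(A.comp (ContinuousLinearMap.inl ℝ (ModelVec n) (ModelCovec n)))) := rfl

/-- Both sides are linear in ξ, and on coordinate forms the identity is the definition of
`hamiltonianVector`. -/
theorem apply_hamiltonianVector_fst (A : ModelVec n × ModelCovec n →L[ℝ] ℝ) (ξ : ModelCovec n) :
    ξ (hamiltonianVector A).1 = A (0, ξ) := by
  have hξ : ξ = ∑ i, ξ (EuclideanSpace.single i 1) • EuclideanSpace.proj (𝕜 := ℝ) i := by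
    ext v
    conv_lhs => rw [← (EuclideanSpace.basisFun (Fin n) ℝ).sum_repr v]
    simp [mul_comm]
  have h0 : A (0, ξ) = (A.comp (ContinuousLinearMap.inr ℝ (ModelVec n) (ModelCovec n))) ξ := by
    simp
  rw [h0]
  conv_lhs => rw [hξ]
  conv_rhs => rw [hξ]
  simp [hamiltonianVector_apply, map_sum]

/-- Together with nondegeneracy this characterises the Hamiltonian vector without coordinates; all
later invariance statements rest on it. -/
theorem stdSymplectic_hamiltonianVector (A : ModelVec n × ModelCovec n →L[ℝ] ℝ)
    (b : ModelVec n × ModelCovec n) : stdSymplectic (hamiltonianVector A) b = -A b := by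
  rw [stdSymplectic, apply_hamiltonianVector_fst, show A b = A (b.1, 0) + A (0, b.2) by
    rw [← map_add]; simp]
  simp [hamiltonianVector_apply]
  ring

theorem apply_hamiltonianVector_self (A : ModelVec n × ModelCovec n →L[ℝ] ℝ) :
    A (hamiltonianVector A) = 0 := by
  have := stdSymplectic_hamiltonianVector A (hamiltonianVector A)
  rw [stdSymplectic_self] at this
  linarith

/-- The symplectic form is the differential of the one-form ξ dx, which is pulled back to β. The
second derivatives of x produced by the product rule cancel by symmetry. Working within s allows
boundary points, where symmetry requires p to be a limit of interior points. -/
theorem stdSymplectic_pullback {W : Type*} [NormedAddCommGroup W] [NormedSpace ℝ W]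
    {s : Set W} (hs : UniqueDiffOn ℝ s) {p : W} (hp : p ∈ s) (hp' : p ∈ closure (interior s))
    {x : W → ModelVec n} {ξ : W → ModelCovec n} {β : W → W →L[ℝ] ℝ}
    (hx : ContDiffWithinAt ℝ 2 x s p) (hξ : DifferentiableWithinAt ℝ ξ s p)
    (hβ : β =ᶠ[𝓝[s] p] fun w ↦ (ξ w).comp (fderivWithin ℝ x s w)) (a b : W) :
    stdSymplectic (fderivWithin ℝ (fun w ↦ (x w, ξ w)) s p a)
      (fderivWithin ℝ (fun w ↦ (x w, ξ w)) s p b) =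
      fderivWithin ℝ β s p a b - fderivWithin ℝ β s p b a := by
  have hx1 : DifferentiableWithinAt ℝ x s p := hx.differentiableWithinAt (by simp)
  have hdx : DifferentiableWithinAt ℝ (fderivWithin ℝ x s) s p :=
    (hx.fderivWithin_right (m := 1) hs (by norm_num) hp).differentiableWithinAt (by simp)
  have hsymm : IsSymmSndFDerivWithinAt ℝ x s p :=
    hx.isSymmSndFDerivWithinAt (by simp) hs hp' hp
  have hder : HasFDerivWithinAt β _ s p :=
    ((hξ.hasFDerivWithinAt).clm_comp hdx.hasFDerivWithinAt).congr_of_eventuallyEq hβ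
      (hβ.self_of_nhdsWithin hp)
  rw [hder.fderivWithin (hs p hp), (hx1.hasFDerivWithinAt.prodMk hξ.hasFDerivWithinAt).fderivWithin
    (hs p hp)]
  have := hsymm a b
  simp [stdSymplectic, this]

/-- Symmetry of the second derivative of Φ exchanges the derivative in time with the one in the
direction a; the flow equation and the chain rule then give the linearised equation. -/
theorem fderiv_flow_time_derivative {E : Type*} [NormedAddCommGroup E] [NormedSpace ℝ E]
    {X : E → E} {Φ : E × ℝ → E} {z : E} {t : ℝ} (hX : DifferentiableAt ℝ X (Φ (z, t)))
    (hΦ : ContDiffAt ℝ 2 Φ (z, t))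
    (hflow : ∀ᶠ p in 𝓝 (z, t), HasDerivAt (fun s ↦ Φ (p.1, s)) (X (Φ p)) p.2) (a : E) :
    HasDerivAt (fun s ↦ fderiv ℝ Φ (z, s) (a, 0))
      (fderiv ℝ X (Φ (z, t)) (fderiv ℝ Φ (z, t) (a, 0))) t := by
  have hdd : DifferentiableAt ℝ (fderiv ℝ Φ) (z, t) :=
    (hΦ.fderiv_right (m := 1) (by norm_num)).differentiableAt (by simp)
  have hd : DifferentiableAt ℝ Φ (z, t) := hΦ.differentiableAt (by simp)
  have hsymm : IsSymmSndFDerivAt ℝ Φ (z, t) := hΦ.isSymmSndFDerivAt (by simp)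
  have h1 : HasDerivAt (fun s : ℝ ↦ (z, s)) ((0 : E), (1 : ℝ)) t :=
    (hasDerivAt_const t z).prodMk (hasDerivAt_id t)
  have h2 : HasDerivAt (fun s ↦ fderiv ℝ Φ (z, s) (a, 0))
      (fderiv ℝ (fderiv ℝ Φ) (z, t) (0, 1) (a, 0)) t := by
    have h3 : HasDerivAt (fun s ↦ fderiv ℝ Φ (z, s)) (fderiv ℝ (fderiv ℝ Φ) (z, t) (0, 1)) t :=
      hdd.hasFDerivAt.comp_hasDerivAt t h1
    simpa using h3.clm_apply (hasDerivAt_const t ((a, 0) : E × ℝ))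
  have h4 : (fun p ↦ fderiv ℝ Φ p (0, 1)) =ᶠ[𝓝 (z, t)] fun p ↦ X (Φ p) := by
    have hdn : ∀ᶠ p in 𝓝 (z, t), DifferentiableAt ℝ Φ p := by
      filter_upwards [hΦ.eventually (by simp)] with p hp using hp.differentiableAt (by simp)
    filter_upwards [hdn, hflow] with p hp hp'
    have h5 : HasDerivAt (fun s ↦ Φ (p.1, s)) (fderiv ℝ Φ p (0, 1)) p.2 :=
      HasFDerivAt.comp_hasDerivAt (l := Φ) p.2 hp.hasFDerivAt
        ((hasDerivAt_const p.2 p.1).prodMk (hasDerivAt_id p.2))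
    exact h5.unique hp'
  have h6 : fderiv ℝ (fun p ↦ fderiv ℝ Φ p (0, 1)) (z, t) (a, 0) =
      fderiv ℝ (fderiv ℝ Φ) (z, t) (a, 0) (0, 1) := by
    rw [(hdd.hasFDerivAt.clm_apply (hasFDerivAt_const ((0, 1) : E × ℝ) (z, t))).fderiv]
    simp
  have h7 : fderiv ℝ (fun p ↦ X (Φ p)) (z, t) (a, 0) =
      fderiv ℝ X (Φ (z, t)) (fderiv ℝ Φ (z, t) (a, 0)) := by
    exact congrArg (fun A ↦ A (a, 0)) (hX.hasFDerivAt.comp (z, t) hd.hasFDerivAt).fderiv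
  rw [← h7, ← h4.fderiv_eq, h6, ← hsymm (0, 1) (a, 0)]
  exact h2

theorem HasDerivAt.stdSymplectic {u v : ℝ → ModelVec n × ModelCovec n}
    {u' v' : ModelVec n × ModelCovec n} {t : ℝ} (hu : HasDerivAt u u' t) (hv : HasDerivAt v v' t) :
    HasDerivAt (fun s ↦ stdSymplectic (u s) (v s))
      (stdSymplectic u' (v t) + stdSymplectic (u t) v') t := by
  have hfst {w : ℝ → ModelVec n × ModelCovec n} {w' : ModelVec n × ModelCovec n}
      (hw : HasDerivAt w w' t) : HasDerivAt (fun s ↦ (w s).1) w'.1 t :=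
    ((ContinuousLinearMap.fst ℝ (ModelVec n) (ModelCovec n)).hasFDerivAt
      (x := w t)).comp_hasDerivAt t hw
  have hsnd {w : ℝ → ModelVec n × ModelCovec n} {w' : ModelVec n × ModelCovec n}
      (hw : HasDerivAt w w' t) : HasDerivAt (fun s ↦ (w s).2) w'.2 t :=
    ((ContinuousLinearMap.snd ℝ (ModelVec n) (ModelCovec n)).hasFDerivAt
      (x := w t)).comp_hasDerivAt t hw
  have h := ((hsnd hu).clm_apply (hfst hv)).sub ((hsnd hv).clm_apply (hfst hu))
  refine h.congr_deriv ?_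
  simp only [_root_.stdSymplectic]
  ring

set_option maxHeartbeats 800000 in
/-- The local flow of the Hamiltonian vector field of a `C^{k+1}` function is `C^k` and
symplectic. -/
theorem exists_hamiltonian_flow {k : ℕ} (hk : 2 ≤ k) {F : ModelVec n × ModelCovec n → ℝ}
    (hF : ContDiff ℝ (k + 1 : ℕ) F) (z₀ : ModelVec n × ModelCovec n) :
    ∃ Φ : (ModelVec n × ModelCovec n) × ℝ → ModelVec n × ModelCovec n, ∃ ε > 0,
      ∀ z ∈ Metric.ball z₀ ε, Φ (z, 0) = z ∧ ∀ t ∈ Ioo (-ε) ε,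
        ContDiffAt ℝ k Φ (z, t) ∧
        HasDerivAt (fun s ↦ Φ (z, s)) (hamiltonianVector (fderiv ℝ F (Φ (z, t)))) t ∧
        ∀ a b, stdSymplectic (fderiv ℝ Φ (z, t) (a, 0)) (fderiv ℝ Φ (z, t) (b, 0)) =
          stdSymplectic a b := by
  set X := fun z ↦ hamiltonianVector (fderiv ℝ F z) with hXdef
  have hdF : ContDiff ℝ k (fderiv ℝ F) := hF.fderiv_right (by norm_cast)
  have hX : ContDiff ℝ k X := hdF.continuousLinearMap_comp hamiltonianVector
  have h2k : (2 : WithTop ℕ∞) ≤ k := by exact_mod_cast hk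
  have hk0 : (k : WithTop ℕ∞) ≠ 0 := by
    have : k ≠ 0 := by omega
    exact_mod_cast this
  obtain ⟨Φ, hΦ, ε, hε, hfl⟩ := exists_contDiff_flow (by omega) X hX z₀
  obtain ⟨δ, hδ, hδΦ⟩ := Metric.eventually_nhds_iff_ball.1 (hΦ.eventually (by simp))
  set θ := min ε δ
  have hθ : 0 < θ := lt_min hε hδ
  have hmem : ∀ z ∈ Metric.ball z₀ θ, ∀ t ∈ Ioo (-θ) θ, ContDiffAt ℝ k Φ (z, t) := by
    intro z hz t ht
    refine hδΦ _ ?_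
    rw [← ball_prod_same]
    refine ⟨Metric.ball_subset_ball (min_le_right _ _) hz, ?_⟩
    rw [Real.ball_eq_Ioo]
    exact ⟨by linarith [ht.1, min_le_right ε δ], by linarith [ht.2, min_le_right ε δ]⟩
  have hder : ∀ z ∈ Metric.ball z₀ θ, ∀ t ∈ Ioo (-θ) θ,
      HasDerivAt (fun s ↦ Φ (z, s)) (X (Φ (z, t))) t := fun z hz t ht ↦
    (hfl z (Metric.ball_subset_ball (min_le_left _ _) hz)).2 t
      ⟨by linarith [ht.1, min_le_left ε δ], by linarith [ht.2, min_le_left ε δ]⟩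
  have hzero : ∀ z ∈ Metric.ball z₀ θ, Φ (z, 0) = z := fun z hz ↦
    (hfl z (Metric.ball_subset_ball (min_le_left _ _) hz)).1
  refine ⟨Φ, θ, hθ, fun z hz ↦ ⟨hzero z hz, fun t ht ↦ ⟨hmem z hz t ht, hder z hz t ht,
    fun a b ↦ ?_⟩⟩⟩
  have hvar : ∀ a, ∀ t ∈ Ioo (-θ) θ, HasDerivAt (fun s ↦ fderiv ℝ Φ (z, s) (a, 0))
      (fderiv ℝ X (Φ (z, t)) (fderiv ℝ Φ (z, t) (a, 0))) t := by
    intro a t ht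
    refine fderiv_flow_time_derivative (hX.contDiffAt.differentiableAt hk0)
      ((hmem z hz t ht).of_le h2k) ?_ a
    filter_upwards [prod_mem_nhds (Metric.isOpen_ball.mem_nhds hz) (isOpen_Ioo.mem_nhds ht)]
      with p hp using hder p.1 hp.1 p.2 hp.2
  have hdX : ∀ z v, fderiv ℝ X z v = hamiltonianVector (fderiv ℝ (fderiv ℝ F) z v) := by
    intro z v
    have := ((hamiltonianVector (n := n)).hasFDerivAt).comp z
      ((hdF.contDiffAt.differentiableAt hk0 : DifferentiableAt ℝ (fderiv ℝ F) z).hasFDerivAt)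
    exact congrArg (fun A ↦ A v) this.fderiv
  -- The derivative of X is `hamiltonianVector` applied to the second derivative of F. The two terms
  -- in the derivative of the symplectic form are then opposite values of this symmetric form.
  have hconst : ∀ t ∈ Ioo (-θ) θ, HasDerivAt (fun s ↦ stdSymplectic (fderiv ℝ Φ (z, s) (a, 0))
      (fderiv ℝ Φ (z, s) (b, 0))) 0 t := by
    intro t ht
    refine ((hvar a t ht).stdSymplectic (hvar b t ht)).congr_deriv ?_
    have hsymm : IsSymmSndFDerivAt ℝ F (Φ (z, t)) := hF.contDiffAt.isSymmSndFDerivAt (by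
      simp only [minSmoothness_of_isRCLikeNormedField]
      exact_mod_cast (by omega : 2 ≤ k + 1))
    rw [hdX, hdX, stdSymplectic_hamiltonianVector, stdSymplectic_swap _ (hamiltonianVector _),
      stdSymplectic_hamiltonianVector, hsymm]
    ring
  have h0 : (0 : ℝ) ∈ Ioo (-θ) θ := ⟨by linarith, hθ⟩
  have heq := isOpen_Ioo.is_const_of_deriv_eq_zero isPreconnected_Ioo
    (fun t ht ↦ (hconst t ht).differentiableAt.differentiableWithinAt)
    (fun t ht ↦ (hconst t ht).deriv) ht h0
  have hid : ∀ a, fderiv ℝ Φ (z, 0) (a, 0) = a := by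
    intro a
    have h1 : HasFDerivAt (fun y ↦ Φ (y, 0))
        ((fderiv ℝ Φ (z, 0)).comp (ContinuousLinearMap.inl ℝ _ ℝ)) z :=
      ((hmem z hz 0 h0).differentiableAt hk0).hasFDerivAt.comp z (hasFDerivAt_prodMk_left z 0)
    have h2 : HasFDerivAt (fun y ↦ Φ (y, 0)) (ContinuousLinearMap.id ℝ _) z := by
      refine (hasFDerivAt_id z).congr_of_eventuallyEq ?_
      filter_upwards [Metric.isOpen_ball.mem_nhds hz] with y hy using hzero y hy
    simpa using congrArg (fun A ↦ A a) (h1.unique h2)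
  simpa only [hid] using heq

end Symplectic

/-! ### Canonical coordinates on the cotangent bundle -/

section CotangentCharts

variable {n : ℕ} {A : Type*} [TopologicalSpace A]
  {I : ModelWithCorners ℝ (EuclideanSpace ℝ (Fin n)) A}
  {M : Type*} [TopologicalSpace M] [ChartedSpace A M] [IsManifold I ∞ M]

theorem mem_extChartAt_cotangent_source {p r : CotangentBundle I M} :
    r ∈ (extChartAt (cotangentModel I) p).source ↔ r.proj ∈ (extChartAt I p.proj).source := by
  rw [FiberBundle.extChartAt]
  simp
  exact id

theorem mem_extChartAt_cotangent_target {p : CotangentBundle I M} {z : ModelVec n × ModelCovec n} :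
    z ∈ (extChartAt (cotangentModel I) p).target ↔ z.1 ∈ (extChartAt I p.proj).target := by
  rw [FiberBundle.extChartAt]
  simp only [PartialEquiv.trans_target, PartialEquiv.prod_target, PartialEquiv.refl_target,
    mem_inter_iff, mem_prod, mem_univ, and_true, mem_preimage, PartialEquiv.prod_symm,
    PartialEquiv.refl_symm, PartialEquiv.prod_coe]
  refine and_iff_left_of_imp fun h ↦ ?_
  erw [Trivialization.mem_target]
  simpa using (extChartAt I p.proj).map_target h

theorem extChartAt_cotangent_fst (p r : CotangentBundle I M) :
    (extChartAt (cotangentModel I) p r).1 = extChartAt I p.proj r.proj := rfl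

/-- The form `r.2` is expressed in the preferred chart at its own base point, so its coordinates at
p are its pullback under the change from the chart at p to that preferred chart. -/
theorem extChartAt_cotangent_snd (p r : CotangentBundle I M)
    (hr : r.proj ∈ (extChartAt I p.proj).source) (v : ModelVec n) :
    (extChartAt (cotangentModel I) p r).2 v =
      (r.2 (tangentCoordChange I p.proj r.proj r.proj v) : ℝ) := by
  have h : (extChartAt (cotangentModel I) p r).2 =
    (chartAt (ModelProd A (ModelCovec n)) p r).2 := rfl
  rw [h, hom_chart]
  have hr' : r.proj ∈ (trivializationAt (ModelVec n) (TangentSpace I) p.proj).baseSet := by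
    simpa [extChartAt_source] using hr
  rw [ContinuousLinearMap.inCoordinates_eq hr' (by simp)]
  have h2 := TangentBundle.symmL_trivializationAt_eq_core (I := I) (b₀ := p.proj) (b := r.proj)
    (by simpa [extChartAt_source] using hr)
  have h3 : ((trivializationAt (ModelVec n) (TangentSpace I) p.proj).continuousLinearEquivAt ℝ
      r.proj hr').symm v = tangentCoordChange I p.proj r.proj r.proj v := by
    change _ = ((tangentBundleCore I M).coordChange (achart A p.proj) (achart A r.proj) r.proj) v
    rw [← h2]
    exact congrFun (Trivialization.symm_continuousLinearEquivAt_eq (R := ℝ)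
      (trivializationAt (ModelVec n) (TangentSpace I) p.proj) hr') v
  rw [← h3]
  rfl

theorem extChartAt_cotangent_dilation (c : ℝ) (p r : CotangentBundle I M)
    (hr : r.proj ∈ (extChartAt I p.proj).source) :
    extChartAt (cotangentModel I) p (dilation c r) =
      ((extChartAt (cotangentModel I) p r).1, c • (extChartAt (cotangentModel I) p r).2) := by
  refine Prod.ext rfl ?_
  ext v
  have h : (dilation c r).proj ∈ (extChartAt I p.proj).source := hr
  rw [extChartAt_cotangent_snd p _ h]
  simp only [smul_apply]
  rw [extChartAt_cotangent_snd p r hr]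
  rfl

theorem extChartAt_cotangent_injOn_fibre {p r r' : CotangentBundle I M}
    (hr : r.proj ∈ (extChartAt I p.proj).source) (hr' : r'.proj ∈ (extChartAt I p.proj).source)
    (h : extChartAt (cotangentModel I) p r = extChartAt (cotangentModel I) p r') : r = r' :=
  (extChartAt (cotangentModel I) p).injOn (mem_extChartAt_cotangent_source.2 hr)
    (mem_extChartAt_cotangent_source.2 hr') h

theorem range_cotangentModel : range (cotangentModel I) = range I ×ˢ univ := by
  ext ⟨a, b⟩
  simp only [modelWithCorners_prod_coe, mem_range, mem_prod, mem_univ, and_true]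
  exact ⟨fun ⟨y, hy⟩ ↦ ⟨y.1, congrArg Prod.fst hy⟩, fun ⟨y, hy⟩ ↦ ⟨(y, b), Prod.ext hy rfl⟩⟩

theorem fderivWithin_prod_fst {E F G : Type*} [NormedAddCommGroup E] [NormedSpace ℝ E]
    [NormedAddCommGroup F] [NormedSpace ℝ F] [NormedAddCommGroup G] [NormedSpace ℝ G]
    {f : E → G} {s : Set E} (hs : UniqueDiffOn ℝ s) {z : E × F} (hz : z.1 ∈ s)
    (hf : DifferentiableWithinAt ℝ f s z.1) :
    fderivWithin ℝ (fun w : E × F ↦ f w.1) (s ×ˢ univ) z =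
      (fderivWithin ℝ f s z.1).comp (ContinuousLinearMap.fst ℝ E F) := by
  refine HasFDerivWithinAt.fderivWithin ?_ (hs.prod uniqueDiffOn_univ z ⟨hz, mem_univ _⟩)
  exact hf.hasFDerivWithinAt.comp z hasFDerivWithinAt_fst fun w hw ↦ hw.1

theorem contDiffWithinAt_extChartAt_comp_symm {p q r : CotangentBundle I M}
    (hp : r ∈ (extChartAt (cotangentModel I) p).source)
    (hq : r ∈ (extChartAt (cotangentModel I) q).source) :
    ContDiffWithinAt ℝ ∞ (extChartAt (cotangentModel I) q ∘ (extChartAt (cotangentModel I) p).symm)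
      (range (cotangentModel I)) (extChartAt (cotangentModel I) p r) := by
  refine contDiffWithinAt_ext_coord_change _ _ ?_
  rw [PartialEquiv.trans_source'', PartialEquiv.symm_symm, PartialEquiv.symm_target]
  exact mem_image_of_mem _ ⟨hp, hq⟩

/-- Changes of canonical coordinates are symplectic. -/
theorem stdSymplectic_tangentCoordChange {p q r : CotangentBundle I M}
    (hp : r ∈ (extChartAt (cotangentModel I) p).source)
    (hq : r ∈ (extChartAt (cotangentModel I) q).source) (a b : ModelVec n × ModelCovec n) :
    stdSymplectic (tangentCoordChange (cotangentModel I) p q r a : ModelVec n × ModelCovec n)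
      (tangentCoordChange (cotangentModel I) p q r b : ModelVec n × ModelCovec n) =
      stdSymplectic a b := by
  set s := range (cotangentModel I) with hs
  set T := extChartAt (cotangentModel I) q ∘ (extChartAt (cotangentModel I) p).symm with hT
  set z₀ := extChartAt (cotangentModel I) p r with hz₀
  have hsprod : s = range I ×ˢ univ := range_cotangentModel
  have hTs : ContDiffWithinAt ℝ ∞ T s z₀ := contDiffWithinAt_extChartAt_comp_symm hp hq
  have hz₀s : z₀ ∈ s := mem_range_self _
  have hx : ContDiffWithinAt ℝ 2 (fun z ↦ (T z).1) s z₀ :=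
    (contDiffWithinAt_fst.comp z₀ hTs (mapsTo_univ _ _)).of_le ENat.LEInfty.out
  have hξ : DifferentiableWithinAt ℝ (fun z ↦ (T z).2) s z₀ :=
    (contDiffWithinAt_snd.comp z₀ hTs (mapsTo_univ _ _)).differentiableWithinAt (by simp)
  -- β is the canonical one-form ξ dx in the coordinates at p. Covectors transform so that it has
  -- the same expression in the coordinates at q, and the symplectic form is its differential in
  -- both.
  let β : ModelVec n × ModelCovec n → (ModelVec n × ModelCovec n →L[ℝ] ℝ) := fun z ↦
    z.2.comp (ContinuousLinearMap.fst ℝ (ModelVec n) (ModelCovec n))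
  have hβ : β =ᶠ[𝓝[s] z₀] fun z ↦ ((T z).2).comp (fderivWithin ℝ (fun z ↦ (T z).1) s z) := by
    have h1 : (extChartAt (cotangentModel I) p).symm ⁻¹'
        (extChartAt (cotangentModel I) q).source ∈ 𝓝[s] z₀ := by
      refine (continuousAt_extChartAt_symm' hp).continuousWithinAt.preimage_mem_nhdsWithin ?_
      rw [(extChartAt (cotangentModel I) p).left_inv hp]
      exact extChartAt_source_mem_nhds' hq
    filter_upwards [h1, extChartAt_target_mem_nhdsWithin' hp] with z hzq hzt
    set r' := (extChartAt (cotangentModel I) p).symm z with hr'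
    have hr'p : r'.proj ∈ (extChartAt I p.proj).source :=
      mem_extChartAt_cotangent_source.1 ((extChartAt (cotangentModel I) p).map_target hzt)
    have hr'q : r'.proj ∈ (extChartAt I q.proj).source := mem_extChartAt_cotangent_source.1 hzq
    have hzr : extChartAt (cotangentModel I) p r' = z :=
      (extChartAt (cotangentModel I) p).right_inv hzt
    have hz1 : z.1 = extChartAt I p.proj r'.proj := by rw [← hzr]; rfl
    have hfd := hasFDerivWithinAt_tangentCoordChange (I := I) (x := p.proj) (y := q.proj)
      (z := r'.proj) ⟨hr'p, hr'q⟩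
    have hD : fderivWithin ℝ (fun z ↦ (T z).1) s z =
        (tangentCoordChange I p.proj q.proj r'.proj).comp
          (ContinuousLinearMap.fst ℝ (ModelVec n) (ModelCovec n)) := by
      have : (fun z ↦ (T z).1) = fun z : ModelVec n × ModelCovec n ↦
        (extChartAt I q.proj ∘ (extChartAt I p.proj).symm) z.1 := rfl
      rw [this, hsprod, fderivWithin_prod_fst I.uniqueDiffOn
        (by rw [hz1]; exact mem_range_self _) (by rw [hz1]; exact hfd.differentiableWithinAt)]
      rw [hz1]
      rfl
    rw [hD]
    ext v
    · have h2 : (T z).2 (tangentCoordChange I p.proj q.proj r'.proj v) =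
          r'.2 (tangentCoordChange I q.proj r'.proj r'.proj
            (tangentCoordChange I p.proj q.proj r'.proj v)) :=
        extChartAt_cotangent_snd q r' hr'q _
      rw [tangentCoordChange_comp ⟨⟨hr'p, hr'q⟩, mem_extChartAt_source _⟩,
        ← extChartAt_cotangent_snd p r' hr'p, hzr] at h2
      simpa [β] using h2.symm
    · simp [β]
  have key := stdSymplectic_pullback (cotangentModel I).uniqueDiffOn hz₀s
    ((cotangentModel I).range_subset_closure_interior hz₀s) hx hξ hβ a b
  have hβ' : ∀ a b, fderivWithin ℝ β s z₀ a b = a.2 b.1 := by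
    intro a b
    let βL : ModelVec n × ModelCovec n →L[ℝ] (ModelVec n × ModelCovec n →L[ℝ] ℝ) :=
      ((ContinuousLinearMap.compL ℝ (ModelVec n × ModelCovec n) (ModelVec n) ℝ).flip
        (ContinuousLinearMap.fst ℝ (ModelVec n) (ModelCovec n))).comp
        (ContinuousLinearMap.snd ℝ (ModelVec n) (ModelCovec n))
    have hβL : β = βL := rfl
    have : HasFDerivWithinAt β βL s z₀ := by
      rw [hβL]
      exact ContinuousLinearMap.hasFDerivWithinAt (𝕜 := ℝ) (E := ModelVec n × ModelCovec n)
        (F := ModelVec n × ModelCovec n →L[ℝ] ℝ) βL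
    rw [this.fderivWithin ((cotangentModel I).uniqueDiffOn z₀ hz₀s)]
    rfl
  rw [hβ', hβ'] at key
  exact key

end CotangentCharts

/-! ### Hamilton's equations in canonical coordinates -/

section HamiltonianInCharts

variable {n : ℕ} {A : Type*} [TopologicalSpace A]
  {I : ModelWithCorners ℝ (EuclideanSpace ℝ (Fin n)) A}
  {M : Type*} [TopologicalSpace M] [ChartedSpace A M] [IsManifold I ∞ M]

theorem snd_extChartAt_cotangent_eq_zero {p r : CotangentBundle I M}
    (hr : r.proj ∈ (extChartAt I p.proj).source) :
    (extChartAt (cotangentModel I) p r).2 = 0 ↔ r.2 = 0 := by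
  constructor
  · intro h
    refine ContinuousLinearMap.ext fun (v : ModelVec n) ↦ ?_
    have h0 : tangentCoordChange I p.proj r.proj r.proj
        (tangentCoordChange I r.proj p.proj r.proj v) = v := by
      rw [tangentCoordChange_comp ⟨⟨mem_extChartAt_source _, hr⟩, mem_extChartAt_source _⟩,
        tangentCoordChange_self (mem_extChartAt_source _)]
    have h1 := extChartAt_cotangent_snd p r hr (tangentCoordChange I r.proj p.proj r.proj v)
    rw [h, h0] at h1
    exact h1.symm
  · intro h
    ext v
    rw [extChartAt_cotangent_snd p r hr, h]
    rfl

theorem isOpen_nonzeroCovectors : IsOpen (nonzeroCovectors : Set (CotangentBundle I M)) := by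
  refine isOpen_iff_mem_nhds.2 fun r hr ↦ ?_
  have h0 : (extChartAt (cotangentModel I) r r).2 ≠ 0 :=
    fun h ↦ hr ((snd_extChartAt_cotangent_eq_zero (mem_extChartAt_source _)).1 h)
  have h1 : ∀ᶠ r' in 𝓝 r, (extChartAt (cotangentModel I) r r').2 ≠ 0 :=
    (continuous_snd.continuousAt.comp (continuousAt_extChartAt r)).eventually_ne h0
  filter_upwards [h1, extChartAt_source_mem_nhds (I := cotangentModel I) r] with r' h2 h3 h4
  exact h2 ((snd_extChartAt_cotangent_eq_zero (mem_extChartAt_cotangent_source.1 h3)).2 h4)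

theorem IsPositiveHamiltonian.contMDiffAt {F : CotangentBundle I M → ℝ}
    (hF : IsPositiveHamiltonian F) {r : CotangentBundle I M} (hr : r ∈ nonzeroCovectors) :
    ContMDiffAt (cotangentModel I) 𝓘(ℝ, ℝ) ∞ F r :=
  hF.smooth.contMDiffAt (isOpen_nonzeroCovectors.mem_nhds hr)

theorem contDiffWithinAt_comp_extChartAt_symm {E' : Type*} [NormedAddCommGroup E']
    [NormedSpace ℝ E'] {H' : Type*} [TopologicalSpace H'] {J : ModelWithCorners ℝ E' H'}
    {N : Type*} [TopologicalSpace N] [ChartedSpace H' N] [IsManifold J ∞ N]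
    {E'' : Type*} [NormedAddCommGroup E''] [NormedSpace ℝ E''] {F : N → E''} {p r : N}
    (hF : ContMDiffAt J 𝓘(ℝ, E'') ∞ F r) (hr : r ∈ (extChartAt J p).source) :
    ContDiffWithinAt ℝ ∞ (F ∘ (extChartAt J p).symm) (range J) (extChartAt J p r) := by
  rw [← contMDiffWithinAt_iff_contDiffWithinAt]
  rw [← (extChartAt J p).left_inv hr] at hF
  exact hF.comp_contMDiffWithinAt _
    (contMDiffWithinAt_extChartAt_symm_range p ((extChartAt J p).map_source hr))

/-- This is the chain rule for a change of chart. Derivatives are taken within the range of the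
model because r may lie over the boundary. -/
theorem fderivWithin_comp_tangentCoordChange {F : CotangentBundle I M → ℝ}
    {p r : CotangentBundle I M} (hF : ContMDiffAt (cotangentModel I) 𝓘(ℝ, ℝ) ∞ F r)
    (hr : r ∈ (extChartAt (cotangentModel I) p).source) (v : ModelVec n × ModelCovec n) :
    fderivWithin ℝ (F ∘ (extChartAt (cotangentModel I) p).symm) (range (cotangentModel I))
      (extChartAt (cotangentModel I) p r) (tangentCoordChange (cotangentModel I) r p r v) =
      (mfderiv (cotangentModel I) 𝓘(ℝ, ℝ) F r : ModelVec n × ModelCovec n →L[ℝ] ℝ) v := by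
  have hd1 : HasFDerivWithinAt (F ∘ (extChartAt (cotangentModel I) p).symm) _
      (range (cotangentModel I)) (extChartAt (cotangentModel I) p r) :=
    ((contDiffWithinAt_comp_extChartAt_symm hF hr).differentiableWithinAt
      (by simp)).hasFDerivWithinAt
  have hT := hasFDerivWithinAt_tangentCoordChange (I := cotangentModel I) (x := r) (y := p)
    (z := r) ⟨mem_extChartAt_source _, hr⟩
  have hTr : (extChartAt (cotangentModel I) p ∘ (extChartAt (cotangentModel I) r).symm)
      (extChartAt (cotangentModel I) r r) = extChartAt (cotangentModel I) p r :=
    congrArg _ (extChartAt_to_inv r)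
  rw [← hTr] at hd1
  have hcomp := hd1.comp (extChartAt (cotangentModel I) r r) hT (t := range (cotangentModel I))
    (fun z _ ↦ mem_range_self _)
  have hm : (mfderiv (cotangentModel I) 𝓘(ℝ, ℝ) F r : ModelVec n × ModelCovec n →L[ℝ] ℝ) =
      fderivWithin ℝ (F ∘ (extChartAt (cotangentModel I) r).symm) (range (cotangentModel I))
        (extChartAt (cotangentModel I) r r) :=
    (hF.mdifferentiableAt (by simp)).mfderiv
  rw [hm]
  have heq : (F ∘ (extChartAt (cotangentModel I) p).symm) ∘
      (extChartAt (cotangentModel I) p ∘ (extChartAt (cotangentModel I) r).symm)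
      =ᶠ[𝓝[range (cotangentModel I)] (extChartAt (cotangentModel I) r r)]
      F ∘ (extChartAt (cotangentModel I) r).symm := by
    have h1 : (extChartAt (cotangentModel I) r).symm ⁻¹'
        (extChartAt (cotangentModel I) p).source ∈
        𝓝[range (cotangentModel I)] (extChartAt (cotangentModel I) r r) := by
      refine (continuousAt_extChartAt_symm r).continuousWithinAt.preimage_mem_nhdsWithin ?_
      rw [extChartAt_to_inv]
      exact extChartAt_source_mem_nhds' hr
    filter_upwards [h1] with z hz
    simp only [Function.comp_apply]
    rw [(extChartAt (cotangentModel I) p).left_inv hz]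
  have h2 := (hcomp.congr_of_eventuallyEq heq.symm
    (heq.self_of_nhdsWithin (mem_range_self _)).symm).fderivWithin
    ((cotangentModel I).uniqueDiffOn _ (mem_range_self _))
  rw [h2, hTr]
  rfl

/-- The Hamiltonian vector field in canonical coordinates. -/
theorem tangentCoordChange_hamiltonianVectorField {F : CotangentBundle I M → ℝ}
    {p r : CotangentBundle I M} (hF : ContMDiffAt (cotangentModel I) 𝓘(ℝ, ℝ) ∞ F r)
    (hr : r ∈ (extChartAt (cotangentModel I) p).source) :
    (tangentCoordChange (cotangentModel I) r p r (hamiltonianVectorField F r) :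
      ModelVec n × ModelCovec n) =
      hamiltonianVector (fderivWithin ℝ (F ∘ (extChartAt (cotangentModel I) p).symm)
        (range (cotangentModel I)) (extChartAt (cotangentModel I) p r)) := by
  obtain ⟨D, hD, hX⟩ : ∃ D : ModelVec n × ModelCovec n →L[ℝ] ℝ,
      (∀ v, fderivWithin ℝ (F ∘ (extChartAt (cotangentModel I) p).symm) (range (cotangentModel I))
        (extChartAt (cotangentModel I) p r) (tangentCoordChange (cotangentModel I) r p r v) = D v) ∧
      (hamiltonianVectorField F r : ModelVec n × ModelCovec n) = hamiltonianVector D :=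
    ⟨mfderiv (cotangentModel I) 𝓘(ℝ, ℝ) F r, fderivWithin_comp_tangentCoordChange hF hr, rfl⟩
  refine (congrArg (tangentCoordChange (cotangentModel I) r p r) hX).trans ?_
  rw [← sub_eq_zero]
  -- Both vectors represent the differential of F through the symplectic form, which the coordinate
  -- change preserves; nondegeneracy makes them equal.
  refine eq_zero_of_stdSymplectic_eq_zero fun b ↦ ?_
  obtain ⟨b', hb'⟩ : ∃ b' : ModelVec n × ModelCovec n,
      tangentCoordChange (cotangentModel I) r p r b' = b :=
    ⟨tangentCoordChange (cotangentModel I) p r r b, by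
      rw [tangentCoordChange_comp ⟨⟨hr, mem_extChartAt_source _⟩, hr⟩,
        tangentCoordChange_self hr]⟩
  rw [sub_eq_add_neg, stdSymplectic_add_left, ← neg_one_smul ℝ, stdSymplectic_smul_left,
    stdSymplectic_hamiltonianVector]
  conv_lhs => rw [← hb']
  rw [stdSymplectic_tangentCoordChange (mem_extChartAt_source _) hr, hD,
    stdSymplectic_hamiltonianVector]
  ring

/-- The manifold derivative at t refers to the chart at γ t, which moves with t. A fixed chart is
needed to compare γ with an ordinary differential equation. -/
theorem HasMFDerivWithinAt.hasDerivWithinAt_extChartAt {γ : ℝ → CotangentBundle I M} {s : Set ℝ}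
    {t : ℝ} {v : ModelVec n × ModelCovec n} {p : CotangentBundle I M}
    (h : HasMFDerivWithinAt 𝓘(ℝ, ℝ) (cotangentModel I) γ s t
      ((1 : ℝ →L[ℝ] ℝ).smulRight v))
    (hp : γ t ∈ (extChartAt (cotangentModel I) p).source) :
    HasDerivWithinAt (fun u ↦ extChartAt (cotangentModel I) p (γ u))
      (tangentCoordChange (cotangentModel I) (γ t) p (γ t) v) s t := by
  have h1 : HasFDerivWithinAt (fun u ↦ extChartAt (cotangentModel I) (γ t) (γ u))
      ((1 : ℝ →L[ℝ] ℝ).smulRight v) s t := by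
    have := h.2
    simp only [mfld_simps] at this
    exact this
  have hT := hasFDerivWithinAt_tangentCoordChange (I := cotangentModel I) (x := γ t) (y := p)
    (z := γ t) ⟨mem_extChartAt_source _, hp⟩
  have h2 := hT.comp t h1 (t := range (cotangentModel I)) (fun u _ ↦ mem_range_self _)
  have heq : (fun u ↦ extChartAt (cotangentModel I) p (γ u)) =ᶠ[𝓝[s] t]
      (extChartAt (cotangentModel I) p ∘ (extChartAt (cotangentModel I) (γ t)).symm) ∘
        fun u ↦ extChartAt (cotangentModel I) (γ t) (γ u) := by
    filter_upwards [h.1.preimage_mem_nhdsWithin (extChartAt_source_mem_nhds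
      (I := cotangentModel I) (γ t))] with u hu
    simp only [Function.comp_apply]
    rw [(extChartAt (cotangentModel I) (γ t)).left_inv hu]
  have h3 := h2.congr_of_eventuallyEq heq
    (congrArg _ (extChartAt_to_inv (γ t)).symm)
  rw [hasDerivWithinAt_iff_hasFDerivWithinAt]
  refine h3.congr_fderiv ?_
  ext1
  simp

/-- Bicharacteristics in canonical coordinates are solutions of Hamilton's equations. -/
theorem IsBicharacteristicOn.hasDerivWithinAt {F : CotangentBundle I M → ℝ}
    (hF : IsPositiveHamiltonian F) {γ : ℝ → CotangentBundle I M} {s : Set ℝ}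
    (hγ : IsBicharacteristicOn F γ s) {t : ℝ} (ht : t ∈ s) {p : CotangentBundle I M}
    (hp : γ t ∈ (extChartAt (cotangentModel I) p).source) :
    HasDerivWithinAt (fun u ↦ extChartAt (cotangentModel I) p (γ u))
      (hamiltonianVector (fderivWithin ℝ (F ∘ (extChartAt (cotangentModel I) p).symm)
        (range (cotangentModel I)) (extChartAt (cotangentModel I) p (γ t)))) s t := by
  have h := HasMFDerivWithinAt.hasDerivWithinAt_extChartAt (hγ.2 t ht) hp
  rwa [tangentCoordChange_hamiltonianVectorField (hF.contMDiffAt (hγ.1 t ht)) hp] at h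

end HamiltonianInCharts

/-! ### Uniqueness for autonomous equations -/

section Uniqueness

/-- Uniqueness of the solutions of an autonomous equation on a compact interval. -/
theorem eqOn_Icc_of_hasDerivWithinAt {E : Type*} [NormedAddCommGroup E] [NormedSpace ℝ E]
    [FiniteDimensional ℝ E] {X : E → E} (hX : ContDiff ℝ 1 X) {f g : ℝ → E} {a b t₀ : ℝ}
    (ht₀ : t₀ ∈ Icc a b) (hf : ∀ t ∈ Icc a b, HasDerivWithinAt f (X (f t)) (Icc a b) t)
    (hg : ∀ t ∈ Icc a b, HasDerivWithinAt g (X (g t)) (Icc a b) t) (h : f t₀ = g t₀) :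
    EqOn f g (Icc a b) := by
  have hfc : ContinuousOn f (Icc a b) := fun t ht ↦ (hf t ht).continuousWithinAt
  have hgc : ContinuousOn g (Icc a b) := fun t ht ↦ (hg t ht).continuousWithinAt
  -- X is only C¹, hence locally Lipschitz. On a ball containing both compact trajectories it has a
  -- global Lipschitz constant.
  obtain ⟨R, hR⟩ : ∃ R, ∀ t ∈ Icc a b, f t ∈ Metric.closedBall 0 R ∧ g t ∈ Metric.closedBall 0 R := by
    obtain ⟨R₁, h₁⟩ := isCompact_Icc.exists_bound_of_continuousOn hfc
    obtain ⟨R₂, h₂⟩ := isCompact_Icc.exists_bound_of_continuousOn hgc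
    refine ⟨max R₁ R₂, fun t ht ↦ ⟨?_, ?_⟩⟩
    · simpa using Or.inl (h₁ t ht)
    · simpa using Or.inr (h₂ t ht)
  have := FiniteDimensional.proper ℝ E
  obtain ⟨K, hK⟩ := hX.contDiffOn.exists_lipschitzOnWith one_ne_zero
    (convex_closedBall (0 : E) R) (isCompact_closedBall _ _)
  have hr : EqOn f g (Icc t₀ b) := by
    have hsub : Icc t₀ b ⊆ Icc a b := Icc_subset_Icc_left ht₀.1
    refine ODE_solution_unique_of_mem_Icc_right (v := fun _ ↦ X) (s := fun _ ↦ Metric.closedBall 0 R)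
      (fun _ _ ↦ hK) (hfc.mono hsub) (fun t ht ↦ ?_)
      (fun t ht ↦ (hR t (hsub (Ico_subset_Icc_self ht))).1) (hgc.mono hsub) (fun t ht ↦ ?_)
      (fun t ht ↦ (hR t (hsub (Ico_subset_Icc_self ht))).2) h
    · exact (hf t (hsub (Ico_subset_Icc_self ht))).mono_of_mem_nhdsWithin
        (Filter.mem_of_superset (Icc_mem_nhdsGE ht.2) (Icc_subset_Icc_left (ht₀.1.trans ht.1)))
    · exact (hg t (hsub (Ico_subset_Icc_self ht))).mono_of_mem_nhdsWithin
        (Filter.mem_of_superset (Icc_mem_nhdsGE ht.2) (Icc_subset_Icc_left (ht₀.1.trans ht.1)))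
  have hl : EqOn f g (Icc a t₀) := by
    have hsub : Icc a t₀ ⊆ Icc a b := Icc_subset_Icc_right ht₀.2
    refine ODE_solution_unique_of_mem_Icc_left (v := fun _ ↦ X) (s := fun _ ↦ Metric.closedBall 0 R)
      (fun _ _ ↦ hK) (hfc.mono hsub) (fun t ht ↦ ?_)
      (fun t ht ↦ (hR t (hsub (Ioc_subset_Icc_self ht))).1) (hgc.mono hsub) (fun t ht ↦ ?_)
      (fun t ht ↦ (hR t (hsub (Ioc_subset_Icc_self ht))).2) h
    · exact (hf t (hsub (Ioc_subset_Icc_self ht))).mono_of_mem_nhdsWithin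
        (Filter.mem_of_superset (Icc_mem_nhdsLE ht.1) (Icc_subset_Icc_right (ht.2.trans ht₀.2)))
    · exact (hg t (hsub (Ioc_subset_Icc_self ht))).mono_of_mem_nhdsWithin
        (Filter.mem_of_superset (Icc_mem_nhdsLE ht.1) (Icc_subset_Icc_right (ht.2.trans ht₀.2)))
  rw [← Icc_union_Icc_eq_Icc ht₀.1 ht₀.2]
  exact hl.union hr

end Uniqueness

/-! ### The Hausdorff property of the cotangent bundle -/

section CotangentHausdorff

variable {n : ℕ} {A : Type*} [TopologicalSpace A]
  {I : ModelWithCorners ℝ (EuclideanSpace ℝ (Fin n)) A}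
  {M : Type*} [TopologicalSpace M] [ChartedSpace A M] [IsManifold I ∞ M]

theorem continuous_cotangent_proj :
    Continuous (fun r : CotangentBundle I M ↦ r.proj) :=
  FiberBundle.continuous_proj (ModelCovec n) _

/-- Covectors over distinct points are separated through the base; those over the same point lie in
a common chart. -/
theorem t2Space_cotangentBundle [T2Space M] : T2Space (CotangentBundle I M) := by
  refine ⟨fun r r' hne ↦ ?_⟩
  by_cases hproj : r.proj = r'.proj
  · set e := extChartAt (cotangentModel I) r
    have hr : r ∈ e.source := mem_extChartAt_source r
    have hr' : r' ∈ e.source :=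
      mem_extChartAt_cotangent_source.2 (hproj ▸ mem_extChartAt_source (I := I) r.proj)
    obtain ⟨u, v, hu, hv, hru, hrv, huv⟩ :=
      t2_separation (fun h ↦ hne (e.injOn hr hr' h) : e r ≠ e r')
    refine ⟨e.source ∩ e ⁻¹' u, e.source ∩ e ⁻¹' v, ?_, ?_, ⟨hr, hru⟩, ⟨hr', hrv⟩, ?_⟩
    · exact (continuousOn_extChartAt r).isOpen_inter_preimage (isOpen_extChartAt_source r) hu
    · exact (continuousOn_extChartAt r).isOpen_inter_preimage (isOpen_extChartAt_source r) hv
    · exact (huv.preimage e).mono inter_subset_right inter_subset_right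
  · obtain ⟨u, v, hu, hv, hru, hrv, huv⟩ := t2_separation hproj
    exact ⟨_, _, hu.preimage continuous_cotangent_proj, hv.preimage continuous_cotangent_proj,
      hru, hrv, huv.preimage _⟩

end CotangentHausdorff

/-! ### Interior and boundary through the normal coordinate -/

section HalfSpace

variable {m : ℕ}

/-- The coordinate of the base point that vanishes on the boundary of the half space. -/
def normalCoord (m : ℕ) : ModelVec (m + 1) × ModelCovec (m + 1) →L[ℝ] ℝ :=
  (EuclideanSpace.proj (𝕜 := ℝ) (0 : Fin (m + 1))).comp
    (ContinuousLinearMap.fst ℝ (ModelVec (m + 1)) (ModelCovec (m + 1)))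

theorem normalCoord_apply (z : ModelVec (m + 1) × ModelCovec (m + 1)) :
    normalCoord m z = z.1 0 := rfl

theorem range_cotangentModel_halfSpace :
    range (cotangentModel (𝓡∂ (m + 1))) = {z | 0 ≤ normalCoord m z} := by
  rw [range_cotangentModel, range_modelWithCornersEuclideanHalfSpace]
  ext z
  simp [normalCoord_apply]

theorem interior_range_halfSpace :
    interior (range (𝓡∂ (m + 1))) = {y : ModelVec (m + 1) | 0 < y 0} :=
  interior_range_modelWithCornersEuclideanHalfSpace _

variable {M : Type*} [TopologicalSpace M] [ChartedSpace (EuclideanHalfSpace (m + 1)) M]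

theorem extChartAt_nonneg (x y : M) : 0 ≤ (extChartAt (𝓡∂ (m + 1)) x y) 0 := by
  have h : extChartAt (𝓡∂ (m + 1)) x y ∈ range (𝓡∂ (m + 1)) := mem_range_self _
  rwa [range_modelWithCornersEuclideanHalfSpace] at h

variable [IsManifold (𝓡∂ (m + 1)) ∞ M]

/-- Whether a point is interior can be tested in any chart of the atlas, so the chart at x serves
for all points y of its domain. -/
theorem isInteriorPoint_iff_extChartAt_pos {x y : M} (hy : y ∈ (extChartAt (𝓡∂ (m + 1)) x).source) :
    y ∈ (𝓡∂ (m + 1)).interior M ↔ 0 < (extChartAt (𝓡∂ (m + 1)) x y) 0 := by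
  have h := ModelWithCorners.isInteriorPoint_iff_of_mem_atlas (I := 𝓡∂ (m + 1)) (n := ∞)
    (by simp) (chart_mem_atlas (EuclideanHalfSpace (m + 1)) x)
    (by simpa [extChartAt_source] using hy : y ∈ (chartAt (EuclideanHalfSpace (m + 1)) x).source)
  refine h.trans ⟨fun hx ↦ ?_, fun hx ↦ ?_⟩
  · have := OpenPartialHomeomorph.interior_extend_target_subset_interior_range _ hx
    rwa [interior_range_halfSpace] at this
  · refine OpenPartialHomeomorph.mem_interior_extend_target _
      ((chartAt (EuclideanHalfSpace (m + 1)) x).map_source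
        (by simpa [extChartAt_source] using hy)) ?_
    rw [interior_range_halfSpace]
    exact hx

theorem isBoundaryPoint_iff_extChartAt_eq_zero {x y : M}
    (hy : y ∈ (extChartAt (𝓡∂ (m + 1)) x).source) :
    y ∈ (𝓡∂ (m + 1)).boundary M ↔ (extChartAt (𝓡∂ (m + 1)) x y) 0 = 0 := by
  rw [← (𝓡∂ (m + 1)).compl_interior, mem_compl_iff, isInteriorPoint_iff_extChartAt_pos hy, not_lt]
  exact ⟨fun h ↦ le_antisymm h (extChartAt_nonneg x y), le_of_eq⟩

end HalfSpace

/-! ### Flow boxes of the extended Hamiltonian -/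

section FlowBox

variable {m : ℕ} {M : Type*} [TopologicalSpace M] [ChartedSpace (EuclideanHalfSpace (m + 1)) M]
  [IsManifold (𝓡∂ (m + 1)) ∞ M]

/-- `G` extends `F`, read in the canonical coordinates at `r`, from a half ball of radius `δ` to a
function of class `C^(k+1)`, and `Φ` is the Hamiltonian flow of `G` on a ball of radius `ε`, for
times less than `ε`. -/
structure IsFlowBox (F : CotangentBundle (𝓡∂ (m + 1)) M → ℝ) (k : ℕ)
    (r : CotangentBundle (𝓡∂ (m + 1)) M) (G : ModelVec (m + 1) × ModelCovec (m + 1) → ℝ)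
    (Φ : (ModelVec (m + 1) × ModelCovec (m + 1)) × ℝ → ModelVec (m + 1) × ModelCovec (m + 1))
    (δ ε : ℝ) : Prop where
  pos : 0 < ε
  le : ε ≤ δ
  contDiff : ContDiff ℝ (k + 1 : ℕ) G
  extends_chart : ∀ z ∈ Metric.ball (extChartAt (cotangentModel (𝓡∂ (m + 1))) r r) δ,
    0 ≤ normalCoord m z →
      z ∈ (extChartAt (cotangentModel (𝓡∂ (m + 1))) r).target ∧
      (extChartAt (cotangentModel (𝓡∂ (m + 1))) r).symm z ∈ nonzeroCovectors ∧
      F ((extChartAt (cotangentModel (𝓡∂ (m + 1))) r).symm z) = G z ∧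
      fderivWithin ℝ (F ∘ (extChartAt (cotangentModel (𝓡∂ (m + 1))) r).symm)
        (range (cotangentModel (𝓡∂ (m + 1)))) z = fderiv ℝ G z
  flow_zero : ∀ z ∈ Metric.ball (extChartAt (cotangentModel (𝓡∂ (m + 1))) r r) ε, Φ (z, 0) = z
  flow_mem : ∀ z ∈ Metric.ball (extChartAt (cotangentModel (𝓡∂ (m + 1))) r r) ε,
    ∀ t ∈ Ioo (-ε) ε, Φ (z, t) ∈ Metric.ball (extChartAt (cotangentModel (𝓡∂ (m + 1))) r r) δ
  flow_contDiffAt : ∀ z ∈ Metric.ball (extChartAt (cotangentModel (𝓡∂ (m + 1))) r r) ε,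
    ∀ t ∈ Ioo (-ε) ε, ContDiffAt ℝ k Φ (z, t)
  flow_hasDerivAt : ∀ z ∈ Metric.ball (extChartAt (cotangentModel (𝓡∂ (m + 1))) r r) ε,
    ∀ t ∈ Ioo (-ε) ε,
      HasDerivAt (fun s ↦ Φ (z, s)) (hamiltonianVector (fderiv ℝ G (Φ (z, t)))) t
  flow_symplectic : ∀ z ∈ Metric.ball (extChartAt (cotangentModel (𝓡∂ (m + 1))) r r) ε,
    ∀ t ∈ Ioo (-ε) ε, ∀ a b,
      stdSymplectic (fderiv ℝ Φ (z, t) (a, 0)) (fderiv ℝ Φ (z, t) (b, 0)) = stdSymplectic a b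

theorem IsFlowBox.mono {F : CotangentBundle (𝓡∂ (m + 1)) M → ℝ} {k : ℕ}
    {r : CotangentBundle (𝓡∂ (m + 1)) M} {G : ModelVec (m + 1) × ModelCovec (m + 1) → ℝ}
    {Φ : (ModelVec (m + 1) × ModelCovec (m + 1)) × ℝ → ModelVec (m + 1) × ModelCovec (m + 1)}
    {δ ε ε' : ℝ} (h : IsFlowBox F k r G Φ δ ε) (hε : 0 < ε') (hle : ε' ≤ ε) :
    IsFlowBox F k r G Φ δ ε' where
  pos := hε
  le := hle.trans h.le
  contDiff := h.contDiff
  extends_chart := h.extends_chart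
  flow_zero z hz := h.flow_zero z (Metric.ball_subset_ball hle hz)
  flow_mem z hz t ht := h.flow_mem z (Metric.ball_subset_ball hle hz) t
    (Ioo_subset_Ioo (neg_le_neg hle) hle ht)
  flow_contDiffAt z hz t ht := h.flow_contDiffAt z (Metric.ball_subset_ball hle hz) t
    (Ioo_subset_Ioo (neg_le_neg hle) hle ht)
  flow_hasDerivAt z hz t ht := h.flow_hasDerivAt z (Metric.ball_subset_ball hle hz) t
    (Ioo_subset_Ioo (neg_le_neg hle) hle ht)
  flow_symplectic z hz t ht := h.flow_symplectic z (Metric.ball_subset_ball hle hz) t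
    (Ioo_subset_Ioo (neg_le_neg hle) hle ht)

theorem exists_pos_ball_prod_Ioo {E : Type*} [PseudoMetricSpace E] {z₀ : E} {P : E × ℝ → Prop}
    (h : ∀ᶠ y in 𝓝 (z₀, (0 : ℝ)), P y) :
    ∃ ε > 0, ∀ z ∈ Metric.ball z₀ ε, ∀ t ∈ Ioo (-ε) ε, P (z, t) := by
  obtain ⟨ε, hε, hP⟩ := Metric.eventually_nhds_iff_ball.1 h
  refine ⟨ε, hε, fun z hz t ht ↦ hP _ ?_⟩
  rw [← ball_prod_same]
  exact ⟨hz, by simpa [abs_lt] using ht⟩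

/-- The Hamiltonian in the chart extends past the half-space by reflection, and the flow of the
extension exists in both time directions even over the boundary. Continuity at the centre allows the
box to shrink until the flow stays where the extension agrees with F on the half-space. -/
theorem IsPositiveHamiltonian.exists_isFlowBox {F : CotangentBundle (𝓡∂ (m + 1)) M → ℝ}
    (hF : IsPositiveHamiltonian F) {k : ℕ} (hk : 2 ≤ k) {r : CotangentBundle (𝓡∂ (m + 1)) M}
    (hr : r ∈ nonzeroCovectors) : ∃ G Φ δ ε, IsFlowBox F k r G Φ δ ε := by
  set e := extChartAt (cotangentModel (𝓡∂ (m + 1))) r with he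
  set z₀ := e r with hz₀
  have hsm : ContDiffWithinAt ℝ ∞ (F ∘ e.symm) (range (cotangentModel (𝓡∂ (m + 1)))) z₀ :=
    contDiffWithinAt_comp_extChartAt_symm (hF.contMDiffAt hr) (mem_extChartAt_source r)
  have hz₀r : z₀ ∈ range (cotangentModel (𝓡∂ (m + 1))) := mem_range_self _
  rw [range_cotangentModel_halfSpace] at hsm hz₀r
  obtain ⟨G, hG, hGF⟩ := ContDiffWithinAt.exists_contDiff_extension (L := normalCoord m)
    (e := (EuclideanSpace.single 0 1, 0)) (by simp [normalCoord_apply]) (k := k + 1)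
    hz₀r (hsm.of_le (by exact_mod_cast le_top))
  obtain ⟨Φ, ε₁, hε₁, hΦ⟩ := exists_hamiltonian_flow hk hG z₀
  have h1 : ∀ᶠ z in 𝓝[{z | 0 ≤ normalCoord m z}] z₀, z ∈ e.target ∧ e.symm z ∈ nonzeroCovectors ∧
      F (e.symm z) = G z := by
    have ht : e.target ∈ 𝓝[{z | 0 ≤ normalCoord m z}] z₀ := by
      rw [← range_cotangentModel_halfSpace]
      exact extChartAt_target_mem_nhdsWithin r
    have hn : e.symm ⁻¹' nonzeroCovectors ∈ 𝓝 z₀ := by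
      refine (continuousAt_extChartAt_symm r).preimage_mem_nhds ?_
      rw [extChartAt_to_inv]
      exact isOpen_nonzeroCovectors.mem_nhds hr
    filter_upwards [ht, mem_nhdsWithin_of_mem_nhds hn, hGF] with z h1 h2 h3
    exact ⟨h1, h2, h3.symm⟩
  obtain ⟨δ, hδ, hball⟩ := Metric.mem_nhdsWithin_iff.1 h1
  have hcont : ∀ᶠ y in 𝓝 (z₀, (0 : ℝ)), Φ y ∈ Metric.ball z₀ δ := by
    have h0 := hΦ z₀ (Metric.mem_ball_self hε₁)
    refine (h0.2 0 ⟨by linarith, hε₁⟩).1.continuousAt.preimage_mem_nhds ?_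
    rw [h0.1]
    exact Metric.ball_mem_nhds _ hδ
  obtain ⟨ε₂, hε₂, hmem⟩ := exists_pos_ball_prod_Ioo hcont
  refine ⟨G, Φ, δ, min (min ε₁ ε₂) δ, ?_⟩
  have hle1 : min (min ε₁ ε₂) δ ≤ ε₁ := (min_le_left _ _).trans (min_le_left _ _)
  have hle2 : min (min ε₁ ε₂) δ ≤ ε₂ := (min_le_left _ _).trans (min_le_right _ _)
  have hb1 {z} (hz : z ∈ Metric.ball z₀ (min (min ε₁ ε₂) δ)) : z ∈ Metric.ball z₀ ε₁ :=
    Metric.ball_subset_ball hle1 hz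
  have hb2 {z} (hz : z ∈ Metric.ball z₀ (min (min ε₁ ε₂) δ)) : z ∈ Metric.ball z₀ ε₂ :=
    Metric.ball_subset_ball hle2 hz
  have hi1 {t} (ht : t ∈ Ioo (-min (min ε₁ ε₂) δ) (min (min ε₁ ε₂) δ)) : t ∈ Ioo (-ε₁) ε₁ :=
    Ioo_subset_Ioo (neg_le_neg hle1) hle1 ht
  have hi2 {t} (ht : t ∈ Ioo (-min (min ε₁ ε₂) δ) (min (min ε₁ ε₂) δ)) : t ∈ Ioo (-ε₂) ε₂ :=
    Ioo_subset_Ioo (neg_le_neg hle2) hle2 ht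
  exact
    { pos := lt_min (lt_min hε₁ hε₂) hδ
      le := min_le_right _ _
      contDiff := hG
      extends_chart := fun z hz hz' ↦ by
        obtain ⟨h2, h3, h4⟩ := hball ⟨hz, hz'⟩
        refine ⟨h2, h3, h4, ?_⟩
        have hev : F ∘ e.symm =ᶠ[𝓝[{z | 0 ≤ normalCoord m z}] z] G := by
          filter_upwards [self_mem_nhdsWithin,
            mem_nhdsWithin_of_mem_nhds (Metric.isOpen_ball.mem_nhds hz)] with y hy hy'
          exact (hball ⟨hy', hy⟩).2.2
        rw [range_cotangentModel_halfSpace, hev.fderivWithin_eq h4]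
        -- The half-space has unique derivatives even at its boundary points, so the values of F on
        -- it determine the full derivative of G.
        refine fderivWithin_eq_fderiv ?_ (hG.differentiable (by simp) z)
        rw [← range_cotangentModel_halfSpace]
        refine (cotangentModel (𝓡∂ (m + 1))).uniqueDiffOn _ ?_
        rw [range_cotangentModel_halfSpace]
        exact hz'
      flow_zero := fun z hz ↦ (hΦ z (hb1 hz)).1
      flow_mem := fun z hz t ht ↦ hmem z (hb2 hz) t (hi2 ht)
      flow_contDiffAt := fun z hz t ht ↦ ((hΦ z (hb1 hz)).2 t (hi1 ht)).1
      flow_hasDerivAt := fun z hz t ht ↦ ((hΦ z (hb1 hz)).2 t (hi1 ht)).2.1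
      flow_symplectic := fun z hz t ht ↦ ((hΦ z (hb1 hz)).2 t (hi1 ht)).2.2 }

variable {F : CotangentBundle (𝓡∂ (m + 1)) M → ℝ} {k : ℕ}
  {r : CotangentBundle (𝓡∂ (m + 1)) M} {G : ModelVec (m + 1) × ModelCovec (m + 1) → ℝ}
  {Φ : (ModelVec (m + 1) × ModelCovec (m + 1)) × ℝ → ModelVec (m + 1) × ModelCovec (m + 1)}
  {δ ε : ℝ}

theorem normalCoord_extChartAt_nonneg (p r : CotangentBundle (𝓡∂ (m + 1)) M) :
    0 ≤ normalCoord m (extChartAt (cotangentModel (𝓡∂ (m + 1))) p r) :=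
  extChartAt_nonneg _ _

theorem IsFlowBox.contDiff_vectorField (hk : 2 ≤ k) (h : IsFlowBox F k r G Φ δ ε) :
    ContDiff ℝ 1 fun z ↦ hamiltonianVector (fderiv ℝ G z) := by
  have h1 : ContDiff ℝ 1 (fderiv ℝ G) := h.contDiff.fderiv_right (by norm_cast; omega)
  exact h1.continuousLinearMap_comp hamiltonianVector

theorem IsFlowBox.hasDerivWithinAt_bicharacteristic (hF : IsPositiveHamiltonian F)
    (h : IsFlowBox F k r G Φ δ ε) {γ : ℝ → CotangentBundle (𝓡∂ (m + 1)) M} {s : Set ℝ}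
    (hγ : IsBicharacteristicOn F γ s) {t : ℝ} (ht : t ∈ s)
    (hs : γ t ∈ (extChartAt (cotangentModel (𝓡∂ (m + 1))) r).source)
    (hb : extChartAt (cotangentModel (𝓡∂ (m + 1))) r (γ t) ∈
      Metric.ball (extChartAt (cotangentModel (𝓡∂ (m + 1))) r r) δ) :
    HasDerivWithinAt (fun u ↦ extChartAt (cotangentModel (𝓡∂ (m + 1))) r (γ u))
      (hamiltonianVector (fderiv ℝ G (extChartAt (cotangentModel (𝓡∂ (m + 1))) r (γ t)))) s t := by
  have h1 := hγ.hasDerivWithinAt hF ht hs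
  rwa [(h.extends_chart _ hb (normalCoord_extChartAt_nonneg _ _)).2.2.2] at h1

theorem IsBicharacteristicOn.mono {γ : ℝ → CotangentBundle (𝓡∂ (m + 1)) M} {s s' : Set ℝ}
    (hγ : IsBicharacteristicOn F γ s) (hs : s' ⊆ s) : IsBicharacteristicOn F γ s' :=
  ⟨fun t ht ↦ hγ.1 t (hs ht), hγ.2.mono hs⟩

theorem IsBicharacteristicOn.continuousOn {γ : ℝ → CotangentBundle (𝓡∂ (m + 1)) M} {s : Set ℝ}
    (hγ : IsBicharacteristicOn F γ s) : ContinuousOn γ s :=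
  fun t ht ↦ (hγ.2 t ht).1

/-- A bicharacteristic follows the flow of the extended Hamiltonian as long as the latter is
defined. -/
theorem IsFlowBox.tracks [T2Space M] (hF : IsPositiveHamiltonian F) (hk : 2 ≤ k)
    (h : IsFlowBox F k r G Φ δ ε) {γ : ℝ → CotangentBundle (𝓡∂ (m + 1)) M} {a b : ℝ}
    (hγ : IsBicharacteristicOn F γ (Icc a b)) (hab : b < a + ε)
    (ha : γ a ∈ (extChartAt (cotangentModel (𝓡∂ (m + 1))) r).source)
    (hb : extChartAt (cotangentModel (𝓡∂ (m + 1))) r (γ a) ∈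
      Metric.ball (extChartAt (cotangentModel (𝓡∂ (m + 1))) r r) ε) :
    ∀ t ∈ Icc a b, γ t ∈ (extChartAt (cotangentModel (𝓡∂ (m + 1))) r).source ∧
      extChartAt (cotangentModel (𝓡∂ (m + 1))) r (γ t) =
        Φ (extChartAt (cotangentModel (𝓡∂ (m + 1))) r (γ a), t - a) := by
  have : T2Space (CotangentBundle (𝓡∂ (m + 1)) M) := t2Space_cotangentBundle
  set e := extChartAt (cotangentModel (𝓡∂ (m + 1))) r with he
  set z := e (γ a) with hz
  have hε := h.pos
  have hIoo {t : ℝ} (ht : t ∈ Icc a b) : t - a ∈ Ioo (-ε) ε :=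
    ⟨by linarith [ht.1], by linarith [ht.2]⟩
  have hder {t : ℝ} (ht : t ∈ Icc a b) : HasDerivAt (fun u ↦ Φ (z, u - a))
      (hamiltonianVector (fderiv ℝ G (Φ (z, t - a)))) t :=
    HasDerivAt.comp_sub_const t a (h.flow_hasDerivAt z hb _ (hIoo ht))
  set S := {t | γ t ∈ e.source ∧ e (γ t) = Φ (z, t - a)} with hS
  suffices Icc a b ⊆ S from this
  rcases lt_or_ge b a with hlt | hle
  · simp [Icc_eq_empty (not_le.2 hlt)]
  -- Continuous induction on time: the set S of good times is closed in [a, b], contains a, and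
  -- extends to the right of each of its points before b.
  refine IsClosed.Icc_subset_of_forall_exists_gt ?_ ?_ ?_
  · refine isClosed_of_closure_subset fun t ht ↦ ?_
    have htI : t ∈ Icc a b := closure_minimal inter_subset_right isClosed_Icc ht
    have hne : (𝓝[S ∩ Icc a b] t).NeBot := mem_closure_iff_nhdsWithin_neBot.1 ht
    have hΦt : Filter.Tendsto (fun u ↦ Φ (z, u - a)) (𝓝[S ∩ Icc a b] t) (𝓝 (Φ (z, t - a))) :=
      (hder htI).continuousAt.tendsto.mono_left nhdsWithin_le_nhds
    have hγt : Filter.Tendsto γ (𝓝[S ∩ Icc a b] t) (𝓝 (γ t)) :=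
      (hγ.continuousOn t htI).mono_left (nhdsWithin_mono _ inter_subset_right)
    -- At a limit time γ might leave the chart. The extended flow stays in the closed half-space as
    -- a limit of chart values, so the inverse chart is defined there, and uniqueness of limits
    -- identifies its value with γ t.
    have hnn : 0 ≤ normalCoord m (Φ (z, t - a)) := by
      refine ge_of_tendsto' (((normalCoord m).continuous.tendsto _).comp
        (hΦt.congr' (f₂ := fun u ↦ e (γ u)) ?_)) fun u ↦ normalCoord_extChartAt_nonneg _ _
      filter_upwards [self_mem_nhdsWithin] with u hu using hu.1.2.symm
    have htar := (h.extends_chart _ (h.flow_mem z hb _ (hIoo htI)) hnn).1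
    have heq : γ t = e.symm (Φ (z, t - a)) := by
      refine tendsto_nhds_unique_of_eventuallyEq hγt
        (((continuousAt_extChartAt_symm'' htar).tendsto).comp hΦt) ?_
      filter_upwards [self_mem_nhdsWithin] with u hu
      rw [Function.comp_apply, ← hu.1.2, e.left_inv hu.1.1]
    refine ⟨⟨?_, ?_⟩, htI⟩
    · rw [heq]; exact e.map_target htar
    · rw [heq, e.right_inv htar]
  · exact ⟨ha, by rw [sub_self, h.flow_zero z hb]⟩
  · rintro t ⟨⟨hts, hte⟩, htI⟩ y hy
    have htI' : t ∈ Icc a b := Ico_subset_Icc_self htI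
    have hnear : ∀ᶠ u in 𝓝[Icc a b] t, γ u ∈ e.source ∧
        e (γ u) ∈ Metric.ball (e r) δ := by
      have hc := hγ.continuousOn t htI'
      have h1 := hc.preimage_mem_nhdsWithin (extChartAt_source_mem_nhds' hts)
      have h2 := ((continuousAt_extChartAt' hts).comp_continuousWithinAt hc).preimage_mem_nhdsWithin
        (Metric.isOpen_ball.mem_nhds (show e (γ t) ∈ Metric.ball (e r) δ by
          rw [hte]; exact h.flow_mem z hb _ (hIoo htI')))
      filter_upwards [h1, h2] with u h3 h4 using ⟨h3, h4⟩
    have hnear' : ∀ᶠ u in 𝓝[≥] t, γ u ∈ e.source ∧ e (γ u) ∈ Metric.ball (e r) δ := by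
      refine hnear.filter_mono ?_
      rw [← nhdsWithin_Icc_eq_nhdsGE htI.2]
      exact nhdsWithin_mono _ (Icc_subset_Icc_left htI.1)
    obtain ⟨c, hc, hcs⟩ := mem_nhdsGE_iff_exists_Icc_subset.1 hnear'
    set d := min c (min y b) with hd
    have htd : t < d := lt_min hc (lt_min hy htI.2)
    have hsub : Icc t d ⊆ Icc a b := Icc_subset_Icc htI.1 ((min_le_right _ _).trans (min_le_right _ _))
    refine ⟨d, ?_, htd, (min_le_right _ _).trans (min_le_left _ _)⟩
    have hmem {u : ℝ} (hu : u ∈ Icc t d) : γ u ∈ e.source ∧ e (γ u) ∈ Metric.ball (e r) δ :=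
      hcs ⟨hu.1, hu.2.trans (min_le_left _ _)⟩
    refine ⟨(hmem (right_mem_Icc.2 htd.le)).1, ?_⟩
    refine eqOn_Icc_of_hasDerivWithinAt (h.contDiff_vectorField hk) (f := fun u ↦ e (γ u))
      (g := fun u ↦ Φ (z, u - a)) (left_mem_Icc.2 htd.le) (fun u hu ↦ ?_) (fun u hu ↦ ?_) hte
      (right_mem_Icc.2 htd.le)
    · exact h.hasDerivWithinAt_bicharacteristic hF (hγ.mono hsub) hu (hmem hu).1 (hmem hu).2
    · exact (hder (hsub hu)).hasDerivWithinAt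

end FlowBox

/-! ### Uniqueness, energy and normal velocity of bicharacteristics -/

section Bicharacteristics

variable {m : ℕ} {M : Type*} [TopologicalSpace M] [ChartedSpace (EuclideanHalfSpace (m + 1)) M]
  [IsManifold (𝓡∂ (m + 1)) ∞ M] {F : CotangentBundle (𝓡∂ (m + 1)) M → ℝ}

/-- Unique continuation of bicharacteristics. -/
theorem IsBicharacteristicOn.eqOn [T2Space M] (hF : IsPositiveHamiltonian F)
    {γ γ' : ℝ → CotangentBundle (𝓡∂ (m + 1)) M} {a b t₀ : ℝ}
    (hγ : IsBicharacteristicOn F γ (Icc a b)) (hγ' : IsBicharacteristicOn F γ' (Icc a b))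
    (ht₀ : t₀ ∈ Icc a b) (h : γ t₀ = γ' t₀) : EqOn γ γ' (Icc a b) := by
  have : T2Space (CotangentBundle (𝓡∂ (m + 1)) M) := t2Space_cotangentBundle
  intro t ht
  -- Agreement propagates locally by uniqueness of solutions in a flow box, and disagreement is an
  -- open condition by the Hausdorff property; connectedness of the interval concludes.
  refine isPreconnected_Icc.induction₂' (fun x y ↦ γ x = γ' x → γ y = γ' y) (fun x hx ↦ ?_)
    (fun x y z _ _ _ h1 h2 h3 ↦ h2 (h1 h3)) ht₀ ht h
  by_cases hxe : γ x = γ' x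
  swap
  · have hne : ∀ᶠ y in 𝓝[Icc a b] x, γ y ≠ γ' y :=
      ((hγ.continuousOn x hx).prodMk (hγ'.continuousOn x hx)).preimage_mem_nhdsWithin
        (isClosed_diagonal.isOpen_compl.mem_nhds hxe)
    filter_upwards [hne] with y hy
    exact ⟨fun h ↦ absurd h hxe, fun h ↦ absurd h hy⟩
  obtain ⟨G, Φ, δ, ε, hbox⟩ := hF.exists_isFlowBox (le_refl 2) (hγ.1 x hx)
  set e := extChartAt (cotangentModel (𝓡∂ (m + 1))) (γ x) with he
  have hδ : 0 < δ := hbox.pos.trans_le hbox.le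
  have hnear : ∀ᶠ y in 𝓝[Icc a b] x, (γ y ∈ e.source ∧ e (γ y) ∈ Metric.ball (e (γ x)) δ) ∧
      γ' y ∈ e.source ∧ e (γ' y) ∈ Metric.ball (e (γ x)) δ := by
    have hopen : e.source ∩ e ⁻¹' Metric.ball (e (γ x)) δ ∈ 𝓝 (γ x) :=
      ((continuousOn_extChartAt (γ x)).isOpen_inter_preimage (isOpen_extChartAt_source (γ x))
        Metric.isOpen_ball).mem_nhds ⟨mem_extChartAt_source _, Metric.mem_ball_self hδ⟩
    have hopen' : e.source ∩ e ⁻¹' Metric.ball (e (γ x)) δ ∈ 𝓝 (γ' x) := hxe ▸ hopen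
    filter_upwards [(hγ.continuousOn x hx).preimage_mem_nhdsWithin hopen,
      (hγ'.continuousOn x hx).preimage_mem_nhdsWithin hopen'] with y h1 h2
    exact ⟨h1, h2⟩
  obtain ⟨c, hc, hcs⟩ := Metric.mem_nhdsWithin_iff.1 hnear
  have hIcc : Icc (max a (x - c / 2)) (min b (x + c / 2)) ∈ 𝓝[Icc a b] x := by
    have h1 : Icc (x - c / 2) (x + c / 2) ∈ 𝓝 x := Icc_mem_nhds (by linarith) (by linarith)
    filter_upwards [self_mem_nhdsWithin, mem_nhdsWithin_of_mem_nhds h1] with y h2 h3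
    exact ⟨max_le h2.1 h3.1, le_min h2.2 h3.2⟩
  have hsub : Icc (max a (x - c / 2)) (min b (x + c / 2)) ⊆ Icc a b :=
    Icc_subset_Icc (le_max_left _ _) (min_le_left _ _)
  have hmem {y : ℝ} (hy : y ∈ Icc (max a (x - c / 2)) (min b (x + c / 2))) :=
    hcs (show y ∈ Metric.ball x c ∩ Icc a b from ⟨by
      rw [Metric.mem_ball, Real.dist_eq, abs_lt]
      constructor
      · linarith [(le_max_right a (x - c / 2)).trans hy.1]
      · linarith [hy.2.trans (min_le_right b (x + c / 2))], hsub hy⟩)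
  have heq : ∀ y ∈ Icc (max a (x - c / 2)) (min b (x + c / 2)), γ y = γ' y := by
    intro y hy
    refine e.injOn (hmem hy).1.1 (hmem hy).2.1 ?_
    refine eqOn_Icc_of_hasDerivWithinAt (hbox.contDiff_vectorField le_rfl) (f := fun u ↦ e (γ u))
      (g := fun u ↦ e (γ' u)) (t₀ := x)
      ⟨max_le hx.1 (by linarith), le_min hx.2 (by linarith)⟩ (fun u hu ↦ ?_) (fun u hu ↦ ?_)
      (congrArg e hxe) hy
    · exact hbox.hasDerivWithinAt_bicharacteristic hF (hγ.mono hsub) hu (hmem hu).1.1 (hmem hu).1.2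
    · exact hbox.hasDerivWithinAt_bicharacteristic hF (hγ'.mono hsub) hu (hmem hu).2.1 (hmem hu).2.2
  filter_upwards [hIcc] with y hy
  exact ⟨fun _ ↦ heq y hy, fun _ ↦ hxe⟩

theorem mfderiv_hamiltonianVectorField_self (F : CotangentBundle (𝓡∂ (m + 1)) M → ℝ)
    (p : CotangentBundle (𝓡∂ (m + 1)) M) :
    (mfderiv (cotangentModel (𝓡∂ (m + 1))) 𝓘(ℝ, ℝ) F p (hamiltonianVectorField F p) : ℝ) = 0 :=
  apply_hamiltonianVector_self (mfderiv (cotangentModel (𝓡∂ (m + 1))) 𝓘(ℝ, ℝ) F p)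

/-- Conservation of energy. -/
theorem IsBicharacteristicOn.energy (hF : IsPositiveHamiltonian F)
    {γ : ℝ → CotangentBundle (𝓡∂ (m + 1)) M} {a b : ℝ}
    (hγ : IsBicharacteristicOn F γ (Icc a b)) : ∀ t ∈ Icc a b, F (γ t) = F (γ a) := by
  have hd : ∀ t ∈ Icc a b, HasDerivWithinAt (fun u ↦ F (γ u)) 0 (Icc a b) t := by
    intro t ht
    have h1 := (((hF.contMDiffAt (hγ.1 t ht)).mdifferentiableAt (by simp)).hasMFDerivAt
      ).comp_hasMFDerivWithinAt t (hγ.2 t ht)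
    obtain ⟨A, X, hAX, h2⟩ : ∃ (A : ModelVec (m + 1) × ModelCovec (m + 1) →L[ℝ] ℝ)
        (X : ModelVec (m + 1) × ModelCovec (m + 1)), A X = 0 ∧
        HasFDerivWithinAt (F ∘ γ) (A.comp ((1 : ℝ →L[ℝ] ℝ).smulRight X)) (Icc a b) t :=
      ⟨_, _, mfderiv_hamiltonianVectorField_self F (γ t), h1.hasFDerivWithinAt⟩
    rw [hasDerivWithinAt_iff_hasFDerivWithinAt]
    refine h2.congr_fderiv ?_
    ext
    simp [hAX]
  refine constant_of_has_deriv_right_zero (fun t ht ↦ (hd t ht).continuousWithinAt) fun t ht ↦ ?_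
  exact (hd t (Ico_subset_Icc_self ht)).mono_of_mem_nhdsWithin
    (Filter.mem_of_superset (Icc_mem_nhdsGE ht.2) (Icc_subset_Icc_left ht.1))

theorem mfderiv_cotangent_proj (p : CotangentBundle (𝓡∂ (m + 1)) M)
    (v : ModelVec (m + 1) × ModelCovec (m + 1)) :
    (mfderiv (cotangentModel (𝓡∂ (m + 1))) (𝓡∂ (m + 1))
      (fun r : CotangentBundle (𝓡∂ (m + 1)) M ↦ r.proj) p v : ModelVec (m + 1)) = v.1 := by
  have h : HasMFDerivAt (cotangentModel (𝓡∂ (m + 1))) (𝓡∂ (m + 1))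
      (fun r : CotangentBundle (𝓡∂ (m + 1)) M ↦ r.proj) p
      (ContinuousLinearMap.fst ℝ (ModelVec (m + 1)) (ModelCovec (m + 1))) := by
    refine ⟨continuous_cotangent_proj.continuousAt, ?_⟩
    refine HasFDerivWithinAt.congr_of_eventuallyEq hasFDerivWithinAt_fst ?_ ?_
    · filter_upwards [extChartAt_target_mem_nhdsWithin (I := cotangentModel (𝓡∂ (m + 1))) p] with z hz
      exact (extChartAt (𝓡∂ (m + 1)) p.proj).right_inv (mem_extChartAt_cotangent_target.1 hz)
    · exact (extChartAt (𝓡∂ (m + 1)) p.proj).right_inv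
        (mem_extChartAt_target (I := 𝓡∂ (m + 1)) p.proj)
  exact congrArg (fun A : ModelVec (m + 1) × ModelCovec (m + 1) →L[ℝ] ModelVec (m + 1) ↦ A v)
    h.mfderiv

/-- The differential of a boundary defining function is a positive multiple of the differential of
the normal coordinate. -/
theorem IsBoundaryDefiningFunction.exists_mfderiv_eq {ρ : M → ℝ}
    (hρ : IsBoundaryDefiningFunction (𝓡∂ (m + 1)) ρ) {x : M}
    (hx : x ∈ (𝓡∂ (m + 1)).boundary M) : ∃ a > 0, ∀ v : ModelVec (m + 1),
      (mfderiv (𝓡∂ (m + 1)) 𝓘(ℝ, ℝ) ρ x v : ℝ) = a * v 0 := by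
  obtain ⟨D, hD, hne⟩ : ∃ D : ModelVec (m + 1) →L[ℝ] ℝ,
      (mfderiv (𝓡∂ (m + 1)) 𝓘(ℝ, ℝ) ρ x : ModelVec (m + 1) →L[ℝ] ℝ) = D ∧ D ≠ 0 :=
    ⟨_, rfl, hρ.mfderiv_ne_zero x hx⟩
  have hmd : MDifferentiableAt (𝓡∂ (m + 1)) 𝓘(ℝ, ℝ) ρ x := (hρ.smooth x).mdifferentiableAt (by simp)
  have hfd : HasFDerivWithinAt (ρ ∘ (extChartAt (𝓡∂ (m + 1)) x).symm) D (range (𝓡∂ (m + 1)))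
      (extChartAt (𝓡∂ (m + 1)) x x) := by
    have := hmd.hasMFDerivAt.2
    rw [← hD]
    exact this
  have hx0 : (extChartAt (𝓡∂ (m + 1)) x x) 0 = 0 :=
    (isBoundaryPoint_iff_extChartAt_eq_zero (mem_extChartAt_source x)).1 hx
  have hρnn : ∀ y, 0 ≤ ρ y := fun y ↦ by
    rcases (𝓡∂ (m + 1)).isInteriorPoint_or_isBoundaryPoint y with h | h
    · exact (hρ.pos y h).le
    · exact (hρ.zero y h).ge
  -- ρ vanishes at x and is nonnegative everywhere, so its one-sided derivative along a ray into the
  -- half-space is nonnegative.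
  have hnn : ∀ v : ModelVec (m + 1), 0 ≤ v 0 → 0 ≤ D v := by
    intro v hv
    have hline : HasDerivWithinAt (fun s : ℝ ↦ extChartAt (𝓡∂ (m + 1)) x x + s • v) v (Ioi 0) 0 := by
      have := ((hasDerivAt_id (0 : ℝ)).smul_const v).const_add (extChartAt (𝓡∂ (m + 1)) x x)
      simpa using this.hasDerivWithinAt
    have hfd' : HasFDerivWithinAt (ρ ∘ (extChartAt (𝓡∂ (m + 1)) x).symm) D (range (𝓡∂ (m + 1)))
      (extChartAt (𝓡∂ (m + 1)) x x + (0 : ℝ) • v) := by simpa using hfd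
    have hcomp := hfd'.comp_hasDerivWithinAt (0 : ℝ) hline (fun s hs ↦ by
      rw [range_modelWithCornersEuclideanHalfSpace]
      rw [mem_ofPred_eq, PiLp.add_apply, PiLp.smul_apply, hx0, zero_add]
      exact mul_nonneg (le_of_lt hs) hv)
    rw [hasDerivWithinAt_iff_tendsto_slope'] at hcomp
    · refine ge_of_tendsto hcomp ?_
      filter_upwards [self_mem_nhdsWithin] with s hs
      rw [slope_def_field]
      refine div_nonneg ?_ (by simpa using (le_of_lt hs))
      have h0 : (ρ ∘ (extChartAt (𝓡∂ (m + 1)) x).symm)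
          (extChartAt (𝓡∂ (m + 1)) x x + (0 : ℝ) • v) = 0 := by
        rw [zero_smul, add_zero, Function.comp_apply, extChartAt_to_inv, hρ.zero x hx]
      simp only [Function.comp_apply] at h0 ⊢
      rw [h0, sub_zero]
      exact hρnn _
    · simp
  have hval : ∀ v : ModelVec (m + 1), D v = D (EuclideanSpace.single 0 1) * v 0 := by
    intro v
    -- A vector tangent to the boundary and its opposite both point into the closed half-space, so D
    -- vanishes on it.
    have h0 : D (v - v 0 • EuclideanSpace.single 0 1) = 0 := by
      refine le_antisymm ?_ (hnn _ (by simp))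
      have := hnn (-(v - v 0 • EuclideanSpace.single 0 1)) (by simp)
      rw [map_neg] at this
      linarith
    rw [map_sub, map_smul, sub_eq_zero, smul_eq_mul] at h0
    rw [h0, mul_comm]
  refine ⟨D (EuclideanSpace.single 0 1), lt_of_le_of_ne (hnn _ (by simp)) fun h ↦ hne ?_, fun v ↦ ?_⟩
  · ext v
    rw [hval v, ← h]
    simp
  · exact (congrArg (fun A : ModelVec (m + 1) →L[ℝ] ℝ ↦ A v) hD).trans (hval v)

/-- The hypotheses on the normal velocity concern only its sign or vanishing, so after this lemma ρ
can be replaced by the normal coordinate of the chart. -/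
theorem exists_normalVelocity_eq {ρ : M → ℝ} (hρ : IsBoundaryDefiningFunction (𝓡∂ (m + 1)) ρ)
    (F : CotangentBundle (𝓡∂ (m + 1)) M → ℝ) {p : CotangentBundle (𝓡∂ (m + 1)) M}
    (hp : p.proj ∈ (𝓡∂ (m + 1)).boundary M) :
    ∃ a > 0, normalVelocity ρ F p =
      a * normalCoord m (hamiltonianVectorField F p : ModelVec (m + 1) × ModelCovec (m + 1)) := by
  obtain ⟨a, ha, h⟩ := hρ.exists_mfderiv_eq hp
  refine ⟨a, ha, (h _).trans ?_⟩
  exact congrArg (fun v : ModelVec (m + 1) ↦ a * v 0) (mfderiv_cotangent_proj p _)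

end Bicharacteristics

/-! ### Dilations and homogeneity -/

section Dilation

variable {n : ℕ} {A : Type*} [TopologicalSpace A]
  {I : ModelWithCorners ℝ (EuclideanSpace ℝ (Fin n)) A}
  {M : Type*} [TopologicalSpace M] [ChartedSpace A M]

theorem dilation_dilation (c d : ℝ) (p : CotangentBundle I M) :
    dilation c (dilation d p) = dilation (c * d) p := by
  refine TotalSpace.ext rfl (heq_of_eq ?_)
  exact (mul_smul c d p.2).symm

theorem dilation_one (p : CotangentBundle I M) : dilation 1 p = p := by
  simp [dilation]

theorem dilation_inv_dilation {c : ℝ} (hc : c ≠ 0) (p : CotangentBundle I M) :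
    dilation c⁻¹ (dilation c p) = p := by
  rw [dilation_dilation, inv_mul_cancel₀ hc, dilation_one]

theorem dilation_dilation_inv {c : ℝ} (hc : c ≠ 0) (p : CotangentBundle I M) :
    dilation c (dilation c⁻¹ p) = p := by
  rw [dilation_dilation, mul_inv_cancel₀ hc, dilation_one]

theorem dilation_mem_nonzeroCovectors {c : ℝ} (hc : c ≠ 0) {p : CotangentBundle I M}
    (hp : p ∈ nonzeroCovectors) : dilation c p ∈ nonzeroCovectors :=
  smul_ne_zero hc hp

variable [IsManifold I ∞ M]

/-- The dilation `(x, ξ) ↦ (x, c ξ)` of the model space. -/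
def modelDilation (n : ℕ) (c : ℝ) : ModelVec n × ModelCovec n →L[ℝ] ModelVec n × ModelCovec n :=
  (ContinuousLinearMap.fst ℝ (ModelVec n) (ModelCovec n)).prod
    (c • ContinuousLinearMap.snd ℝ (ModelVec n) (ModelCovec n))

theorem modelDilation_apply (c : ℝ) (z : ModelVec n × ModelCovec n) :
    modelDilation n c z = (z.1, c • z.2) := rfl

theorem extChartAt_cotangent_symm_modelDilation (c : ℝ) {p : CotangentBundle I M}
    {z : ModelVec n × ModelCovec n} (hz : z ∈ (extChartAt (cotangentModel I) p).target) :
    (extChartAt (cotangentModel I) p).symm (modelDilation n c z) =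
      dilation c ((extChartAt (cotangentModel I) p).symm z) := by
  have h3 := mem_extChartAt_cotangent_source.1 ((extChartAt (cotangentModel I) p).map_target hz)
  have h4 := extChartAt_cotangent_dilation c p ((extChartAt (cotangentModel I) p).symm z) h3
  rw [(extChartAt (cotangentModel I) p).right_inv hz] at h4
  rw [modelDilation_apply, ← h4]
  exact (extChartAt (cotangentModel I) p).left_inv (mem_extChartAt_cotangent_source.2 h3)

theorem continuous_dilation :
    Continuous fun y : ℝ × CotangentBundle I M ↦ dilation y.1 y.2 := by
  refine continuous_iff_continuousAt.2 fun ⟨c, p⟩ ↦ ?_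
  set e := extChartAt (cotangentModel I) p with he
  have hev : (fun y : ℝ × CotangentBundle I M ↦ dilation y.1 y.2) =ᶠ[𝓝 (c, p)]
      fun y ↦ e.symm ((e y.2).1, y.1 • (e y.2).2) := by
    have hs : ∀ᶠ y in 𝓝 (c, p), y.2 ∈ e.source :=
      continuous_snd.continuousAt.preimage_mem_nhds (extChartAt_source_mem_nhds p)
    filter_upwards [hs] with y hy
    have h := extChartAt_cotangent_symm_modelDilation y.1 (e.map_source hy)
    rw [← he, e.left_inv hy] at h
    exact h.symm
  refine ContinuousAt.congr_of_eventuallyEq ?_ hev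
  have ht : ((e p).1, c • (e p).2) ∈ e.target :=
    mem_extChartAt_cotangent_target.2 (mem_extChartAt_target p.proj)
  have hc : ContinuousAt (fun y : ℝ × CotangentBundle I M ↦ ((e y.2).1, y.1 • (e y.2).2)) (c, p) := by
    have h2 : ContinuousAt (fun y : ℝ × CotangentBundle I M ↦ e y.2) (c, p) :=
      (continuousAt_extChartAt p).comp (x := (c, p)) continuousAt_snd
    exact h2.fst.prodMk (continuousAt_fst.smul h2.snd)
  exact ContinuousAt.comp (x := (c, p)) (g := e.symm)
    (f := fun y : ℝ × CotangentBundle I M ↦ ((e y.2).1, y.1 • (e y.2).2))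
    (continuousAt_extChartAt_symm'' ht) hc

/-- The dilation multiplies the symplectic form by c and the Hamiltonian by c², so it carries the
Hamiltonian field to c⁻¹ times the field at the image. The factor c is the change of speed along
dilated bicharacteristics. -/
theorem hamiltonianVector_of_comp_modelDilation {c : ℝ} (hc : c ≠ 0)
    {D D' : ModelVec n × ModelCovec n →L[ℝ] ℝ} (h : D'.comp (modelDilation n c) = c ^ 2 • D) :
    hamiltonianVector D' = c • modelDilation n c (hamiltonianVector D) := by
  have key : ∀ z, D' (z.1, c • z.2) = c ^ 2 * D z := fun z ↦ by
    have := congrArg (fun B : ModelVec n × ModelCovec n →L[ℝ] ℝ ↦ B z) h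
    simpa [modelDilation_apply] using this
  refine Prod.ext ?_ ?_
  · ext i
    have h1 := key (0, c⁻¹ • EuclideanSpace.proj i)
    have h2 : D (0, c⁻¹ • EuclideanSpace.proj i) = c⁻¹ * D (0, EuclideanSpace.proj i) := by
      rw [← smul_eq_mul, ← map_smul, Prod.smul_mk, smul_zero]
    simp only [smul_smul, mul_inv_cancel₀ hc, one_smul, h2] at h1
    change D' (0, EuclideanSpace.proj i) = c * D (0, EuclideanSpace.proj i)
    rw [h1]
    field_simp
  · ext v
    have h1 := key (v, 0)
    rw [smul_zero] at h1
    change -(D' (v, 0)) = c * (c * -(D (v, 0)))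
    rw [h1]
    ring

/-- In the chart at p the dilation is linear and acts on fibre coordinates only, so differentiating
the homogeneity relation gives the hypothesis of `hamiltonianVector_of_comp_modelDilation`. -/
theorem IsPositiveHamiltonian.hamiltonianVectorField_dilation {F : CotangentBundle I M → ℝ}
    (hF : IsPositiveHamiltonian F) {c : ℝ} (hc : 0 < c) {p : CotangentBundle I M}
    (hp : p ∈ nonzeroCovectors) :
    (hamiltonianVectorField F (dilation c p) : ModelVec n × ModelCovec n) =
      c • modelDilation n c (hamiltonianVectorField F p : ModelVec n × ModelCovec n) := by
  refine hamiltonianVector_of_comp_modelDilation hc.ne' ?_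
  set e := extChartAt (cotangentModel I) p with he
  have hp' := dilation_mem_nonzeroCovectors hc.ne' hp
  obtain ⟨D, hD, hd⟩ : ∃ D : ModelVec n × ModelCovec n →L[ℝ] ℝ,
      (mfderiv (cotangentModel I) 𝓘(ℝ, ℝ) F p : ModelVec n × ModelCovec n →L[ℝ] ℝ) = D ∧
      HasFDerivWithinAt (F ∘ e.symm) D (range (cotangentModel I)) (e p) :=
    ⟨_, rfl, ((hF.contMDiffAt hp).mdifferentiableAt (by simp)).hasMFDerivAt.2⟩
  obtain ⟨D', hD', hd'⟩ : ∃ D' : ModelVec n × ModelCovec n →L[ℝ] ℝ,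
      (mfderiv (cotangentModel I) 𝓘(ℝ, ℝ) F (dilation c p) :
        ModelVec n × ModelCovec n →L[ℝ] ℝ) = D' ∧
      HasFDerivWithinAt (F ∘ e.symm) D' (range (cotangentModel I)) (e (dilation c p)) :=
    ⟨_, rfl, ((hF.contMDiffAt hp').mdifferentiableAt (by simp)).hasMFDerivAt.2⟩
  refine (congrArg (fun B : ModelVec n × ModelCovec n →L[ℝ] ℝ ↦ B.comp (modelDilation n c))
    hD').trans (Eq.trans ?_ (congrArg (fun B : ModelVec n × ModelCovec n →L[ℝ] ℝ ↦ c ^ 2 • B)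
      hD).symm)
  have hep : e (dilation c p) = modelDilation n c (e p) :=
    extChartAt_cotangent_dilation c p p (mem_extChartAt_source _)
  rw [hep] at hd'
  have hcomp := hd'.comp (e p) (modelDilation n c).hasFDerivWithinAt (t := range (cotangentModel I))
    (s := range (cotangentModel I)) (fun z hz ↦ by
      rw [range_cotangentModel] at hz ⊢
      exact ⟨hz.1, mem_univ _⟩)
  have hright : HasFDerivWithinAt (fun z ↦ c ^ 2 * (F ∘ e.symm) z) (c ^ 2 • D)
      (range (cotangentModel I)) (e p) := hd.const_mul _
  have hev : (fun z ↦ c ^ 2 * (F ∘ e.symm) z) =ᶠ[𝓝[range (cotangentModel I)] (e p)]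
      (F ∘ e.symm) ∘ modelDilation n c := by
    have h1 : e.target ∈ 𝓝[range (cotangentModel I)] (e p) := extChartAt_target_mem_nhdsWithin p
    have h2 : e.symm ⁻¹' nonzeroCovectors ∈ 𝓝 (e p) := by
      refine (continuousAt_extChartAt_symm p).preimage_mem_nhds ?_
      rw [extChartAt_to_inv]
      exact isOpen_nonzeroCovectors.mem_nhds hp
    filter_upwards [h1, mem_nhdsWithin_of_mem_nhds h2] with z hz hz'
    have h5 := extChartAt_cotangent_symm_modelDilation c hz
    simp only [Function.comp_apply]
    rw [he, h5]
    exact (hF.homogeneous _ hz' c hc).symm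
  have huniq := (cotangentModel I).uniqueDiffOn (e p) (mem_range_self _)
  exact (huniq.eq (hcomp.congr_of_eventuallyEq hev
    (hev.self_of_nhdsWithin (mem_range_self _))) hright)

/-- Dilating a bicharacteristic yields a bicharacteristic, after a change of time. -/
theorem IsBicharacteristicOn.dilation {F : CotangentBundle I M → ℝ}
    (hF : IsPositiveHamiltonian F) {γ : ℝ → CotangentBundle I M} {s : Set ℝ}
    (hγ : IsBicharacteristicOn F γ s) {c : ℝ} (hc : 0 < c) :
    IsBicharacteristicOn F (fun t ↦ _root_.dilation c (γ (c * t))) ((fun t ↦ c * t) ⁻¹' s) := by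
  refine ⟨fun t ht ↦ dilation_mem_nonzeroCovectors hc.ne' (hγ.1 _ ht), fun t ht ↦ ?_⟩
  have h := hγ.2 (c * t) ht
  have hcont : ContinuousWithinAt (fun t ↦ γ (c * t)) ((fun t ↦ c * t) ⁻¹' s) t :=
    h.1.comp (continuous_const_mul c).continuousWithinAt fun u hu ↦ hu
  refine ⟨?_, ?_⟩
  · exact ((continuous_dilation (I := I) (M := M)).comp
      (Continuous.prodMk_right c)).continuousAt.comp_continuousWithinAt hcont
  set e := extChartAt (cotangentModel I) (γ (c * t)) with he
  obtain ⟨X, hX, hXd⟩ : ∃ X : ModelVec n × ModelCovec n,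
      (hamiltonianVectorField F (γ (c * t)) : ModelVec n × ModelCovec n) = X ∧
      HasDerivWithinAt (fun u ↦ e (γ u)) X s (c * t) := by
    refine ⟨_, rfl, ?_⟩
    have h1 := HasMFDerivWithinAt.hasDerivWithinAt_extChartAt h (mem_extChartAt_source (γ (c * t)))
    have h2 : tangentCoordChange (cotangentModel I) (γ (c * t)) (γ (c * t)) (γ (c * t))
        (hamiltonianVectorField F (γ (c * t)) : ModelVec n × ModelCovec n) =
        (hamiltonianVectorField F (γ (c * t)) : ModelVec n × ModelCovec n) :=
      tangentCoordChange_self (mem_extChartAt_source _)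
    exact h2 ▸ h1
  have hd2 : HasDerivWithinAt (fun u ↦ e (γ (c * u))) (c • X) ((fun t ↦ c * t) ⁻¹' s) t := by
    have hl : HasDerivWithinAt (fun u : ℝ ↦ c * u) c ((fun t ↦ c * t) ⁻¹' s) t := by
      simpa using ((hasDerivAt_id t).const_mul c).hasDerivWithinAt
    exact HasDerivWithinAt.scomp t hXd hl fun u hu ↦ hu
  have hd3 : HasDerivWithinAt (fun u ↦ modelDilation n c (e (γ (c * u))))
      (modelDilation n c (c • X)) ((fun t ↦ c * t) ⁻¹' s) t :=
    (modelDilation n c).hasFDerivAt.comp_hasDerivWithinAt t hd2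
  have hev : (fun u ↦ e (_root_.dilation c (γ (c * u)))) =ᶠ[𝓝[(fun t ↦ c * t) ⁻¹' s] t]
      fun u ↦ modelDilation n c (e (γ (c * u))) := by
    filter_upwards [hcont.preimage_mem_nhdsWithin
      (extChartAt_source_mem_nhds (I := cotangentModel I) (γ (c * t)))] with u hu
    exact extChartAt_cotangent_dilation c _ _ (mem_extChartAt_cotangent_source.1 hu)
  have hd4 := hd3.congr_of_eventuallyEq hev (hev.self_of_nhdsWithin ht)
  have hval : modelDilation n c (c • X) =
      (hamiltonianVectorField F (_root_.dilation c (γ (c * t))) : ModelVec n × ModelCovec n) := by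
    rw [hF.hamiltonianVectorField_dilation hc (hγ.1 _ ht), hX, map_smul]
  rw [hval] at hd4
  have hd5 := hd4.hasFDerivWithinAt
  simp only [mfld_simps]
  exact hd5

end Dilation

/-! ### Smooth symplectic slices of a family of curves -/

section Slice

variable {m : ℕ} {M : Type*} [TopologicalSpace M] [ChartedSpace (EuclideanHalfSpace (m + 1)) M]
  [IsManifold (𝓡∂ (m + 1)) ∞ M] {F : CotangentBundle (𝓡∂ (m + 1)) M → ℝ}
  {E : Type*} [NormedAddCommGroup E] [NormedSpace ℝ E]

/-- The map `f` is of class `C^k` at `w₀` in the canonical coordinates at `p`, and near `w₀` it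
pulls the symplectic form back to `σ`. -/
def IsSmoothSlice (k : ℕ) (σ : E → E → ℝ) (w₀ : E) (f : E → CotangentBundle (𝓡∂ (m + 1)) M)
    (p : CotangentBundle (𝓡∂ (m + 1)) M) : Prop :=
  ContDiffAt ℝ k (fun w ↦ extChartAt (cotangentModel (𝓡∂ (m + 1))) p (f w)) w₀ ∧
    ∀ᶠ w in 𝓝 w₀, f w ∈ (extChartAt (cotangentModel (𝓡∂ (m + 1))) p).source ∧
      ∀ a b, stdSymplectic
        (fderiv ℝ (fun w ↦ extChartAt (cotangentModel (𝓡∂ (m + 1))) p (f w)) w a)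
        (fderiv ℝ (fun w ↦ extChartAt (cotangentModel (𝓡∂ (m + 1))) p (f w)) w b) = σ a b

variable {k : ℕ} {σ : E → E → ℝ} {w₀ : E} {f : E → CotangentBundle (𝓡∂ (m + 1)) M}
  {p p' : CotangentBundle (𝓡∂ (m + 1)) M}

theorem IsSmoothSlice.continuousAt (h : IsSmoothSlice k σ w₀ f p) : ContinuousAt f w₀ := by
  set e := extChartAt (cotangentModel (𝓡∂ (m + 1))) p with he
  have hev : f =ᶠ[𝓝 w₀] fun w ↦ e.symm (e (f w)) := by
    filter_upwards [h.2] with w hw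
    rw [e.left_inv hw.1]
  refine ContinuousAt.congr_of_eventuallyEq ?_ hev
  exact ContinuousAt.comp (g := e.symm)
    (continuousAt_extChartAt_symm'' (e.map_source h.2.self_of_nhds.1)) h.1.continuousAt

/-- The notion of a smooth slice does not depend on the canonical coordinates. -/
theorem IsSmoothSlice.change_chart (hk : 1 ≤ k) (h : IsSmoothSlice k σ w₀ f p)
    (hp' : f w₀ ∈ (extChartAt (cotangentModel (𝓡∂ (m + 1))) p').source) :
    IsSmoothSlice k σ w₀ f p' := by
  set J := cotangentModel (𝓡∂ (m + 1)) with hJ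
  set e := extChartAt J p with he
  set e' := extChartAt J p' with he'
  have hsrc : ∀ᶠ w in 𝓝 w₀, f w ∈ e'.source :=
    h.continuousAt.preimage_mem_nhds (extChartAt_source_mem_nhds' hp')
  have heq : (fun w ↦ e' (f w)) =ᶠ[𝓝 w₀] fun w ↦ (e' ∘ e.symm) (e (f w)) := by
    filter_upwards [h.2] with w hw
    rw [Function.comp_apply, e.left_inv hw.1]
  have hrange : ∀ w, e (f w) ∈ range J := fun w ↦ mem_range_self _
  refine ⟨?_, ?_⟩
  · refine ContDiffAt.congr_of_eventuallyEq ?_ heq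
    have h1 : ContDiffWithinAt ℝ k (e' ∘ e.symm) (range J) (e (f w₀)) :=
      (contDiffWithinAt_extChartAt_comp_symm h.2.self_of_nhds.1 hp').of_le
        (by exact_mod_cast le_top)
    -- The change of chart is smooth only within the half-space, but f takes its values in the
    -- manifold, so this suffices for smoothness in the unrestricted variable w.
    have h2 := h1.comp w₀ h.1.contDiffWithinAt (s := univ) (fun w _ ↦ hrange w)
    exact h2.contDiffAt Filter.univ_mem
  · have hd : ∀ᶠ w in 𝓝 w₀, DifferentiableAt ℝ (fun w ↦ e (f w)) w := by
      filter_upwards [h.1.eventually (by simp)] with w hw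
      exact hw.differentiableAt (by exact_mod_cast (by omega : k ≠ 0))
    filter_upwards [hsrc, h.2, heq.eventuallyEq_nhds, hd] with w h1 h2 h3 h4
    refine ⟨h1, fun a b ↦ ?_⟩
    have hT := hasFDerivWithinAt_tangentCoordChange (I := J) (x := p) (y := p') (z := f w) ⟨h2.1, h1⟩
    have hc := (hT.comp w h4.hasFDerivAt.hasFDerivWithinAt (s := univ)
      (fun w _ ↦ hrange w)).hasFDerivAt Filter.univ_mem
    have hfd := (hc.congr_of_eventuallyEq h3).fderiv
    have hv : ∀ v, fderiv ℝ (fun w ↦ e' (f w)) w v =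
        tangentCoordChange J p p' (f w) (fderiv ℝ (fun w ↦ e (f w)) w v) :=
      fun v ↦ congrArg (fun B : E →L[ℝ] ModelVec (m + 1) × ModelCovec (m + 1) ↦ B v) hfd
    rw [hv, hv, stdSymplectic_tangentCoordChange h2.1 h1]
    exact h2.2 a b

/-- The slice at t₂ is the slice at t₁ followed by the extended flow for the fixed time t₂ − t₁,
which is C^k and symplectic. -/
theorem IsFlowBox.smoothSlice_of_tracks [T2Space M] (hF : IsPositiveHamiltonian F) (hk : 2 ≤ k)
    {r : CotangentBundle (𝓡∂ (m + 1)) M} {G : ModelVec (m + 1) × ModelCovec (m + 1) → ℝ}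
    {Φ : (ModelVec (m + 1) × ModelCovec (m + 1)) × ℝ → ModelVec (m + 1) × ModelCovec (m + 1)}
    {δ ε : ℝ} (hbox : IsFlowBox F k r G Φ δ ε) {γ : E → ℝ → CotangentBundle (𝓡∂ (m + 1)) M}
    {t₁ t₂ : ℝ} (h12 : t₁ ≤ t₂) (hlt : t₂ < t₁ + ε) (h : IsSmoothSlice k σ w₀ (fun w ↦ γ w t₁) r)
    (hball : extChartAt (cotangentModel (𝓡∂ (m + 1))) r (γ w₀ t₁) ∈
      Metric.ball (extChartAt (cotangentModel (𝓡∂ (m + 1))) r r) ε)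
    (hbi : ∀ᶠ w in 𝓝 w₀, IsBicharacteristicOn F (γ w) (Icc t₁ t₂)) :
    IsSmoothSlice k σ w₀ (fun w ↦ γ w t₂) r := by
  set e := extChartAt (cotangentModel (𝓡∂ (m + 1))) r with he
  have hs : t₂ - t₁ ∈ Ioo (-ε) ε := ⟨by linarith [hbox.pos], by linarith⟩
  have hball' : ∀ᶠ w in 𝓝 w₀, e (γ w t₁) ∈ Metric.ball (e r) ε :=
    h.1.continuousAt.preimage_mem_nhds (Metric.isOpen_ball.mem_nhds hball)
  have htr : ∀ᶠ w in 𝓝 w₀, γ w t₂ ∈ e.source ∧ e (γ w t₂) = Φ (e (γ w t₁), t₂ - t₁) := by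
    filter_upwards [hball', h.2, hbi] with w h1 h2 h3
    exact hbox.tracks hF hk h3 hlt h2.1 h1 t₂ (right_mem_Icc.2 h12)
  have heq : (fun w ↦ e (γ w t₂)) =ᶠ[𝓝 w₀] fun w ↦ Φ (e (γ w t₁), t₂ - t₁) :=
    htr.mono fun w hw ↦ hw.2
  refine ⟨?_, ?_⟩
  · refine ContDiffAt.congr_of_eventuallyEq ?_ heq
    exact ContDiffAt.comp w₀ (hbox.flow_contDiffAt _ hball _ hs) (h.1.prodMk contDiffAt_const)
  · have hd : ∀ᶠ w in 𝓝 w₀, DifferentiableAt ℝ (fun w ↦ e (γ w t₁)) w := by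
      filter_upwards [h.1.eventually (by simp)] with w hw
      exact hw.differentiableAt (by exact_mod_cast (by omega : k ≠ 0))
    filter_upwards [htr, h.2, heq.eventuallyEq_nhds, hd, hball'] with w h1 h2 h3 h4 h5
    refine ⟨h1.1, fun a b ↦ ?_⟩
    have hΦ : HasFDerivAt Φ (fderiv ℝ Φ (e (γ w t₁), t₂ - t₁)) (e (γ w t₁), t₂ - t₁) :=
      ((hbox.flow_contDiffAt _ h5 _ hs).differentiableAt
        (by exact_mod_cast (by omega : k ≠ 0))).hasFDerivAt
    have hc : HasFDerivAt (fun w ↦ Φ (e (γ w t₁), t₂ - t₁)) _ w :=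
      HasFDerivAt.comp w hΦ (h4.hasFDerivAt.prodMk (hasFDerivAt_const (t₂ - t₁) w))
    have hfd := (hc.congr_of_eventuallyEq h3).fderiv
    have hv : ∀ v, fderiv ℝ (fun w ↦ e (γ w t₂)) w v =
        fderiv ℝ Φ (e (γ w t₁), t₂ - t₁) (fderiv ℝ (fun w ↦ e (γ w t₁)) w v, 0) :=
      fun v ↦ congrArg (fun B : E →L[ℝ] ModelVec (m + 1) × ModelCovec (m + 1) ↦ B v) hfd
    rw [hv, hv, hbox.flow_symplectic _ h5 _ hs]
    exact h2.2 a b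

end Slice

/-! ### Flow boxes at entrance, exit and interior points -/

section FlowBoxShapes

variable {m : ℕ} {M : Type*} [TopologicalSpace M] [ChartedSpace (EuclideanHalfSpace (m + 1)) M]
  [IsManifold (𝓡∂ (m + 1)) ∞ M] {F : CotangentBundle (𝓡∂ (m + 1)) M → ℝ} {k : ℕ}
  {r : CotangentBundle (𝓡∂ (m + 1)) M} {G : ModelVec (m + 1) × ModelCovec (m + 1) → ℝ}
  {Φ : (ModelVec (m + 1) × ModelCovec (m + 1)) × ℝ → ModelVec (m + 1) × ModelCovec (m + 1)}
  {δ ε : ℝ}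

theorem IsFlowBox.vectorField_eq (hF : IsPositiveHamiltonian F) (h : IsFlowBox F k r G Φ δ ε) :
    (hamiltonianVectorField F r : ModelVec (m + 1) × ModelCovec (m + 1)) =
      hamiltonianVector (fderiv ℝ G (extChartAt (cotangentModel (𝓡∂ (m + 1))) r r)) := by
  have h1 := h.extends_chart _ (Metric.mem_ball_self (h.pos.trans_le h.le))
    (normalCoord_extChartAt_nonneg r r)
  rw [extChartAt_to_inv] at h1
  rw [← h1.2.2.2, ← tangentCoordChange_hamiltonianVectorField (hF.contMDiffAt h1.2.1)
    (mem_extChartAt_source r)]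
  exact (tangentCoordChange_self (I := cotangentModel (𝓡∂ (m + 1))) (mem_extChartAt_source r)).symm

theorem IsFlowBox.flow_continuousAt (h : IsFlowBox F k r G Φ δ ε) :
    ContinuousAt Φ (extChartAt (cotangentModel (𝓡∂ (m + 1))) r r, 0) :=
  (h.flow_contDiffAt _ (Metric.mem_ball_self h.pos) 0 ⟨by linarith [h.pos], h.pos⟩).continuousAt

theorem IsFlowBox.flow_center (h : IsFlowBox F k r G Φ δ ε) :
    Φ (extChartAt (cotangentModel (𝓡∂ (m + 1))) r r, 0) =
      extChartAt (cotangentModel (𝓡∂ (m + 1))) r r :=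
  h.flow_zero _ (Metric.mem_ball_self h.pos)

theorem IsFlowBox.velocity_continuousAt (hk : 2 ≤ k) (h : IsFlowBox F k r G Φ δ ε) :
    ContinuousAt (fun y ↦ normalCoord m (hamiltonianVector (fderiv ℝ G (Φ y))))
      (extChartAt (cotangentModel (𝓡∂ (m + 1))) r r, 0) :=
  ((normalCoord m).continuous.comp
    (h.contDiff_vectorField hk).continuous).continuousAt.comp h.flow_continuousAt

theorem IsFlowBox.hasDerivAt_normalCoord (h : IsFlowBox F k r G Φ δ ε) :
    ∀ z ∈ Metric.ball (extChartAt (cotangentModel (𝓡∂ (m + 1))) r r) ε, ∀ t ∈ Ioo (-ε) ε,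
      HasDerivAt (fun s ↦ normalCoord m (Φ (z, s)))
        (normalCoord m (hamiltonianVector (fderiv ℝ G (Φ (z, t))))) t :=
  fun z hz t ht ↦ (normalCoord m).hasFDerivAt.comp_hasDerivAt t (h.flow_hasDerivAt z hz t ht)

/-- The normal velocity along the extended flow is continuous, so positivity at the centre persists
in a smaller box. Monotonicity then decides on which side of the boundary the extended flow lies,
also outside the manifold. -/
theorem IsPositiveHamiltonian.exists_isFlowBox_strictMonoOn (hF : IsPositiveHamiltonian F)
    (hk : 2 ≤ k) (hr : r ∈ nonzeroCovectors)
    (hpos : 0 < normalCoord m (hamiltonianVectorField F r :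
      ModelVec (m + 1) × ModelCovec (m + 1))) :
    ∃ G Φ δ ε, IsFlowBox F k r G Φ δ ε ∧
      ∀ z ∈ Metric.ball (extChartAt (cotangentModel (𝓡∂ (m + 1))) r r) ε,
        StrictMonoOn (fun t ↦ normalCoord m (Φ (z, t))) (Ioo (-ε) ε) := by
  obtain ⟨G, Φ, δ, ε, h⟩ := hF.exists_isFlowBox hk hr
  have hX := h.vectorField_eq hF
  rw [hX, ← h.flow_center] at hpos
  obtain ⟨ε', hε', hP⟩ := exists_pos_ball_prod_Ioo
    ((h.velocity_continuousAt hk).eventually_const_lt hpos)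
  have h' := h.mono (lt_min hε' h.pos) (min_le_right _ _)
  refine ⟨G, Φ, δ, min ε' ε, h', fun z hz ↦ ?_⟩
  refine strictMonoOn_of_deriv_pos (convex_Ioo _ _)
    (fun t ht ↦ (h'.hasDerivAt_normalCoord z hz t ht).continuousAt.continuousWithinAt)
    fun t ht ↦ ?_
  rw [interior_Ioo] at ht
  rw [(h'.hasDerivAt_normalCoord z hz t ht).deriv]
  exact hP z (Metric.ball_subset_ball (min_le_left _ _) hz) t
    (Ioo_subset_Ioo (neg_le_neg (min_le_left _ _)) (min_le_left _ _) ht)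

theorem IsPositiveHamiltonian.exists_isFlowBox_strictAntiOn (hF : IsPositiveHamiltonian F)
    (hk : 2 ≤ k) (hr : r ∈ nonzeroCovectors)
    (hneg : normalCoord m (hamiltonianVectorField F r :
      ModelVec (m + 1) × ModelCovec (m + 1)) < 0) :
    ∃ G Φ δ ε, IsFlowBox F k r G Φ δ ε ∧
      ∀ z ∈ Metric.ball (extChartAt (cotangentModel (𝓡∂ (m + 1))) r r) ε,
        StrictAntiOn (fun t ↦ normalCoord m (Φ (z, t))) (Ioo (-ε) ε) := by
  obtain ⟨G, Φ, δ, ε, h⟩ := hF.exists_isFlowBox hk hr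
  have hX := h.vectorField_eq hF
  rw [hX, ← h.flow_center] at hneg
  obtain ⟨ε', hε', hP⟩ := exists_pos_ball_prod_Ioo
    ((h.velocity_continuousAt hk).eventually_lt_const hneg)
  have h' := h.mono (lt_min hε' h.pos) (min_le_right _ _)
  refine ⟨G, Φ, δ, min ε' ε, h', fun z hz ↦ ?_⟩
  refine strictAntiOn_of_deriv_neg (convex_Ioo _ _)
    (fun t ht ↦ (h'.hasDerivAt_normalCoord z hz t ht).continuousAt.continuousWithinAt)
    fun t ht ↦ ?_
  rw [interior_Ioo] at ht
  rw [(h'.hasDerivAt_normalCoord z hz t ht).deriv]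
  exact hP z (Metric.ball_subset_ball (min_le_left _ _) hz) t
    (Ioo_subset_Ioo (neg_le_neg (min_le_left _ _)) (min_le_left _ _) ht)

theorem IsPositiveHamiltonian.exists_isFlowBox_interior (hF : IsPositiveHamiltonian F)
    (hk : 2 ≤ k) (hr : r ∈ nonzeroCovectors) (hint : r.proj ∈ (𝓡∂ (m + 1)).interior M) :
    ∃ G Φ δ ε, IsFlowBox F k r G Φ δ ε ∧
      ∀ z ∈ Metric.ball (extChartAt (cotangentModel (𝓡∂ (m + 1))) r r) ε,
        ∀ t ∈ Ioo (-ε) ε, 0 < normalCoord m (Φ (z, t)) := by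
  obtain ⟨G, Φ, δ, ε, h⟩ := hF.exists_isFlowBox hk hr
  have hc : ContinuousAt (fun y ↦ normalCoord m (Φ y))
      (extChartAt (cotangentModel (𝓡∂ (m + 1))) r r, 0) :=
    (normalCoord m).continuous.continuousAt.comp h.flow_continuousAt
  have hpos : 0 < normalCoord m (Φ (extChartAt (cotangentModel (𝓡∂ (m + 1))) r r, 0)) := by
    rw [h.flow_center]
    exact (isInteriorPoint_iff_extChartAt_pos (mem_extChartAt_source r.proj)).1 hint
  obtain ⟨ε', hε', hP⟩ := exists_pos_ball_prod_Ioo (hc.eventually_const_lt hpos)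
  refine ⟨G, Φ, δ, min ε' ε, h.mono (lt_min hε' h.pos) (min_le_right _ _), fun z hz t ht ↦ ?_⟩
  exact hP z (Metric.ball_subset_ball (min_le_left _ _) hz) t
    (Ioo_subset_Ioo (neg_le_neg (min_le_left _ _)) (min_le_left _ _) ht)

theorem IsFlowBox.energy (h : IsFlowBox F k r G Φ δ ε) :
    ∀ z ∈ Metric.ball (extChartAt (cotangentModel (𝓡∂ (m + 1))) r r) ε, ∀ t ∈ Ioo (-ε) ε,
      G (Φ (z, t)) = G z := by
  intro z hz t ht
  have hd : ∀ s ∈ Ioo (-ε) ε, HasDerivAt (fun s ↦ G (Φ (z, s))) 0 s := fun s hs ↦ by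
    have h1 : HasFDerivAt G (fderiv ℝ G (Φ (z, s))) (Φ (z, s)) :=
      (h.contDiff.differentiable (by simp) _).hasFDerivAt
    have h2 := h1.comp_hasDerivAt s (h.flow_hasDerivAt z hz s hs)
    rwa [apply_hamiltonianVector_self] at h2
  have h0 : (0 : ℝ) ∈ Ioo (-ε) ε := ⟨by linarith [h.pos], h.pos⟩
  have := (convex_Ioo (-ε) ε).is_const_of_fderivWithin_eq_zero (𝕜 := ℝ)
    (f := fun s ↦ G (Φ (z, s))) (fun s hs ↦ (hd s hs).differentiableAt.differentiableWithinAt)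
    (fun s hs ↦ by
      rw [fderivWithin_of_isOpen isOpen_Ioo hs]
      ext
      simp [(hd s hs).deriv]) ht h0
  simpa [h.flow_zero z hz] using this

end FlowBoxShapes

/-! ### Regularity of ray families before the exit -/

section RayFamily

variable {m : ℕ} {M : Type*} [TopologicalSpace M] [ChartedSpace (EuclideanHalfSpace (m + 1)) M]
  [IsManifold (𝓡∂ (m + 1)) ∞ M]
  {E : Type*} [NormedAddCommGroup E] [NormedSpace ℝ E]

/-- A family of bicharacteristics `γ w` of energy `en w`, for `w` near `w₀`, that enter the
interior at time `0` and hit the boundary at time `ℓ w`, transversally for `w = w₀`. The initial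
points depend smoothly on `w` and pull the symplectic form back to `σ`. -/
structure IsRayFamily (F : CotangentBundle (𝓡∂ (m + 1)) M → ℝ) (σ : E → E → ℝ) (en : E →L[ℝ] ℝ)
    (γ : E → ℝ → CotangentBundle (𝓡∂ (m + 1)) M) (ℓ : E → ℝ) (w₀ : E) : Prop where
  length_pos : ∀ᶠ w in 𝓝 w₀, 0 < ℓ w
  bichar : ∀ᶠ w in 𝓝 w₀, IsBicharacteristicOn F (γ w) (Icc 0 (ℓ w))
  interior : ∀ᶠ w in 𝓝 w₀, ∀ t ∈ Ioo 0 (ℓ w), (γ w t).proj ∈ (𝓡∂ (m + 1)).interior M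
  boundary : ∀ᶠ w in 𝓝 w₀, (γ w 0).proj ∈ (𝓡∂ (m + 1)).boundary M
  boundary' : ∀ᶠ w in 𝓝 w₀, (γ w (ℓ w)).proj ∈ (𝓡∂ (m + 1)).boundary M
  energy : ∀ᶠ w in 𝓝 w₀, F (γ w 0) = en w
  incoming : 0 < normalCoord m (hamiltonianVectorField F (γ w₀ 0) :
    ModelVec (m + 1) × ModelCovec (m + 1))
  transversal : normalCoord m (hamiltonianVectorField F (γ w₀ (ℓ w₀)) :
    ModelVec (m + 1) × ModelCovec (m + 1)) ≠ 0
  slice : ∀ k : ℕ, 2 ≤ k → IsSmoothSlice k σ w₀ (fun w ↦ γ w 0) (γ w₀ 0)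

variable {F : CotangentBundle (𝓡∂ (m + 1)) M → ℝ} {σ : E → E → ℝ} {en : E →L[ℝ] ℝ}
  {γ : E → ℝ → CotangentBundle (𝓡∂ (m + 1)) M} {ℓ : E → ℝ} {w₀ : E} {k : ℕ}

/-- The time `t` slice of the family is smooth. -/
def IsRegularTime (k : ℕ) (σ : E → E → ℝ) (γ : E → ℝ → CotangentBundle (𝓡∂ (m + 1)) M) (ℓ : E → ℝ)
    (w₀ : E) (t : ℝ) : Prop :=
  (∀ᶠ w in 𝓝 w₀, t < ℓ w) ∧ IsSmoothSlice k σ w₀ (fun w ↦ γ w t) (γ w₀ t)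

/-- If a nearby ray ended at a time in (t₁, t₂], its end would lie on the boundary, whereas the
extended flow is strictly inside for those times. This gives a lower bound for ℓ near w₀ with no
continuity assumption on ℓ. -/
theorem IsFlowBox.isRegularTime [T2Space M] (hF : IsPositiveHamiltonian F) (hk : 2 ≤ k)
    (hγ : IsRayFamily F σ en γ ℓ w₀)
    {r : CotangentBundle (𝓡∂ (m + 1)) M} {G : ModelVec (m + 1) × ModelCovec (m + 1) → ℝ}
    {Φ : (ModelVec (m + 1) × ModelCovec (m + 1)) × ℝ → ModelVec (m + 1) × ModelCovec (m + 1)}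
    {δ ε : ℝ} (hbox : IsFlowBox F k r G Φ δ ε)
    (hpos : ∀ z ∈ Metric.ball (extChartAt (cotangentModel (𝓡∂ (m + 1))) r r) ε,
      0 ≤ normalCoord m z → ∀ s ∈ Ioo 0 ε, 0 < normalCoord m (Φ (z, s)))
    {t₁ t₂ : ℝ} (h0 : 0 ≤ t₁) (h12 : t₁ ≤ t₂) (hlt : t₂ < t₁ + ε)
    (hsrc : γ w₀ t₁ ∈ (extChartAt (cotangentModel (𝓡∂ (m + 1))) r).source)
    (hball : extChartAt (cotangentModel (𝓡∂ (m + 1))) r (γ w₀ t₁) ∈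
      Metric.ball (extChartAt (cotangentModel (𝓡∂ (m + 1))) r r) ε)
    (h : IsRegularTime k σ γ ℓ w₀ t₁) : IsRegularTime k σ γ ℓ w₀ t₂ := by
  set e := extChartAt (cotangentModel (𝓡∂ (m + 1))) r with he
  have hsl := h.2.change_chart (by omega) hsrc
  have hball' : ∀ᶠ w in 𝓝 w₀, e (γ w t₁) ∈ Metric.ball (e r) ε :=
    hsl.1.continuousAt.preimage_mem_nhds (Metric.isOpen_ball.mem_nhds hball)
  have hlen : ∀ᶠ w in 𝓝 w₀, t₂ < ℓ w := by
    filter_upwards [h.1, hball', hsl.2, hγ.bichar, hγ.boundary'] with w h1 h2 h3 h4 h5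
    by_contra! hle
    have htr := hbox.tracks hF hk (h4.mono (Icc_subset_Icc_left h0)) (hle.trans_lt hlt) h3.1 h2
      (ℓ w) (right_mem_Icc.2 h1.le)
    have h6 := hpos _ h2 (normalCoord_extChartAt_nonneg _ _) (ℓ w - t₁)
      ⟨by linarith, by linarith⟩
    rw [← htr.2] at h6
    exact h6.ne' ((isBoundaryPoint_iff_extChartAt_eq_zero
      (mem_extChartAt_cotangent_source.1 htr.1)).1 h5)
  refine ⟨hlen, ?_⟩
  have hbi : ∀ᶠ w in 𝓝 w₀, IsBicharacteristicOn F (γ w) (Icc t₁ t₂) := by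
    filter_upwards [hlen, hγ.bichar] with w h1 h2
    exact h2.mono (Icc_subset_Icc h0 h1.le)
  exact (hbox.smoothSlice_of_tracks hF hk h12 hlt hsl hball hbi).change_chart (by omega)
    (mem_extChartAt_source _)

/-- At time 0 transversality pushes the flow into the interior, and at later times before the exit
the point is interior already. In both cases a box has the positivity that `IsFlowBox.isRegularTime`
needs. -/
theorem IsRayFamily.exists_isRegularTime_imp [T2Space M] (hF : IsPositiveHamiltonian F)
    (hk : 2 ≤ k) (hγ : IsRayFamily F σ en γ ℓ w₀) {t : ℝ} (ht : t ∈ Ico 0 (ℓ w₀)) :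
    ∃ η > 0, ∀ t₁ t₂, 0 ≤ t₁ → t₁ ≤ t₂ → t₂ < ℓ w₀ → |t₁ - t| < η → |t₂ - t| < η →
      IsRegularTime k σ γ ℓ w₀ t₁ → IsRegularTime k σ γ ℓ w₀ t₂ := by
  have hbi := hγ.bichar.self_of_nhds
  have htI : t ∈ Icc 0 (ℓ w₀) := Ico_subset_Icc_self ht
  obtain ⟨G, Φ, δ, ε, hbox, hpos⟩ : ∃ G Φ δ ε, IsFlowBox F k (γ w₀ t) G Φ δ ε ∧
      ∀ z ∈ Metric.ball (extChartAt (cotangentModel (𝓡∂ (m + 1))) (γ w₀ t) (γ w₀ t)) ε,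
      0 ≤ normalCoord m z → ∀ s ∈ Ioo 0 ε, 0 < normalCoord m (Φ (z, s)) := by
    rcases ht.1.eq_or_lt with h0 | h0
    · obtain ⟨G, Φ, δ, ε, hbox, hmono⟩ := hF.exists_isFlowBox_strictMonoOn hk (hbi.1 t htI)
        (by rw [← h0]; exact hγ.incoming)
      refine ⟨G, Φ, δ, ε, hbox, fun z hz hz' s hs ↦ ?_⟩
      have := hmono z hz (⟨by linarith [hbox.pos], hbox.pos⟩ : (0 : ℝ) ∈ Ioo (-ε) ε)
        ⟨by linarith [hs.1, hbox.pos], hs.2⟩ hs.1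
      simp only [hbox.flow_zero z hz] at this
      linarith
    · obtain ⟨G, Φ, δ, ε, hbox, hint⟩ := hF.exists_isFlowBox_interior hk (hbi.1 t htI)
        (hγ.interior.self_of_nhds t ⟨h0, ht.2⟩)
      exact ⟨G, Φ, δ, ε, hbox, fun z hz _ s hs ↦ hint z hz s
        ⟨by linarith [hs.1, hbox.pos], hs.2⟩⟩
  set e := extChartAt (cotangentModel (𝓡∂ (m + 1))) (γ w₀ t) with he
  have hopen : e.source ∩ e ⁻¹' Metric.ball (e (γ w₀ t)) ε ∈ 𝓝 (γ w₀ t) :=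
    ((continuousOn_extChartAt (γ w₀ t)).isOpen_inter_preimage (isOpen_extChartAt_source (γ w₀ t))
      Metric.isOpen_ball).mem_nhds ⟨mem_extChartAt_source _, Metric.mem_ball_self hbox.pos⟩
  obtain ⟨η, hη, hsub⟩ := Metric.mem_nhdsWithin_iff.1
    ((hbi.continuousOn t htI).preimage_mem_nhdsWithin hopen)
  refine ⟨min η (ε / 2), lt_min hη (half_pos hbox.pos), fun t₁ t₂ h0 h12 h2 hd1 hd2 hreg ↦ ?_⟩
  have hm := hsub (show t₁ ∈ Metric.ball t η ∩ Icc 0 (ℓ w₀) from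
    ⟨hd1.trans_le (min_le_left _ _), h0, (h12.trans_lt h2).le⟩)
  have hd1' := abs_lt.1 (hd1.trans_le (min_le_right _ _))
  have hd2' := abs_lt.1 (hd2.trans_le (min_le_right _ _))
  exact hbox.isRegularTime hF hk hγ hpos h0 h12 (by linarith [hd1'.1, hd2'.2]) hm.1 hm.2 hreg

/-- All times before the exit time are regular. -/
theorem IsRayFamily.isRegularTime [T2Space M] (hF : IsPositiveHamiltonian F)
    (hk : 2 ≤ k) (hγ : IsRayFamily F σ en γ ℓ w₀) :
    ∀ t ∈ Ico 0 (ℓ w₀), IsRegularTime k σ γ ℓ w₀ t := by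
  have h0 : IsRegularTime k σ γ ℓ w₀ 0 := ⟨hγ.length_pos, hγ.slice k hk⟩
  intro t ht
  -- The induction on connected sets is symmetric, while regularity propagates only forward in time.
  -- The property used is therefore regularity of all times up to the given one, which passes
  -- trivially to earlier times.
  refine isPreconnected_Ico.induction₂' (s := Ico 0 (ℓ w₀))
    (fun x y ↦ (∀ s ∈ Icc 0 x, IsRegularTime k σ γ ℓ w₀ s) →
      ∀ s ∈ Icc 0 y, IsRegularTime k σ γ ℓ w₀ s) (fun x hx ↦ ?_)
    (fun x y z _ _ _ h1 h2 h3 ↦ h2 (h1 h3)) (left_mem_Ico.2 (ht.1.trans_lt ht.2)) ht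
    (fun s hs ↦ by rwa [le_antisymm hs.2 hs.1]) t (right_mem_Icc.2 ht.1)
  obtain ⟨η, hη, himp⟩ := hγ.exists_isRegularTime_imp hF hk hx
  filter_upwards [self_mem_nhdsWithin, mem_nhdsWithin_of_mem_nhds (Metric.ball_mem_nhds x hη)]
    with y hy hyη
  have hyη' : |y - x| < η := hyη
  constructor
  · intro hreg s hs
    rcases le_total s x with hsx | hxs
    · exact hreg s ⟨hs.1, hsx⟩
    · refine himp x s hx.1 hxs (hs.2.trans_lt hy.2) (by simpa using hη) ?_
        (hreg x (right_mem_Icc.2 hx.1))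
      rw [abs_of_nonneg (by linarith)]
      exact lt_of_le_of_lt (by linarith [hs.2]) (le_abs_self (y - x) |>.trans_lt hyη')
  · intro hreg s hs
    rcases le_total s y with hsy | hys
    · exact hreg s ⟨hs.1, hsy⟩
    · refine himp y s hy.1 hys (hs.2.trans_lt hx.2) hyη' ?_ (hreg y (right_mem_Icc.2 hy.1))
      rw [abs_lt] at hyη' ⊢
      constructor <;> linarith [hs.2, hyη'.1]

end RayFamily

theorem eventually_nhds_fst {X Y : Type*} [TopologicalSpace X] [TopologicalSpace Y] {P : X → Prop}
    {x : X} {y : Y} (h : ∀ᶠ x' in 𝓝 x, P x') : ∀ᶠ z in 𝓝 (x, y), P z.1 :=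
  continuous_fst.continuousAt.eventually h

/-! ### The symplectic normal form along rays -/

section NormalForm

variable {m : ℕ} {M : Type*} [TopologicalSpace M] [ChartedSpace (EuclideanHalfSpace (m + 1)) M]
  [IsManifold (𝓡∂ (m + 1)) ∞ M] {E : Type*} [NormedAddCommGroup E] [NormedSpace ℝ E]
  {F : CotangentBundle (𝓡∂ (m + 1)) M → ℝ} {σ : E → E → ℝ} {en : E →L[ℝ] ℝ}
  {γ : E → ℝ → CotangentBundle (𝓡∂ (m + 1)) M} {ℓ : E → ℝ} {w₀ : E} {k : ℕ}
  {r : CotangentBundle (𝓡∂ (m + 1)) M} {G : ModelVec (m + 1) × ModelCovec (m + 1) → ℝ}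
  {Φ : (ModelVec (m + 1) × ModelCovec (m + 1)) × ℝ → ModelVec (m + 1) × ModelCovec (m + 1)}
  {δ ε : ℝ}

theorem IsFlowBox.fderiv_flow_apply (hk : 2 ≤ k) (hbox : IsFlowBox F k r G Φ δ ε)
    {z : ModelVec (m + 1) × ModelCovec (m + 1)}
    (hz : z ∈ Metric.ball (extChartAt (cotangentModel (𝓡∂ (m + 1))) r r) ε) {s : ℝ}
    (hs : s ∈ Ioo (-ε) ε) (a : ModelVec (m + 1) × ModelCovec (m + 1)) (α : ℝ) :
    fderiv ℝ Φ (z, s) (a, α) =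
      fderiv ℝ Φ (z, s) (a, 0) + α • hamiltonianVector (fderiv ℝ G (Φ (z, s))) := by
  have hΦ : HasFDerivAt Φ (fderiv ℝ Φ (z, s)) (z, s) :=
    ((hbox.flow_contDiffAt _ hz _ hs).differentiableAt
      (by exact_mod_cast (by omega : k ≠ 0))).hasFDerivAt
  have h1 : HasDerivAt (fun u : ℝ ↦ (z, u)) ((0 : ModelVec (m + 1) × ModelCovec (m + 1)), (1 : ℝ)) s :=
    (hasDerivAt_const s z).prodMk (hasDerivAt_id s)
  have h2 := (hΦ.comp_hasDerivAt s h1).unique (hbox.flow_hasDerivAt z hz s hs)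
  rw [← h2, ← map_smul, ← map_add]
  congr 1
  simp

/-- With α, β the time components and D u, D v the variations of the energy, the extra terms are −dt
∧ de. -/
theorem stdSymplectic_add_smul_hamiltonianVector {n : ℕ} {D : ModelVec n × ModelCovec n →L[ℝ] ℝ}
    (u v : ModelVec n × ModelCovec n) (α β : ℝ) :
    stdSymplectic (u + α • hamiltonianVector D) (v + β • hamiltonianVector D) =
      stdSymplectic u v - α * D v + β * D u := by
  rw [stdSymplectic_add_left, stdSymplectic_add_right, stdSymplectic_add_right,
    stdSymplectic_smul_left, stdSymplectic_smul_left, stdSymplectic_smul_right,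
    stdSymplectic_smul_right, stdSymplectic_self, stdSymplectic_hamiltonianVector,
    stdSymplectic_swap u (hamiltonianVector D), stdSymplectic_hamiltonianVector]
  ring

/-- In the coordinates given by the initial point and time, the symplectic form is
`σ - dt ∧ d(energy)`. -/
theorem IsFlowBox.normalForm [T2Space M] (hF : IsPositiveHamiltonian F) (hk : 2 ≤ k)
    (hγ : IsRayFamily F σ en γ ℓ w₀) (hbox : IsFlowBox F k r G Φ δ ε) {t₁ t : ℝ} (h0 : 0 ≤ t₁)
    (h1t : t₁ ≤ t) (htℓ : t ≤ ℓ w₀) (hlt : t < t₁ + ε) (hreg : IsRegularTime k σ γ ℓ w₀ t₁)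
    (hsrc : γ w₀ t₁ ∈ (extChartAt (cotangentModel (𝓡∂ (m + 1))) r).source)
    (hball : extChartAt (cotangentModel (𝓡∂ (m + 1))) r (γ w₀ t₁) ∈
      Metric.ball (extChartAt (cotangentModel (𝓡∂ (m + 1))) r r) ε) :
    ContDiffAt ℝ k (fun y : E × ℝ ↦
      Φ (extChartAt (cotangentModel (𝓡∂ (m + 1))) r (γ y.1 t₁), y.2 - t₁)) (w₀, t) ∧
    Φ (extChartAt (cotangentModel (𝓡∂ (m + 1))) r (γ w₀ t₁), t - t₁) =
      extChartAt (cotangentModel (𝓡∂ (m + 1))) r (γ w₀ t) ∧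
    (∀ᶠ w in 𝓝 w₀, extChartAt (cotangentModel (𝓡∂ (m + 1))) r (γ w t₁) ∈
      Metric.ball (extChartAt (cotangentModel (𝓡∂ (m + 1))) r r) ε) ∧
    (∀ᶠ w in 𝓝 w₀, ∀ u, t₁ ≤ u → u ≤ ℓ w → u < t₁ + ε →
      γ w u ∈ (extChartAt (cotangentModel (𝓡∂ (m + 1))) r).source ∧
      extChartAt (cotangentModel (𝓡∂ (m + 1))) r (γ w u) =
        Φ (extChartAt (cotangentModel (𝓡∂ (m + 1))) r (γ w t₁), u - t₁)) ∧
    ∀ᶠ y in 𝓝 (w₀, t), ∀ a b : E × ℝ,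
      stdSymplectic
        (fderiv ℝ (fun y : E × ℝ ↦
          Φ (extChartAt (cotangentModel (𝓡∂ (m + 1))) r (γ y.1 t₁), y.2 - t₁)) y a)
        (fderiv ℝ (fun y : E × ℝ ↦
          Φ (extChartAt (cotangentModel (𝓡∂ (m + 1))) r (γ y.1 t₁), y.2 - t₁)) y b) =
        σ a.1 b.1 - a.2 * en b.1 + b.2 * en a.1 := by
  set e := extChartAt (cotangentModel (𝓡∂ (m + 1))) r with he
  have hk0 : (k : WithTop ℕ∞) ≠ 0 := by exact_mod_cast (by omega : k ≠ 0)
  have hsl := hreg.2.change_chart (by omega) hsrc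
  have hball' : ∀ᶠ w in 𝓝 w₀, e (γ w t₁) ∈ Metric.ball (e r) ε :=
    hsl.1.continuousAt.preimage_mem_nhds (Metric.isOpen_ball.mem_nhds hball)
  have hs : t - t₁ ∈ Ioo (-ε) ε := ⟨by linarith [hbox.pos], by linarith⟩
  have htr : ∀ᶠ w in 𝓝 w₀, ∀ u, t₁ ≤ u → u ≤ ℓ w → u < t₁ + ε → γ w u ∈ e.source ∧
      e (γ w u) = Φ (e (γ w t₁), u - t₁) := by
    filter_upwards [hball', hsl.2, hγ.bichar] with w h1 h2 h3 u h4 h5 h6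
    exact hbox.tracks hF hk (h3.mono (Icc_subset_Icc h0 h5)) h6 h2.1 h1 u (right_mem_Icc.2 h4)
  refine ⟨?_, (htr.self_of_nhds t h1t htℓ hlt).2.symm, hball', htr, ?_⟩
  · have h1 : ContDiffAt ℝ k (fun y : E × ℝ ↦ e (γ y.1 t₁)) (w₀, t) :=
      ContDiffAt.comp (w₀, t) (f := Prod.fst) (g := fun w ↦ e (γ w t₁)) hsl.1 contDiffAt_fst
    have h2 : ContDiffAt ℝ k (fun y : E × ℝ ↦ y.2 - t₁) (w₀, t) :=
      contDiffAt_snd.sub contDiffAt_const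
    exact ContDiffAt.comp (w₀, t) (hbox.flow_contDiffAt _ hball _ hs) (h1.prodMk h2)
  have hd : ∀ᶠ w in 𝓝 w₀, DifferentiableAt ℝ (fun w ↦ e (γ w t₁)) w := by
    filter_upwards [hsl.1.eventually (by simp)] with w hw
    exact hw.differentiableAt hk0
  have hen : ∀ᶠ w in 𝓝 w₀, e (γ w t₁) ∈ Metric.ball (e r) ε ∧ G (e (γ w t₁)) = en w := by
    filter_upwards [hball', hsl.2, hreg.1, hγ.bichar, hγ.energy] with w h1 h2 h3 h4 h5
    refine ⟨h1, ?_⟩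
    have h6 := (hbox.extends_chart _ (Metric.ball_subset_ball hbox.le h1)
      (normalCoord_extChartAt_nonneg _ _)).2.2.1
    rw [← he, e.left_inv h2.1] at h6
    rw [← h6, h4.energy hF t₁ ⟨h0, h3.le⟩, h5]
  have hw : ∀ᶠ y in 𝓝 (w₀, t), DifferentiableAt ℝ (fun w ↦ e (γ w t₁)) y.1 ∧
      (∀ᶠ w in 𝓝 y.1, e (γ w t₁) ∈ Metric.ball (e r) ε ∧ G (e (γ w t₁)) = en w) ∧
      ∀ a b, stdSymplectic (fderiv ℝ (fun w ↦ e (γ w t₁)) y.1 a)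
        (fderiv ℝ (fun w ↦ e (γ w t₁)) y.1 b) = σ a b :=
    eventually_nhds_fst ((hd.and (hen.eventually_nhds.and (hsl.2.mono fun _ h ↦ h.2))))
  have hIoo : ∀ᶠ y in 𝓝 (w₀, t), y.2 - t₁ ∈ Ioo (-ε) ε :=
    (continuousAt_snd.sub continuousAt_const).preimage_mem_nhds (isOpen_Ioo.mem_nhds hs)
  filter_upwards [hw, hIoo] with ⟨w, u⟩ ⟨h1, h2, h3⟩ hu a b
  simp only at h1 h2 h3 hu
  have hz := h2.self_of_nhds.1
  set L := fderiv ℝ (fun w ↦ e (γ w t₁)) w with hL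
  have hΦ : HasFDerivAt Φ (fderiv ℝ Φ (e (γ w t₁), u - t₁)) (e (γ w t₁), u - t₁) :=
    ((hbox.flow_contDiffAt _ hz _ hu).differentiableAt hk0).hasFDerivAt
  have hfst : HasFDerivAt (fun y : E × ℝ ↦ e (γ y.1 t₁)) (L.comp (ContinuousLinearMap.fst ℝ E ℝ))
      (w, u) :=
    HasFDerivAt.comp (w, u) (f := Prod.fst) (g := fun w ↦ e (γ w t₁)) h1.hasFDerivAt hasFDerivAt_fst
  have hsnd : HasFDerivAt (fun y : E × ℝ ↦ y.2 - t₁) (ContinuousLinearMap.snd ℝ E ℝ) (w, u) :=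
    hasFDerivAt_snd.sub_const t₁
  have hA : HasFDerivAt (fun y : E × ℝ ↦ Φ (e (γ y.1 t₁), y.2 - t₁)) _ (w, u) :=
    HasFDerivAt.comp (w, u) hΦ (hfst.prodMk hsnd)
  set X := hamiltonianVector (fderiv ℝ G (Φ (e (γ w t₁), u - t₁))) with hX
  have hv : ∀ v : E × ℝ, fderiv ℝ (fun y : E × ℝ ↦ Φ (e (γ y.1 t₁), y.2 - t₁)) (w, u) v =
      fderiv ℝ Φ (e (γ w t₁), u - t₁) (L v.1, 0) + v.2 • X := fun v ↦ by
    rw [← hbox.fderiv_flow_apply hk hz hu]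
    exact congrArg (fun B : E × ℝ →L[ℝ] ModelVec (m + 1) × ModelCovec (m + 1) ↦ B v) hA.fderiv
  -- Conservation of energy by the extended flow makes G at the moved point equal to `en`; this is
  -- differentiated in w.
  have henergy : ∀ v : E, fderiv ℝ G (Φ (e (γ w t₁), u - t₁))
      (fderiv ℝ Φ (e (γ w t₁), u - t₁) (L v, 0)) = en v := by
    have hG : HasFDerivAt G (fderiv ℝ G (Φ (e (γ w t₁), u - t₁))) (Φ (e (γ w t₁), u - t₁)) :=
      (hbox.contDiff.differentiable (by simp) _).hasFDerivAt
    have hc1 : HasFDerivAt (fun w' ↦ Φ (e (γ w' t₁), u - t₁)) _ w :=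
      HasFDerivAt.comp w hΦ (h1.hasFDerivAt.prodMk (hasFDerivAt_const (u - t₁) w))
    have hc2 : HasFDerivAt (fun w' ↦ G (Φ (e (γ w' t₁), u - t₁))) _ w :=
      HasFDerivAt.comp w hG hc1
    have hev : (fun w' ↦ G (Φ (e (γ w' t₁), u - t₁))) =ᶠ[𝓝 w] en := by
      filter_upwards [h2] with w' hw'
      rw [hbox.energy _ hw'.1 _ hu, hw'.2]
    have huniq := (hc2.congr_of_eventuallyEq hev.symm).unique en.hasFDerivAt
    exact fun v ↦ congrArg (fun B : E →L[ℝ] ℝ ↦ B v) huniq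
  rw [hv, hv, hX, stdSymplectic_add_smul_hamiltonianVector, henergy, henergy,
    hbox.flow_symplectic _ hz _ hu, h3]

/-- The slice at the exit time is not known to be smooth, since nearby rays may end earlier. The
normal form starts instead from a slightly earlier regular time in a box centred at time t. -/
theorem IsRayFamily.exists_earlier_time (hγ : IsRayFamily F σ en γ ℓ w₀) {t : ℝ} (ht : 0 < t)
    (htℓ : t ≤ ℓ w₀) (hε : 0 < ε) : ∃ t₁, 0 ≤ t₁ ∧ t₁ < t ∧ t < t₁ + ε ∧
      γ w₀ t₁ ∈ (extChartAt (cotangentModel (𝓡∂ (m + 1))) (γ w₀ t)).source ∧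
      extChartAt (cotangentModel (𝓡∂ (m + 1))) (γ w₀ t) (γ w₀ t₁) ∈
        Metric.ball (extChartAt (cotangentModel (𝓡∂ (m + 1))) (γ w₀ t) (γ w₀ t)) ε := by
  have hbi := hγ.bichar.self_of_nhds
  set e := extChartAt (cotangentModel (𝓡∂ (m + 1))) (γ w₀ t) with he
  have hopen : e.source ∩ e ⁻¹' Metric.ball (e (γ w₀ t)) ε ∈ 𝓝 (γ w₀ t) :=
    ((continuousOn_extChartAt (γ w₀ t)).isOpen_inter_preimage (isOpen_extChartAt_source (γ w₀ t))
      Metric.isOpen_ball).mem_nhds ⟨mem_extChartAt_source _, Metric.mem_ball_self hε⟩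
  obtain ⟨η, hη, hsub⟩ := Metric.mem_nhdsWithin_iff.1
    ((hbi.continuousOn t ⟨ht.le, htℓ⟩).preimage_mem_nhdsWithin hopen)
  set d := min (min (η / 2) (ε / 2)) t with hd
  have hdpos : 0 < d := lt_min (lt_min (half_pos hη) (half_pos hε)) ht
  have hd1 : d ≤ η / 2 := (min_le_left _ _).trans (min_le_left _ _)
  have hd2 : d ≤ ε / 2 := (min_le_left _ _).trans (min_le_right _ _)
  have hd3 : d ≤ t := min_le_right _ _
  have hm := hsub (show t - d ∈ Metric.ball t η ∩ Icc 0 (ℓ w₀) from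
    ⟨by rw [Metric.mem_ball, Real.dist_eq, abs_lt]; constructor <;> linarith,
      by linarith, by linarith⟩)
  exact ⟨t - d, by linarith, by linarith, by linarith, hm.1, hm.2⟩

/-- A positive normal velocity at the exit would make the normal coordinate increase to 0, hence
negative just before, which is impossible inside the manifold. -/
theorem IsRayFamily.outgoing [T2Space M] (hF : IsPositiveHamiltonian F)
    (hγ : IsRayFamily F σ en γ ℓ w₀) :
    normalCoord m (hamiltonianVectorField F (γ w₀ (ℓ w₀)) :
      ModelVec (m + 1) × ModelCovec (m + 1)) < 0 := by
  have hpos := hγ.length_pos.self_of_nhds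
  have hbi := hγ.bichar.self_of_nhds
  refine lt_of_le_of_ne (le_of_not_gt fun h ↦ ?_) hγ.transversal
  obtain ⟨G, Φ, δ, ε, hbox, hmono⟩ := hF.exists_isFlowBox_strictMonoOn (le_refl 2)
    (hbi.1 _ (right_mem_Icc.2 hpos.le)) h
  obtain ⟨t₁, h0, h1, h2, h3, h4⟩ := hγ.exists_earlier_time hpos le_rfl hbox.pos
  have htr := hbox.tracks hF le_rfl (hbi.mono (Icc_subset_Icc_left h0)) h2 h3 h4 _
    (right_mem_Icc.2 h1.le)
  have h5 := hmono _ h4 (⟨by linarith [hbox.pos], hbox.pos⟩ : (0 : ℝ) ∈ Ioo (-ε) ε)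
    (⟨by linarith [hbox.pos], by linarith⟩ : ℓ w₀ - t₁ ∈ Ioo (-ε) ε) (by linarith)
  simp only [← htr.2, hbox.flow_zero _ h4] at h5
  have h6 : normalCoord m (extChartAt (cotangentModel (𝓡∂ (m + 1))) (γ w₀ (ℓ w₀))
      (γ w₀ (ℓ w₀))) = 0 :=
    (isBoundaryPoint_iff_extChartAt_eq_zero
      (mem_extChartAt_cotangent_source.1 htr.1)).1 hγ.boundary'.self_of_nhds
  have h7 := normalCoord_extChartAt_nonneg (γ w₀ (ℓ w₀)) (γ w₀ t₁)
  linarith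

/-- The normal form of the flowout of a ray family near one of its points. -/
theorem IsRayFamily.exists_normalForm [T2Space M] (hF : IsPositiveHamiltonian F) (hk : 2 ≤ k)
    (hγ : IsRayFamily F σ en γ ℓ w₀) {t : ℝ} (ht : t ∈ Icc 0 (ℓ w₀)) :
    ∃ A : E × ℝ → ModelVec (m + 1) × ModelCovec (m + 1), ContDiffAt ℝ k A (w₀, t) ∧
      A (w₀, t) = extChartAt (cotangentModel (𝓡∂ (m + 1))) (γ w₀ t) (γ w₀ t) ∧
      (∀ᶠ y in 𝓝 (w₀, t), 0 ≤ normalCoord m (A y) ↔ y.2 ∈ Icc 0 (ℓ y.1)) ∧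
      (∀ᶠ y in 𝓝 (w₀, t), y.2 ∈ Icc 0 (ℓ y.1) →
        γ y.1 y.2 ∈ (extChartAt (cotangentModel (𝓡∂ (m + 1))) (γ w₀ t)).source ∧
        extChartAt (cotangentModel (𝓡∂ (m + 1))) (γ w₀ t) (γ y.1 y.2) = A y) ∧
      ∀ᶠ y in 𝓝 (w₀, t), ∀ a b : E × ℝ,
        stdSymplectic (fderiv ℝ A y a) (fderiv ℝ A y b) =
          σ a.1 b.1 - a.2 * en b.1 + b.2 * en a.1 := by
  have hpos := hγ.length_pos.self_of_nhds
  have hbi := hγ.bichar.self_of_nhds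
  have hreg := hγ.isRegularTime hF hk
  set e := extChartAt (cotangentModel (𝓡∂ (m + 1))) (γ w₀ t) with he
  rcases ht.1.eq_or_lt with h0 | h0
  · -- the entrance
    obtain ⟨G, Φ, δ, ε, hbox, hmono⟩ := hF.exists_isFlowBox_strictMonoOn hk (hbi.1 t ht)
      (by rw [← h0]; exact hγ.incoming)
    have hε := hbox.pos
    have hγ0 : γ w₀ 0 = γ w₀ t := by rw [h0]
    obtain ⟨hA, hA0, hz, htr, hsymp⟩ := hbox.normalForm hF hk hγ (t₁ := 0) (t := t) le_rfl h0.le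
      ht.2 (by linarith) (hreg 0 ⟨le_rfl, hpos⟩) (by rw [hγ0]; exact mem_extChartAt_source _)
      (by rw [hγ0]; exact Metric.mem_ball_self hε)
    have hIoo : ∀ᶠ y in 𝓝 (w₀, t), y.2 ∈ Ioo (-ε) ε :=
      continuousAt_snd.preimage_mem_nhds (isOpen_Ioo.mem_nhds ⟨by linarith, by linarith⟩)
    -- Regularity of the time ℓ w₀ / 2 bounds ℓ from below near w₀, so near the entrance only the
    -- constraint 0 ≤ t is active.
    have hlen : ∀ᶠ y in 𝓝 (w₀, t), y.2 ≤ ℓ y.1 := by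
      have h1 : ∀ᶠ y in 𝓝 (w₀, t), ℓ w₀ / 2 < ℓ y.1 :=
        eventually_nhds_fst (hreg (ℓ w₀ / 2) ⟨by linarith, by linarith⟩).1
      have h2 : ∀ᶠ y in 𝓝 (w₀, t), y.2 < ℓ w₀ / 2 :=
        continuousAt_snd.eventually_lt_const (by simp only; linarith)
      filter_upwards [h1, h2] with y h3 h4
      linarith
    refine ⟨_, hA, hA0, ?_, ?_, hsymp⟩
    · have hb : ∀ᶠ y in 𝓝 (w₀, t), (γ y.1 0).proj ∈ (𝓡∂ (m + 1)).boundary M :=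
        eventually_nhds_fst hγ.boundary
      filter_upwards [eventually_nhds_fst hz, hIoo, hlen, hb,
        eventually_nhds_fst htr, eventually_nhds_fst hγ.length_pos]
        with y h1 h2 h3 h4 h5 h6
      have hz0 : normalCoord m (Φ (e (γ y.1 0), 0)) = 0 := by
        have h7 := h5 0 le_rfl h6.le (by linarith)
        rw [hbox.flow_zero _ h1]
        exact (isBoundaryPoint_iff_extChartAt_eq_zero
          (mem_extChartAt_cotangent_source.1 h7.1)).1 h4
      -- The normal coordinate is strictly increasing in time and vanishes at time 0, so its sign is
      -- that of the time.
      have h8 := (hmono _ h1).le_iff_le (⟨by linarith, by linarith⟩ : (0 : ℝ) ∈ Ioo (-ε) ε) h2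
      simp only [← he, hz0] at h8
      rw [sub_zero, ← he, h8]
      exact ⟨fun h ↦ ⟨h, h3⟩, fun h ↦ h.1⟩
    · filter_upwards [eventually_nhds_fst htr, hIoo] with y h1 h2 h3
      exact h1 y.2 h3.1 h3.2 (by linarith [h2.2])
  rcases ht.2.lt_or_eq with hlt | heq
  · -- an interior point
    obtain ⟨G, Φ, δ, ε, hbox, hint⟩ := hF.exists_isFlowBox_interior hk (hbi.1 t ht)
      (hγ.interior.self_of_nhds t ⟨h0, hlt⟩)
    obtain ⟨t₁, h10, h1t, ht1, hsrc, hball⟩ := hγ.exists_earlier_time h0 ht.2 hbox.pos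
    obtain ⟨hA, hA0, hz, htr, hsymp⟩ := hbox.normalForm hF hk hγ h10 h1t.le
      ht.2 ht1 (hreg t₁ ⟨h10, h1t.trans hlt⟩) hsrc hball
    have hIoo : ∀ᶠ y in 𝓝 (w₀, t), y.2 ∈ Ioo t₁ (t₁ + ε) :=
      continuousAt_snd.preimage_mem_nhds (isOpen_Ioo.mem_nhds ⟨h1t, ht1⟩)
    have hlen : ∀ᶠ y in 𝓝 (w₀, t), y.2 ≤ ℓ y.1 := by
      have h1 : ∀ᶠ y in 𝓝 (w₀, t), (t + ℓ w₀) / 2 < ℓ y.1 :=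
        eventually_nhds_fst (hreg ((t + ℓ w₀) / 2) ⟨by linarith, by linarith⟩).1
      have h2 : ∀ᶠ y in 𝓝 (w₀, t), y.2 < (t + ℓ w₀) / 2 :=
        continuousAt_snd.eventually_lt_const (by simp only; linarith)
      filter_upwards [h1, h2] with y h3 h4
      linarith
    refine ⟨_, hA, hA0, ?_, ?_, hsymp⟩
    · filter_upwards [eventually_nhds_fst hz, hIoo, hlen] with y h1 h2 h3
      refine iff_of_true (hint _ h1 _ ⟨by linarith [h2.1, hbox.pos], by linarith [h2.2]⟩).le
        ⟨by linarith [h2.1], h3⟩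
    · filter_upwards [eventually_nhds_fst htr, hIoo] with y h1 h2 h3
      exact h1 y.2 h2.1.le h3.2 h2.2
  · -- the exit
    obtain ⟨G, Φ, δ, ε, hbox, hanti⟩ := hF.exists_isFlowBox_strictAntiOn hk (hbi.1 t ht)
      (by rw [heq]; exact hγ.outgoing hF)
    obtain ⟨t₁, h10, h1t, ht1, hsrc, hball⟩ := hγ.exists_earlier_time h0 ht.2 hbox.pos
    have hreg1 := hreg t₁ ⟨h10, h1t.trans_eq heq⟩
    obtain ⟨hA, hA0, hz, htr, hsymp⟩ := hbox.normalForm hF hk hγ h10 h1t.le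
      ht.2 ht1 hreg1 hsrc hball
    have hε := hbox.pos
    have hIoo : ∀ᶠ y in 𝓝 (w₀, t), y.2 ∈ Ioo t₁ (t₁ + ε) :=
      continuousAt_snd.preimage_mem_nhds (isOpen_Ioo.mem_nhds ⟨h1t, ht1⟩)
    obtain ⟨t₂, htt₂, ht₂⟩ : ∃ t₂, t < t₂ ∧ t₂ < t₁ + ε := exists_between ht1
    -- By time t₂ the extended flow from w₀ is strictly outside the half-space, and so it is for
    -- nearby w. Their rays must have ended before, which bounds ℓ from above.
    have hlen : ∀ᶠ w in 𝓝 w₀, ℓ w < t₂ := by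
      have hneg : normalCoord m (Φ (e (γ w₀ t₁), t₂ - t₁)) < 0 := by
        have h1 := hanti _ hball (⟨by linarith, by linarith⟩ : t - t₁ ∈ Ioo (-ε) ε)
          (⟨by linarith, by linarith⟩ : t₂ - t₁ ∈ Ioo (-ε) ε) (by linarith)
        have h2 : normalCoord m (e (γ w₀ t)) = 0 :=
          (isBoundaryPoint_iff_extChartAt_eq_zero (mem_extChartAt_source (γ w₀ t).proj)).1
            (by rw [heq]; exact hγ.boundary'.self_of_nhds)
        simp only at h1
        rw [hA0, h2] at h1
        exact h1
      have hcz : ContinuousAt (fun w ↦ e (γ w t₁)) w₀ :=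
        (hreg1.2.change_chart (by omega) hsrc).1.continuousAt
      have hcΦ : ContinuousAt Φ (e (γ w₀ t₁), t₂ - t₁) :=
        (hbox.flow_contDiffAt _ hball _ ⟨by linarith, by linarith⟩).continuousAt
      have hc : ContinuousAt (fun w ↦ normalCoord m (Φ (e (γ w t₁), t₂ - t₁))) w₀ :=
        (normalCoord m).continuous.continuousAt.comp
          (ContinuousAt.comp (f := fun w ↦ (e (γ w t₁), t₂ - t₁)) (x := w₀) hcΦ
            (hcz.prodMk continuousAt_const))
      filter_upwards [hc.eventually_lt_const hneg, htr] with w h1 h2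
      by_contra! hle
      have h3 := h2 t₂ (by linarith) hle ht₂
      rw [← h3.2] at h1
      exact absurd h1 (not_lt.2 (normalCoord_extChartAt_nonneg _ _))
    refine ⟨_, hA, hA0, ?_, ?_, hsymp⟩
    · filter_upwards [eventually_nhds_fst hz, hIoo, eventually_nhds_fst hlen,
        eventually_nhds_fst htr, eventually_nhds_fst hreg1.1,
        eventually_nhds_fst hγ.boundary'] with y h1 h2 h3 h4 h5 h6
      have h7 := h4 (ℓ y.1) h5.le le_rfl (by linarith)
      have h8 : normalCoord m (Φ (e (γ y.1 t₁), ℓ y.1 - t₁)) = 0 := by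
        rw [← h7.2]
        exact (isBoundaryPoint_iff_extChartAt_eq_zero
          (mem_extChartAt_cotangent_source.1 h7.1)).1 h6
      -- The normal coordinate decreases strictly and vanishes at time ℓ, so it is nonnegative
      -- exactly up to that time.
      have h9 := (hanti _ h1).le_iff_ge (⟨by linarith, by linarith⟩ : ℓ y.1 - t₁ ∈ Ioo (-ε) ε)
        (⟨by linarith [h2.1], by linarith [h2.2]⟩ : y.2 - t₁ ∈ Ioo (-ε) ε)
      simp only [← he, h8] at h9
      rw [← he, h9]
      exact ⟨fun h ↦ ⟨by linarith [h2.1], by linarith⟩, fun h ↦ by linarith [h.2]⟩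
    · filter_upwards [eventually_nhds_fst htr, hIoo] with y h1 h2 h3
      exact h1 y.2 h2.1.le h3.2 h2.2

end NormalForm

/-! ### Differentials of immersions and changes of coordinates -/

section Immersion

variable {E E' : Type*} [NormedAddCommGroup E] [NormedSpace ℝ E] [NormedAddCommGroup E']
  [NormedSpace ℝ E'] {H H' : Type*} [TopologicalSpace H] [TopologicalSpace H']
  {I : ModelWithCorners ℝ E H} {J : ModelWithCorners ℝ E' H'}
  {N N' : Type*} [TopologicalSpace N] [ChartedSpace H N] [TopologicalSpace N'] [ChartedSpace H' N']

/-- In adapted charts f is v ↦ L (v, 0), which has a left inverse by projection. The chain rule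
turns this local left inverse into one for the differential. -/
theorem injective_mfderiv_of_eqOn_extend [I.Boundaryless] {C : Type*} [NormedAddCommGroup C]
    [NormedSpace ℝ C] {f : N → N'} {x : N} (hf : MDifferentiableAt I J f x)
    {c : OpenPartialHomeomorph N H} {d : OpenPartialHomeomorph N' H'} (L : (E × C) ≃L[ℝ] E')
    (hc : c ∈ IsManifold.maximalAtlas I ∞ N) (hd : d ∈ IsManifold.maximalAtlas J ∞ N')
    (hx : x ∈ c.source) (hfx : f x ∈ d.source)
    (h : EqOn ((d.extend J) ∘ f ∘ (c.extend I).symm) (L ∘ (·, 0)) (c.extend I).target) :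
    Function.Injective (mfderiv I J f x) := by
  have hsrc : ∀ y ∈ c.source, y ∈ (c.extend I).source := fun y hy ↦ by rwa [c.extend_source]
  have hL : ∀ y ∈ c.source, (L.symm (d.extend J (f y))).1 = c.extend I y := by
    intro y hy
    have h1 : d.extend J (f y) = L (c.extend I y, 0) := by
      have h2 := h ((c.extend I).map_source (hsrc y hy))
      simp only [Function.comp_apply] at h2
      rwa [(c.extend I).left_inv (hsrc y hy)] at h2
    rw [h1, L.symm_apply_apply]
  have hdm : MDifferentiableAt J 𝓘(ℝ, E') (d.extend J) (f x) :=
    (d.contMDiffAt_extend hd hfx).mdifferentiableAt (by simp)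
  have hlin : MDifferentiableAt 𝓘(ℝ, E') 𝓘(ℝ, E) (fun v ↦ (L.symm v).1) (d.extend J (f x)) :=
    (differentiableAt_fst.comp _ L.symm.differentiableAt).mdifferentiableAt
  have hsymm : MDifferentiableAt 𝓘(ℝ, E) I (c.extend I).symm (L.symm (d.extend J (f x))).1 := by
    rw [hL x hx]
    have hopen : IsOpen (I '' c.target) := I.toHomeomorph.isOpenMap _ c.open_target
    exact ((contMDiffOn_extend_symm (n := ∞) hc).contMDiffAt
      (hopen.mem_nhds (mem_image_of_mem _ (c.map_source hx)))).mdifferentiableAt (by simp)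
  have hgd : MDifferentiableAt J I (fun y ↦ (c.extend I).symm (L.symm (d.extend J y)).1) (f x) :=
    MDifferentiableAt.comp (f x) hsymm
      (MDifferentiableAt.comp (f x) (g := fun v ↦ (L.symm v).1) hlin hdm)
  have hcomp := hgd.hasMFDerivAt.comp x hf.hasMFDerivAt
  have hid : HasMFDerivAt I I ((fun y ↦ (c.extend I).symm (L.symm (d.extend J y)).1) ∘ f) x
      (ContinuousLinearMap.id ℝ (TangentSpace I x)) := by
    refine (hasMFDerivAt_id x).congr_of_eventuallyEq ?_
    filter_upwards [c.open_source.mem_nhds hx] with y hy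
    rw [Function.comp_apply, hL y hy]
    exact (c.extend I).left_inv (hsrc y hy)
  have huniq := hasMFDerivAt_unique hcomp hid
  refine Function.LeftInverse.injective
    (g := mfderiv J I (fun y ↦ (c.extend I).symm (L.symm (d.extend J y)).1) (f x)) fun v ↦ ?_
  exact congrArg (fun B : E →L[ℝ] E ↦ B v) huniq

theorem IsImmersionAt.injective_mfderiv [I.Boundaryless] {f : N → N'} {x : N}
    (h : Manifold.IsImmersionAt I J ∞ f x) : Function.Injective (mfderiv I J f x) :=
  injective_mfderiv_of_eqOn_extend (h.contMDiffAt.mdifferentiableAt (by simp)) h.equiv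
    h.domChart_mem_maximalAtlas h.codChart_mem_maximalAtlas h.mem_domChart_source
    h.mem_codChart_source h.writtenInCharts

variable [IsManifold J ∞ N'] [IsManifold I ∞ N]

/-- A change of coordinates for the differential of a map between manifolds. -/
theorem fderivWithin_writtenInExtChartAt_tangentCoordChange {f : N → N'} {x₀ x : N} {y₀ : N'}
    (hf : ContMDiffAt I J ∞ f x) (hx : x ∈ (extChartAt I x₀).source)
    (hy : f x ∈ (extChartAt J y₀).source) (v : E) :
    fderivWithin ℝ (fun z ↦ extChartAt J y₀ (f ((extChartAt I x₀).symm z))) (range I)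
      (extChartAt I x₀ x) (tangentCoordChange I x x₀ x v) =
      tangentCoordChange J (f x) y₀ (f x) (mfderiv I J f x v : E') := by
  set fhat := fun z ↦ extChartAt J y₀ (f ((extChartAt I x₀).symm z)) with hfhat
  have hsm : ContDiffWithinAt ℝ ∞ fhat (range I) (extChartAt I x₀ x) := by
    have h1 : ContMDiffAt I 𝓘(ℝ, E') ∞ (fun z ↦ extChartAt J y₀ (f z)) x := by
      refine ContMDiffAt.comp x (contMDiffAt_extChartAt' ?_) hf
      rwa [extChartAt_source] at hy
    exact contDiffWithinAt_comp_extChartAt_symm h1 hx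
  have hd := (hsm.differentiableWithinAt (by simp)).hasFDerivWithinAt
  have hT := hasFDerivWithinAt_tangentCoordChange (I := I) (x := x) (y := x₀)
    (z := x) ⟨mem_extChartAt_source _, hx⟩
  have hTr : (extChartAt I x₀ ∘ (extChartAt I x).symm) (extChartAt I x x) = extChartAt I x₀ x :=
    congrArg _ (extChartAt_to_inv x)
  rw [← hTr] at hd
  have hleft := hd.comp (extChartAt I x x) hT (t := range I) (fun z _ ↦ mem_range_self _)
  obtain ⟨D, hD, hDd⟩ : ∃ D : E →L[ℝ] E', (mfderiv I J f x : E →L[ℝ] E') = D ∧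
      HasFDerivWithinAt (fun z ↦ extChartAt J (f x) (f ((extChartAt I x).symm z))) D (range I)
        (extChartAt I x x) :=
    ⟨_, rfl, (hf.mdifferentiableAt (by simp)).hasMFDerivAt.2⟩
  have hT' := hasFDerivWithinAt_tangentCoordChange (I := J) (x := f x) (y := y₀)
    (z := f x) ⟨mem_extChartAt_source _, hy⟩
  have hpt : (fun z ↦ extChartAt J (f x) (f ((extChartAt I x).symm z))) (extChartAt I x x) =
      extChartAt J (f x) (f x) := by
    simp only [extChartAt_to_inv]
  rw [← hpt] at hT'
  have hright := hT'.comp (extChartAt I x x) hDd (t := range J) (fun z _ ↦ mem_range_self _)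
  have hev : (extChartAt J y₀ ∘ (extChartAt J (f x)).symm) ∘
        (fun z ↦ extChartAt J (f x) (f ((extChartAt I x).symm z)))
      =ᶠ[𝓝[range I] (extChartAt I x x)] fhat ∘ (extChartAt I x₀ ∘ (extChartAt I x).symm) := by
    have h1 : (extChartAt I x).symm ⁻¹' ((extChartAt I x₀).source ∩ f ⁻¹' (extChartAt J (f x)).source) ∈
        𝓝[range I] (extChartAt I x x) := by
      refine (continuousAt_extChartAt_symm x).continuousWithinAt.preimage_mem_nhdsWithin ?_
      rw [extChartAt_to_inv]
      exact Filter.inter_mem (extChartAt_source_mem_nhds' hx)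
        (hf.continuousAt.preimage_mem_nhds (extChartAt_source_mem_nhds (f x)))
    filter_upwards [h1] with z hz
    simp only [Function.comp_apply, hfhat]
    rw [(extChartAt J (f x)).left_inv hz.2, (extChartAt I x₀).left_inv hz.1]
  have huniq := (I.uniqueDiffOn (extChartAt I x x) (mem_range_self _)).eq hleft
    (hright.congr_of_eventuallyEq hev.symm (hev.self_of_nhdsWithin (mem_range_self _)).symm)
  rw [hTr] at huniq
  have h3 := congrArg (fun B : E →L[ℝ] E' ↦ B v) huniq
  refine Eq.trans h3 ?_
  exact congrArg (fun B : E →L[ℝ] E' ↦ tangentCoordChange J (f x) y₀ (f x) (B v)) hD.symm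

end Immersion

/-! ### The inverse function theorem in equal dimensions -/

section LocalInverse

/-- The inverse function theorem for maps between finite-dimensional spaces of the same
dimension. -/
theorem ContDiffAt.exists_local_inverse {E F : Type*} [NormedAddCommGroup E] [NormedSpace ℝ E]
    [NormedAddCommGroup F] [NormedSpace ℝ F] [FiniteDimensional ℝ E] [FiniteDimensional ℝ F]
    (hdim : Module.finrank ℝ E = Module.finrank ℝ F) {f : E → F} {a : E} {k : ℕ} (hk : 1 ≤ k)
    (hf : ContDiffAt ℝ k f a) (hinj : ∀ v, fderiv ℝ f a v = 0 → v = 0) :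
    ∃ g : F → E, ContDiffAt ℝ k g (f a) ∧ g (f a) = a ∧ ∀ᶠ y in 𝓝 (f a), f (g y) = y := by
  have := FiniteDimensional.complete ℝ E
  have := FiniteDimensional.complete ℝ F
  have hk0 : (k : WithTop ℕ∞) ≠ 0 := by exact_mod_cast (by omega : k ≠ 0)
  have hinj' : Function.Injective (fderiv ℝ f a : E →ₗ[ℝ] F) :=
    (injective_iff_map_eq_zero _).2 hinj
  let L : E ≃L[ℝ] F := ((fderiv ℝ f a : E →ₗ[ℝ] F).linearEquivOfInjective hinj' hdim).toContinuousLinearEquiv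
  have hL : (L : E →L[ℝ] F) = fderiv ℝ f a := by
    ext v
    rfl
  have hfd : HasFDerivAt f (L : E →L[ℝ] F) a := by
    rw [hL]
    exact (hf.differentiableAt hk0).hasFDerivAt
  refine ⟨hf.localInverse hfd hk0, hf.to_localInverse hfd hk0, hf.localInverse_apply_image hfd hk0, ?_⟩
  exact (hf.hasStrictFDerivAt' hfd hk0).eventually_right_inverse

theorem finrank_modelCovec (n : ℕ) : Module.finrank ℝ (ModelCovec n) = n := by
  have h : Module.finrank ℝ (ModelVec n →ₗ[ℝ] ℝ) = Module.finrank ℝ (ModelCovec n) :=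
    LinearEquiv.finrank_eq (LinearMap.toContinuousLinearMap (𝕜 := ℝ) (E := ModelVec n) (F' := ℝ))
  rw [← h, Module.finrank_linearMap, Module.finrank_self, mul_one, finrank_euclideanSpace_fin]

end LocalInverse

/-! ### Restriction of covectors to the boundary in coordinates -/

section Restriction

variable {m : ℕ} {M : Type*} [TopologicalSpace M] [ChartedSpace (EuclideanHalfSpace (m + 1)) M]
  {B : Type*} [TopologicalSpace B] [ChartedSpace (EuclideanSpace ℝ (Fin m)) B] {ι : B → M}

theorem IsRestriction.proj_eq {p : CotangentBundle (𝓡∂ (m + 1)) M} {q : CotangentBundle (𝓡 m) B}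
    (h : IsRestriction ι p q) : p.proj = ι q.proj := by
  obtain ⟨b, ξ, rfl, rfl⟩ := h
  rfl

theorem IsRestriction.unique (hι : IsBoundaryInclusion (𝓡∂ (m + 1)) m ι)
    {p : CotangentBundle (𝓡∂ (m + 1)) M} {q q' : CotangentBundle (𝓡 m) B}
    (h : IsRestriction ι p q) (h' : IsRestriction ι p q') : q = q' := by
  obtain ⟨b, ξ, rfl, rfl⟩ := h
  obtain ⟨b', ξ', h1, rfl⟩ := h'
  have hb : b = b' := hι.embedding.isEmbedding.injective (congrArg TotalSpace.proj h1)
  subst hb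
  have hξ : ξ = ξ' := eq_of_heq (TotalSpace.mk.inj h1).2
  subst hξ
  rfl

theorem IsRestriction.dilation {p : CotangentBundle (𝓡∂ (m + 1)) M} {q : CotangentBundle (𝓡 m) B}
    (h : IsRestriction ι p q) (c : ℝ) : IsRestriction ι (dilation c p) (dilation c q) := by
  obtain ⟨b, ξ, rfl, rfl⟩ := h
  exact ⟨b, c • ξ, rfl, rfl⟩

theorem IsRestriction.mem_boundary (hι : IsBoundaryInclusion (𝓡∂ (m + 1)) m ι)
    {p : CotangentBundle (𝓡∂ (m + 1)) M} {q : CotangentBundle (𝓡 m) B}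
    (h : IsRestriction ι p q) : p.proj ∈ (𝓡∂ (m + 1)).boundary M := by
  rw [h.proj_eq, ← hι.range_eq]
  exact mem_range_self _

variable [IsManifold (𝓡∂ (m + 1)) ∞ M] [IsManifold (𝓡 m) ∞ B]

theorem tangentCoordChange_cancel {E H : Type*} [NormedAddCommGroup E] [NormedSpace ℝ E]
    [TopologicalSpace H] {I : ModelWithCorners ℝ E H} {N : Type*} [TopologicalSpace N]
    [ChartedSpace H N] [IsManifold I 1 N] {x y z : N} (hx : z ∈ (extChartAt I x).source)
    (hy : z ∈ (extChartAt I y).source) (v : E) :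
    tangentCoordChange I y x z (tangentCoordChange I x y z v) = v := by
  rw [tangentCoordChange_comp ⟨⟨hx, hy⟩, hx⟩, tangentCoordChange_self hx]

/-- The map `ι` in the charts at `b₀` and `x₀`. -/
def chartInclusion (ι : B → M) (b₀ : B) (x₀ : M) (u : ModelVec m) : ModelVec (m + 1) :=
  extChartAt (𝓡∂ (m + 1)) x₀ (ι ((extChartAt (𝓡 m) b₀).symm u))

theorem contDiffAt_chartInclusion (hι : IsBoundaryInclusion (𝓡∂ (m + 1)) m ι) {b₀ b : B} {x₀ : M}
    (hb : b ∈ (extChartAt (𝓡 m) b₀).source) (hx : ι b ∈ (extChartAt (𝓡∂ (m + 1)) x₀).source) :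
    ContDiffAt ℝ ∞ (chartInclusion ι b₀ x₀) (extChartAt (𝓡 m) b₀ b) := by
  have h1 : ContMDiffAt (𝓡 m) 𝓘(ℝ, ModelVec (m + 1)) ∞
      (fun z ↦ extChartAt (𝓡∂ (m + 1)) x₀ (ι z)) b := by
    refine ContMDiffAt.comp b (contMDiffAt_extChartAt' ?_) (hι.embedding.contMDiff b)
    rwa [extChartAt_source] at hx
  have h2 := contDiffWithinAt_comp_extChartAt_symm h1 hb
  rw [ModelWithCorners.range_eq_univ, contDiffWithinAt_univ] at h2
  exact h2

theorem fderiv_chartInclusion_tangentCoordChange (hι : IsBoundaryInclusion (𝓡∂ (m + 1)) m ι)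
    {b₀ b : B} {x₀ : M} (hb : b ∈ (extChartAt (𝓡 m) b₀).source)
    (hx : ι b ∈ (extChartAt (𝓡∂ (m + 1)) x₀).source) (v : ModelVec m) :
    fderiv ℝ (chartInclusion ι b₀ x₀) (extChartAt (𝓡 m) b₀ b) (tangentCoordChange (𝓡 m) b b₀ b v) =
      tangentCoordChange (𝓡∂ (m + 1)) (ι b) x₀ (ι b)
        (mfderiv (𝓡 m) (𝓡∂ (m + 1)) ι b v : ModelVec (m + 1)) := by
  have h := fderivWithin_writtenInExtChartAt_tangentCoordChange (hι.embedding.contMDiff b) hb hx v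
  rw [ModelWithCorners.range_eq_univ, fderivWithin_univ] at h
  exact h

theorem injective_fderiv_chartInclusion (hι : IsBoundaryInclusion (𝓡∂ (m + 1)) m ι)
    {b₀ b : B} {x₀ : M} (hb : b ∈ (extChartAt (𝓡 m) b₀).source)
    (hx : ι b ∈ (extChartAt (𝓡∂ (m + 1)) x₀).source) (v : ModelVec m)
    (hv : fderiv ℝ (chartInclusion ι b₀ x₀) (extChartAt (𝓡 m) b₀ b) v = 0) : v = 0 := by
  have h1 : tangentCoordChange (𝓡 m) b b₀ b (tangentCoordChange (𝓡 m) b₀ b b v) = v :=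
    tangentCoordChange_cancel hb (mem_extChartAt_source _) v
  rw [← h1, fderiv_chartInclusion_tangentCoordChange hι hb hx] at hv
  have h2 := ((tangentCoordChange_cancel (mem_extChartAt_source _) hx _).symm.trans
    (congrArg (tangentCoordChange (𝓡∂ (m + 1)) x₀ (ι b) (ι b)) hv)).trans (map_zero _)
  have h3 : tangentCoordChange (𝓡 m) b₀ b b v = (0 : ModelVec m) :=
    IsImmersionAt.injective_mfderiv (hι.embedding.isImmersion.isImmersionAt b)
      (h2.trans (map_zero (mfderiv (𝓡 m) (𝓡∂ (m + 1)) ι b)).symm)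
  rw [← h1, h3, map_zero]

/-- The restriction of covectors to the boundary, in coordinates. -/
theorem isRestriction_iff (hι : IsBoundaryInclusion (𝓡∂ (m + 1)) m ι)
    {p₀ p : CotangentBundle (𝓡∂ (m + 1)) M} {q₀ q : CotangentBundle (𝓡 m) B}
    (hq : q.proj ∈ (extChartAt (𝓡 m) q₀.proj).source)
    (hp : p.proj ∈ (extChartAt (𝓡∂ (m + 1)) p₀.proj).source) (hpq : p.proj = ι q.proj) :
    IsRestriction ι p q ↔ (extChartAt (cotangentModel (𝓡 m)) q₀ q).2 =
      (extChartAt (cotangentModel (𝓡∂ (m + 1))) p₀ p).2.comp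
        (fderiv ℝ (chartInclusion ι q₀.proj p₀.proj) (extChartAt (𝓡 m) q₀.proj q.proj)) := by
  obtain ⟨b, ζ⟩ := q
  obtain ⟨x, ξ⟩ := p
  simp only at hpq hq hp
  subst hpq
  have hq' : (⟨b, ξ.comp (mfderiv (𝓡 m) (𝓡∂ (m + 1)) ι b)⟩ : CotangentBundle (𝓡 m) B).proj ∈
    (extChartAt (𝓡 m) q₀.proj).source := hq
  have key : (extChartAt (cotangentModel (𝓡 m)) q₀
      (⟨b, ξ.comp (mfderiv (𝓡 m) (𝓡∂ (m + 1)) ι b)⟩ : CotangentBundle (𝓡 m) B)).2 =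
      (extChartAt (cotangentModel (𝓡∂ (m + 1))) p₀
        (⟨ι b, ξ⟩ : CotangentBundle (𝓡∂ (m + 1)) M)).2.comp
        (fderiv ℝ (chartInclusion ι q₀.proj p₀.proj) (extChartAt (𝓡 m) q₀.proj b)) := by
    ext v
    rw [extChartAt_cotangent_snd q₀ _ hq']
    have h1 : tangentCoordChange (𝓡 m) b q₀.proj b (tangentCoordChange (𝓡 m) q₀.proj b b v) = v :=
      tangentCoordChange_cancel hq (mem_extChartAt_source _) v
    have h2 := fderiv_chartInclusion_tangentCoordChange hι hq hp
      (tangentCoordChange (𝓡 m) q₀.proj b b v)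
    rw [h1] at h2
    have h3 := extChartAt_cotangent_snd p₀ (⟨ι b, ξ⟩ : CotangentBundle (𝓡∂ (m + 1)) M) hp
      (fderiv ℝ (chartInclusion ι q₀.proj p₀.proj) (extChartAt (𝓡 m) q₀.proj b) v)
    refine Eq.trans ?_ h3.symm
    rw [h2]
    exact congrArg (fun u ↦ (ξ u : ℝ))
      (tangentCoordChange_cancel (mem_extChartAt_source (ι b)) hp _).symm
  rw [← key]
  constructor
  · rintro ⟨b', ξ', h1, h2⟩
    have hb : b = b' := congrArg TotalSpace.proj h2
    subst hb
    have hξ : ξ = ξ' := eq_of_heq (TotalSpace.mk.inj h1).2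
    subst hξ
    rw [h2]
  · intro h
    refine ⟨b, ξ, rfl, ?_⟩
    exact extChartAt_cotangent_injOn_fibre hq hq' (Prod.ext
      (by rw [extChartAt_cotangent_fst, extChartAt_cotangent_fst]) h)

end Restriction

/-! ### Covectors with given restriction and energy -/

section BoundarySection

variable {m : ℕ}

/-- A covector on the half space is determined by its restriction to a hypersurface in the boundary
and its value on a transversal vector. -/
theorem eq_zero_of_comp_eq_zero_of_transversal {L : ModelVec m →L[ℝ] ModelVec (m + 1)}
    (hL : ∀ v, L v = 0 → v = 0) (hL0 : ∀ v, L v 0 = 0) {X : ModelVec (m + 1)} (hX : X 0 ≠ 0)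
    {ξ : ModelCovec (m + 1)} (hξL : ξ.comp L = 0) (hξX : ξ X = 0) : ξ = 0 := by
  let T : ModelVec m × ℝ →ₗ[ℝ] ModelVec (m + 1) :=
    (L : ModelVec m →ₗ[ℝ] ModelVec (m + 1)).coprod (LinearMap.toSpanSingleton ℝ _ X)
  have hT : ∀ w s, T (w, s) = L w + s • X := fun w s ↦ by
    simp [T]
  have hinj : Function.Injective T := by
    refine (injective_iff_map_eq_zero _).2 fun ⟨w, s⟩ h ↦ ?_
    rw [hT] at h
    have hs : s = 0 := by
      have h0 := congrArg (fun v : ModelVec (m + 1) ↦ v 0) h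
      simp only [PiLp.add_apply, PiLp.smul_apply, hL0, zero_add, smul_eq_mul, PiLp.zero_apply] at h0
      exact (mul_eq_zero.1 h0).resolve_right hX
    rw [hs, zero_smul, add_zero] at h
    rw [hL w h, hs]
    rfl
  have hsurj : Function.Surjective T :=
    (LinearMap.injective_iff_surjective_of_finrank_eq_finrank (by simp)).1 hinj
  ext v
  obtain ⟨⟨w, s⟩, rfl⟩ := hsurj v
  have h1 : ξ (L w) = 0 := congrArg (fun A : ModelCovec m ↦ A w) hξL
  rw [hT, map_add, map_smul, h1, hξX]
  simp

/-- Since ξ restricts to the boundary covector, the one-form ξ dx pulls back to the canonical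
one-form of the boundary. The two symplectic forms are differentials of the same one-form. -/
theorem stdSymplectic_boundary_section {i : ModelVec m → ModelVec (m + 1)}
    {ξ : (ModelVec m × ModelCovec m) × ℝ → ModelCovec (m + 1)} {w : (ModelVec m × ModelCovec m) × ℝ}
    (h1 : ∀ᶠ w' in 𝓝 w, w'.1.2 = (ξ w').comp (fderiv ℝ i w'.1.1))
    (h2 : ∀ᶠ w' in 𝓝 w, DifferentiableAt ℝ i w'.1.1)
    (h3 : ContDiffAt ℝ 2 (fun w' : (ModelVec m × ModelCovec m) × ℝ ↦ i w'.1.1) w)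
    (h4 : DifferentiableAt ℝ ξ w) (a b : (ModelVec m × ModelCovec m) × ℝ) :
    stdSymplectic (fderiv ℝ (fun w' ↦ (i w'.1.1, ξ w')) w a)
      (fderiv ℝ (fun w' ↦ (i w'.1.1, ξ w')) w b) = stdSymplectic a.1 b.1 := by
  set β : (ModelVec m × ModelCovec m) × ℝ → (ModelVec m × ModelCovec m) × ℝ →L[ℝ] ℝ :=
    fun w ↦ w.1.2.comp ((ContinuousLinearMap.fst ℝ (ModelVec m) (ModelCovec m)).comp
      (ContinuousLinearMap.fst ℝ (ModelVec m × ModelCovec m) ℝ)) with hβ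
  have hffst : ∀ w' : (ModelVec m × ModelCovec m) × ℝ,
      HasFDerivAt (fun w : (ModelVec m × ModelCovec m) × ℝ ↦ w.1.1)
      ((ContinuousLinearMap.fst ℝ (ModelVec m) (ModelCovec m)).comp
        (ContinuousLinearMap.fst ℝ (ModelVec m × ModelCovec m) ℝ)) w' := fun w' ↦
    ((ContinuousLinearMap.fst ℝ (ModelVec m) (ModelCovec m)).comp
        (ContinuousLinearMap.fst ℝ (ModelVec m × ModelCovec m) ℝ)).hasFDerivAt
  have hβ1 : β =ᶠ[𝓝[univ] w] fun w ↦ (ξ w).comp (fderivWithin ℝ (fun w' :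
      (ModelVec m × ModelCovec m) × ℝ ↦ i w'.1.1) univ w) := by
    rw [nhdsWithin_univ]
    filter_upwards [h1, h2] with w' h5 h6
    have h7 : HasFDerivAt (fun w' : (ModelVec m × ModelCovec m) × ℝ ↦ i w'.1.1)
        ((fderiv ℝ i w'.1.1).comp ((ContinuousLinearMap.fst ℝ (ModelVec m) (ModelCovec m)).comp
        (ContinuousLinearMap.fst ℝ (ModelVec m × ModelCovec m) ℝ))) w' :=
      HasFDerivAt.comp w' (g := i) h6.hasFDerivAt (hffst w')
    rw [fderivWithin_univ, h7.fderiv, hβ]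
    simp only
    rw [h5]
    rfl
  have hβ2 : β =ᶠ[𝓝[univ] w] fun w ↦ w.1.2.comp (fderivWithin ℝ (fun w' :
      (ModelVec m × ModelCovec m) × ℝ ↦ w'.1.1) univ w) := by
    refine Filter.Eventually.of_forall fun w' ↦ ?_
    simp only [fderivWithin_univ, (hffst w').fderiv, hβ]
  have hp1 := stdSymplectic_pullback uniqueDiffOn_univ (mem_univ w) (by simp)
    h3.contDiffWithinAt
    h4.differentiableWithinAt hβ1 a b
  have hp2 := stdSymplectic_pullback uniqueDiffOn_univ (mem_univ w) (by simp)
    (x := fun w : (ModelVec m × ModelCovec m) × ℝ ↦ w.1.1) (ξ := fun w ↦ w.1.2)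
    (contDiffAt_fst.comp w contDiffAt_fst).contDiffWithinAt
    (differentiableAt_fst.snd).differentiableWithinAt hβ2 a b
  simp only [fderivWithin_univ] at hp1 hp2
  have hfd : ∀ a, fderiv ℝ (fun w : (ModelVec m × ModelCovec m) × ℝ ↦ (w.1.1, w.1.2)) w a = a.1 :=
    fun a ↦ congrArg (fun A : (ModelVec m × ModelCovec m) × ℝ →L[ℝ] ModelVec m × ModelCovec m ↦ A a)
      (hasFDerivAt_fst (𝕜 := ℝ) (p := w)).fderiv
  rw [hfd, hfd] at hp2
  rw [hp1, hp2]

/-- The covectors over the hypersurface `i` with prescribed restriction and prescribed energy. -/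
theorem exists_boundary_section {i : ModelVec m → ModelVec (m + 1)}
    {G : ModelVec (m + 1) × ModelCovec (m + 1) → ℝ} {u₀ : ModelVec m} {ξ₀ : ModelCovec (m + 1)}
    {k : ℕ} (hk : 2 ≤ k) (hi : ContDiffAt ℝ ∞ i u₀) (hi0 : ∀ᶠ u in 𝓝 u₀, i u 0 = 0)
    (hinj : ∀ v, fderiv ℝ i u₀ v = 0 → v = 0) (hG : ContDiff ℝ k G)
    (hX : normalCoord m (hamiltonianVector (fderiv ℝ G (i u₀, ξ₀))) ≠ 0) :
    ∃ j : (ModelVec m × ModelCovec m) × ℝ → ModelVec (m + 1) × ModelCovec (m + 1),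
      ContDiffAt ℝ k j ((u₀, ξ₀.comp (fderiv ℝ i u₀)), G (i u₀, ξ₀)) ∧
      j ((u₀, ξ₀.comp (fderiv ℝ i u₀)), G (i u₀, ξ₀)) = (i u₀, ξ₀) ∧
      (∀ᶠ w in 𝓝 ((u₀, ξ₀.comp (fderiv ℝ i u₀)), G (i u₀, ξ₀)),
        (j w).1 = i w.1.1 ∧ w.1.2 = (j w).2.comp (fderiv ℝ i w.1.1) ∧ G (j w) = w.2) ∧
      ∀ᶠ w in 𝓝 ((u₀, ξ₀.comp (fderiv ℝ i u₀)), G (i u₀, ξ₀)), ∀ a b,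
        stdSymplectic (fderiv ℝ j w a) (fderiv ℝ j w b) = stdSymplectic a.1 b.1 := by
  have hk0 : (k : WithTop ℕ∞) ≠ 0 := by exact_mod_cast (by omega : k ≠ 0)
  have hdi : ContDiffAt ℝ k (fderiv ℝ i) u₀ := by
    have h1 : ContDiffAt ℝ ((k : WithTop ℕ∞) + 1) i u₀ := hi.of_le (by exact_mod_cast le_top)
    exact h1.fderiv_right le_rfl
  have hik : ContDiffAt ℝ k i u₀ := hi.of_le (by exact_mod_cast le_top)
  -- P sends a boundary point and a covector over it to the point, the restriction and the energy.
  -- The required section is obtained from the local inverse of P.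
  set P : ModelVec m × ModelCovec (m + 1) → (ModelVec m × ModelCovec m) × ℝ :=
    fun y ↦ ((y.1, y.2.comp (fderiv ℝ i y.1)), G (i y.1, y.2)) with hP
  have hPsm : ContDiffAt ℝ k P (u₀, ξ₀) := by
    have h1 : ContDiffAt ℝ k (fun y : ModelVec m × ModelCovec (m + 1) ↦ fderiv ℝ i y.1) (u₀, ξ₀) :=
      ContDiffAt.comp (u₀, ξ₀) (g := fderiv ℝ i) hdi contDiffAt_fst
    have h2 : ContDiffAt ℝ k (fun y : ModelVec m × ModelCovec (m + 1) ↦ i y.1) (u₀, ξ₀) :=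
      ContDiffAt.comp (u₀, ξ₀) (g := i) hik contDiffAt_fst
    have h3 : ContDiffAt ℝ k (fun y : ModelVec m × ModelCovec (m + 1) ↦
        y.2.comp (fderiv ℝ i y.1)) (u₀, ξ₀) := contDiffAt_snd.clm_comp h1
    have h4 : ContDiffAt ℝ k (fun y : ModelVec m × ModelCovec (m + 1) ↦ G (i y.1, y.2)) (u₀, ξ₀) :=
      ContDiffAt.comp (u₀, ξ₀) (g := G) hG.contDiffAt (h2.prodMk contDiffAt_snd)
    exact (contDiffAt_fst.prodMk h3).prodMk h4
  have hdim : Module.finrank ℝ (ModelVec m × ModelCovec (m + 1)) =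
      Module.finrank ℝ ((ModelVec m × ModelCovec m) × ℝ) := by
    simp only [Module.finrank_prod, finrank_modelCovec, finrank_euclideanSpace_fin,
      Module.finrank_self]
    omega
  have hPinj : ∀ v, fderiv ℝ P (u₀, ξ₀) v = 0 → v = 0 := by
    rintro ⟨u', ξ'⟩ hv
    have hPd : HasFDerivAt P (fderiv ℝ P (u₀, ξ₀)) (u₀, ξ₀) :=
      (hPsm.differentiableAt hk0).hasFDerivAt
    have hu : u' = 0 := by
      have h1 : HasFDerivAt (fun y ↦ (P y).1.1)
          (((ContinuousLinearMap.fst ℝ (ModelVec m) (ModelCovec m)).comp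
            (ContinuousLinearMap.fst ℝ (ModelVec m × ModelCovec m) ℝ)).comp
            (fderiv ℝ P (u₀, ξ₀))) (u₀, ξ₀) := hPd.fst.fst
      have h2 := h1.unique (hasFDerivAt_fst (𝕜 := ℝ) (p := (u₀, ξ₀)))
      have h3 := congrArg (fun A : ModelVec m × ModelCovec (m + 1) →L[ℝ] ModelVec m ↦
        A (u', ξ')) h2
      simp only [ContinuousLinearMap.comp_apply, hv] at h3
      simpa using h3.symm
    subst hu
    have hlin : HasFDerivAt (fun ξ : ModelCovec (m + 1) ↦ (u₀, ξ))
        (ContinuousLinearMap.inr ℝ (ModelVec m) (ModelCovec (m + 1))) ξ₀ :=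
      hasFDerivAt_prodMk_right u₀ ξ₀
    have hcomp : HasFDerivAt (fun ξ : ModelCovec (m + 1) ↦ P (u₀, ξ)) _ ξ₀ :=
      HasFDerivAt.comp ξ₀ hPd hlin
    have hL : HasFDerivAt (fun ξ : ModelCovec (m + 1) ↦ ξ.comp (fderiv ℝ i u₀))
        ((ContinuousLinearMap.compL ℝ (ModelVec m) (ModelVec (m + 1)) ℝ).flip (fderiv ℝ i u₀)) ξ₀ :=
      ((ContinuousLinearMap.compL ℝ (ModelVec m) (ModelVec (m + 1)) ℝ).flip
        (fderiv ℝ i u₀)).hasFDerivAt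
    have hlin' : HasFDerivAt (fun ξ : ModelCovec (m + 1) ↦ (i u₀, ξ))
        (ContinuousLinearMap.inr ℝ (ModelVec (m + 1)) (ModelCovec (m + 1))) ξ₀ :=
      hasFDerivAt_prodMk_right (i u₀) ξ₀
    have hGd : HasFDerivAt (fun ξ : ModelCovec (m + 1) ↦ G (i u₀, ξ))
        ((fderiv ℝ G (i u₀, ξ₀)).comp
          (ContinuousLinearMap.inr ℝ (ModelVec (m + 1)) (ModelCovec (m + 1)))) ξ₀ :=
      HasFDerivAt.comp ξ₀ (hG.differentiable hk0 _).hasFDerivAt hlin'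
    have hexp : HasFDerivAt (fun ξ : ModelCovec (m + 1) ↦ P (u₀, ξ)) _ ξ₀ :=
      ((hasFDerivAt_const u₀ ξ₀).prodMk hL).prodMk hGd
    have h2 := congrArg (fun A : ModelCovec (m + 1) →L[ℝ] (ModelVec m × ModelCovec m) × ℝ ↦ A ξ')
      (hcomp.unique hexp)
    have h3 : fderiv ℝ P (u₀, ξ₀) (0, ξ') =
      ((0, ξ'.comp (fderiv ℝ i u₀)), fderiv ℝ G (i u₀, ξ₀) (0, ξ')) := h2
    rw [h3] at hv
    have h4 : ξ'.comp (fderiv ℝ i u₀) = 0 := congrArg (fun y ↦ y.1.2) hv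
    have h5 : fderiv ℝ G (i u₀, ξ₀) (0, ξ') = 0 := congrArg (fun y ↦ y.2) hv
    -- The variation of the energy in the fibre direction ξ' is ξ' evaluated on the base velocity.
    -- That velocity is transversal, so a ξ' that also vanishes on tangential vectors is zero.
    rw [← apply_hamiltonianVector_fst] at h5
    have hL0 : ∀ v, fderiv ℝ i u₀ v 0 = 0 := by
      intro v
      have h6 : HasFDerivAt (fun u ↦ i u 0)
          ((EuclideanSpace.proj (𝕜 := ℝ) (0 : Fin (m + 1))).comp (fderiv ℝ i u₀)) u₀ :=
        HasFDerivAt.comp u₀ (EuclideanSpace.proj (𝕜 := ℝ) (0 : Fin (m + 1))).hasFDerivAt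
          (hik.differentiableAt hk0).hasFDerivAt
      have h7 : HasFDerivAt (fun u ↦ i u 0) (0 : ModelVec m →L[ℝ] ℝ) u₀ :=
        (hasFDerivAt_const (0 : ℝ) u₀).congr_of_eventuallyEq hi0
      exact congrArg (fun A : ModelVec m →L[ℝ] ℝ ↦ A v) (h6.unique h7)
    rw [eq_zero_of_comp_eq_zero_of_transversal hinj hL0 hX h4 h5]
    rfl
  obtain ⟨Q, hQ, hQ0, hPQ⟩ := hPsm.exists_local_inverse hdim (by omega) hPinj
  have hPval : P (u₀, ξ₀) = ((u₀, ξ₀.comp (fderiv ℝ i u₀)), G (i u₀, ξ₀)) := rfl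
  rw [← hPval]
  set w₀ := P (u₀, ξ₀) with hw₀
  have hfst : ContDiffAt ℝ ∞ (fun w : (ModelVec m × ModelCovec m) × ℝ ↦ w.1.1) w₀ :=
    contDiffAt_fst.comp w₀ contDiffAt_fst
  have hx : ContDiffAt ℝ k (fun w : (ModelVec m × ModelCovec m) × ℝ ↦ i w.1.1) w₀ :=
    ContDiffAt.comp w₀ (g := i) hik (hfst.of_le (by exact_mod_cast le_top))
  have hξ : ContDiffAt ℝ k (fun w ↦ (Q w).2) w₀ := hQ.snd
  have hsec : ∀ᶠ w in 𝓝 w₀, w.1.2 = (Q w).2.comp (fderiv ℝ i w.1.1) ∧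
      G (i w.1.1, (Q w).2) = w.2 := by
    filter_upwards [hPQ] with w hw
    have h1 : (Q w).1 = w.1.1 := congrArg (fun y ↦ y.1.1) hw
    have h2 : (Q w).2.comp (fderiv ℝ i (Q w).1) = w.1.2 := congrArg (fun y ↦ y.1.2) hw
    have h3 : G (i (Q w).1, (Q w).2) = w.2 := congrArg (fun y ↦ y.2) hw
    rw [h1] at h2 h3
    exact ⟨h2.symm, h3⟩
  refine ⟨fun w ↦ (i w.1.1, (Q w).2), hx.prodMk hξ, ?_, ?_, ?_⟩
  · simp only [hQ0]
    rw [hPval]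
  · filter_upwards [hsec] with w hw using ⟨rfl, hw⟩
  have hid : ∀ᶠ w in 𝓝 w₀, DifferentiableAt ℝ i w.1.1 := by
    have h1 : ∀ᶠ u in 𝓝 w₀.1.1, DifferentiableAt ℝ i u := by
      filter_upwards [hik.eventually (by simp)] with u hu using hu.differentiableAt hk0
    exact (continuous_fst.fst.continuousAt (x := w₀)).eventually h1
  filter_upwards [hsec.eventually_nhds, hid.eventually_nhds, hx.eventually (by simp),
    hξ.eventually (by simp)] with w h1 h2 h3 h4 a b
  exact stdSymplectic_boundary_section (h1.mono fun _ h ↦ h.1) h2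
    (h3.of_le (by exact_mod_cast hk)) (h4.differentiableAt hk0) a b

end BoundarySection

/-! ### The smooth slice of initial covectors -/

section InitialSlice

variable {m : ℕ} {M : Type*} [TopologicalSpace M] [ChartedSpace (EuclideanHalfSpace (m + 1)) M]
  [IsManifold (𝓡∂ (m + 1)) ∞ M]
  {B : Type*} [TopologicalSpace B] [ChartedSpace (EuclideanSpace ℝ (Fin m)) B]
  [IsManifold (𝓡 m) ∞ B] {ι : B → M} {F : CotangentBundle (𝓡∂ (m + 1)) M → ℝ}

/-- Near a transversal covector, the covectors over the boundary are smoothly and symplectically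
parametrised by their restrictions and energies. -/
theorem exists_initial_slice (hι : IsBoundaryInclusion (𝓡∂ (m + 1)) m ι)
    (hF : IsPositiveHamiltonian F) {k : ℕ} (hk : 2 ≤ k) {p₀ : CotangentBundle (𝓡∂ (m + 1)) M}
    {q₀ : CotangentBundle (𝓡 m) B} (hpq : IsRestriction ι p₀ q₀) (hp₀ : p₀ ∈ nonzeroCovectors)
    (htr : normalCoord m (hamiltonianVectorField F p₀ :
      ModelVec (m + 1) × ModelCovec (m + 1)) ≠ 0) :
    ∃ j : (ModelVec m × ModelCovec m) × ℝ → ModelVec (m + 1) × ModelCovec (m + 1),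
      ContDiffAt ℝ k j (extChartAt (cotangentModel (𝓡 m)) q₀ q₀, F p₀) ∧
      j (extChartAt (cotangentModel (𝓡 m)) q₀ q₀, F p₀) =
        extChartAt (cotangentModel (𝓡∂ (m + 1))) p₀ p₀ ∧
      (∀ᶠ w in 𝓝 (extChartAt (cotangentModel (𝓡 m)) q₀ q₀, F p₀),
        j w ∈ (extChartAt (cotangentModel (𝓡∂ (m + 1))) p₀).target ∧
        (extChartAt (cotangentModel (𝓡∂ (m + 1))) p₀).symm (j w) ∈ nonzeroCovectors ∧
        F ((extChartAt (cotangentModel (𝓡∂ (m + 1))) p₀).symm (j w)) = w.2 ∧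
        IsRestriction ι ((extChartAt (cotangentModel (𝓡∂ (m + 1))) p₀).symm (j w))
          ((extChartAt (cotangentModel (𝓡 m)) q₀).symm w.1)) ∧
      ∀ᶠ w in 𝓝 (extChartAt (cotangentModel (𝓡 m)) q₀ q₀, F p₀), ∀ a b,
        stdSymplectic (fderiv ℝ j w a) (fderiv ℝ j w b) = stdSymplectic a.1 b.1 := by
  -- The extension G makes the energy equation smooth on the full coordinate space; the flow of the
  -- box plays no role here.
  obtain ⟨G, Φ, δ, ε, hbox⟩ := hF.exists_isFlowBox hk hp₀
  have hδ : 0 < δ := hbox.pos.trans_le hbox.le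
  have hproj := hpq.proj_eq
  set i := chartInclusion (m := m) ι q₀.proj p₀.proj with hi
  set u₀ := extChartAt (𝓡 m) q₀.proj q₀.proj with hu₀
  set e := extChartAt (cotangentModel (𝓡∂ (m + 1))) p₀ with he
  set ψ := extChartAt (cotangentModel (𝓡 m)) q₀ with hψ
  have hqs : q₀.proj ∈ (extChartAt (𝓡 m) q₀.proj).source := mem_extChartAt_source _
  have hps : ι q₀.proj ∈ (extChartAt (𝓡∂ (m + 1)) p₀.proj).source := by
    rw [← hproj]; exact mem_extChartAt_source _
  have hiu : (i u₀, (e p₀).2) = e p₀ := by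
    refine Prod.ext ?_ rfl
    simp only [hi, chartInclusion, hu₀]
    rw [extChartAt_to_inv, ← hproj]
    rfl
  have hψq : (u₀, ((e p₀).2).comp (fderiv ℝ i u₀)) = ψ q₀ :=
    Prod.ext rfl ((isRestriction_iff hι hqs (mem_extChartAt_source _) hproj).1 hpq).symm
  have hGF : G (e p₀) = F p₀ := by
    have := (hbox.extends_chart _ (Metric.mem_ball_self hδ)
      (normalCoord_extChartAt_nonneg _ _)).2.2.1
    rw [extChartAt_to_inv] at this
    exact this.symm
  have hism : ContDiffAt ℝ ∞ i u₀ := contDiffAt_chartInclusion hι hqs hps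
  have hsrc : ∀ᶠ u in 𝓝 u₀, ι ((extChartAt (𝓡 m) q₀.proj).symm u) ∈
      (extChartAt (𝓡∂ (m + 1)) p₀.proj).source := by
    have h1 : ContinuousAt (fun u ↦ ι ((extChartAt (𝓡 m) q₀.proj).symm u)) u₀ :=
      (hι.embedding.contMDiff.continuous).continuousAt.comp (continuousAt_extChartAt_symm q₀.proj)
    refine h1.preimage_mem_nhds ((isOpen_extChartAt_source p₀.proj).mem_nhds ?_)
    rw [extChartAt_to_inv]
    exact hps
  have hi0 : ∀ᶠ u in 𝓝 u₀, i u 0 = 0 := by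
    filter_upwards [hsrc] with u hu
    refine (isBoundaryPoint_iff_extChartAt_eq_zero hu).1 ?_
    rw [← hι.range_eq]
    exact mem_range_self _
  have hX : normalCoord m (hamiltonianVector (fderiv ℝ G (i u₀, (e p₀).2))) ≠ 0 := by
    rw [hiu]
    rwa [hbox.vectorField_eq hF] at htr
  obtain ⟨j, hj, hj0, hjs, hjσ⟩ := exists_boundary_section hk hism hi0
    (injective_fderiv_chartInclusion hι hqs hps)
    (hbox.contDiff.of_le (by exact_mod_cast Nat.le_succ k)) hX
  rw [hiu, hψq, hGF] at hj hj0 hjs hjσ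
  refine ⟨j, hj, hj0, ?_, hjσ⟩
  have hball : ∀ᶠ w in 𝓝 (ψ q₀, F p₀), j w ∈ Metric.ball (e p₀) δ := by
    refine hj.continuousAt.preimage_mem_nhds ?_
    rw [hj0]
    exact Metric.ball_mem_nhds _ hδ
  have hu : ∀ᶠ w in 𝓝 (ψ q₀, F p₀), i w.1.1 0 = 0 ∧
      ι ((extChartAt (𝓡 m) q₀.proj).symm w.1.1) ∈ (extChartAt (𝓡∂ (m + 1)) p₀.proj).source :=
    (continuous_fst.fst.continuousAt (x := (ψ q₀, F p₀))).eventually (hi0.and hsrc)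
  have htar : ∀ᶠ w in 𝓝 (ψ q₀, F p₀), w.1 ∈ ψ.target :=
    eventually_nhds_fst (extChartAt_target_mem_nhds q₀)
  filter_upwards [hjs, hball, hu, htar] with w ⟨h1, h2, h3⟩ h4 ⟨h5, h6⟩ h7
  obtain ⟨h8, h9, h10, -⟩ := hbox.extends_chart (j w) h4 (by
    rw [normalCoord_apply, h1, h5])
  refine ⟨h8, h9, h10.trans h3, ?_⟩
  have hq' : (ψ.symm w.1).proj ∈ (extChartAt (𝓡 m) q₀.proj).source :=
    mem_extChartAt_cotangent_source.1 (ψ.map_target h7)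
  have hp' : (e.symm (j w)).proj ∈ (extChartAt (𝓡∂ (m + 1)) p₀.proj).source :=
    mem_extChartAt_cotangent_source.1 (e.map_target h8)
  have hqp : (ψ.symm w.1).proj = (extChartAt (𝓡 m) q₀.proj).symm w.1.1 := rfl
  have hpp : (e.symm (j w)).proj = (extChartAt (𝓡∂ (m + 1)) p₀.proj).symm (j w).1 := rfl
  refine (isRestriction_iff hι hq' hp' ?_).2 ?_
  · rw [hpp, hqp, h1]
    exact (extChartAt (𝓡∂ (m + 1)) p₀.proj).left_inv h6
  · rw [← hψ, ← he, ψ.right_inv h7, e.right_inv h8, hqp,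
      (extChartAt (𝓡 m) q₀.proj).right_inv (mem_extChartAt_cotangent_target.1 h7)]
    exact h2

end InitialSlice

/-! ### Rays do not continue past a transversal exit -/

section TransversalExit

variable {m : ℕ} {M : Type*} [TopologicalSpace M] [ChartedSpace (EuclideanHalfSpace (m + 1)) M]
  [IsManifold (𝓡∂ (m + 1)) ∞ M] {F : CotangentBundle (𝓡∂ (m + 1)) M → ℝ}

theorem IsBicharacteristicOn.hasDerivWithinAt_self
    {γ : ℝ → CotangentBundle (𝓡∂ (m + 1)) M} {s : Set ℝ} (hγ : IsBicharacteristicOn F γ s) {t : ℝ}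
    (ht : t ∈ s) : HasDerivWithinAt
      (fun u ↦ extChartAt (cotangentModel (𝓡∂ (m + 1))) (γ t) (γ u))
      (hamiltonianVectorField F (γ t) : ModelVec (m + 1) × ModelCovec (m + 1)) s t := by
  have h1 := HasMFDerivWithinAt.hasDerivWithinAt_extChartAt (hγ.2 t ht)
    (mem_extChartAt_source (γ t))
  have h2 : tangentCoordChange (cotangentModel (𝓡∂ (m + 1))) (γ t) (γ t) (γ t)
      (hamiltonianVectorField F (γ t) : ModelVec (m + 1) × ModelCovec (m + 1)) =
      (hamiltonianVectorField F (γ t) : ModelVec (m + 1) × ModelCovec (m + 1)) :=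
    tangentCoordChange_self (mem_extChartAt_source _)
  exact h2 ▸ h1

/-- A bicharacteristic cannot touch the boundary transversally at an interior time. -/
theorem IsBicharacteristicOn.normalCoord_eq_zero {γ : ℝ → CotangentBundle (𝓡∂ (m + 1)) M}
    {a b t : ℝ} (hγ : IsBicharacteristicOn F γ (Icc a b)) (ht : t ∈ Ioo a b)
    (hb : (γ t).proj ∈ (𝓡∂ (m + 1)).boundary M) :
    normalCoord m (hamiltonianVectorField F (γ t) :
      ModelVec (m + 1) × ModelCovec (m + 1)) = 0 := by
  obtain ⟨X, hX, hd⟩ : ∃ X : ModelVec (m + 1) × ModelCovec (m + 1),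
      (hamiltonianVectorField F (γ t) : ModelVec (m + 1) × ModelCovec (m + 1)) = X ∧
      HasDerivAt (fun u ↦ extChartAt (cotangentModel (𝓡∂ (m + 1))) (γ t) (γ u)) X t :=
    ⟨_, rfl, (hγ.hasDerivWithinAt_self (Ioo_subset_Icc_self ht)).hasDerivAt
      (Icc_mem_nhds ht.1 ht.2)⟩
  have hd' : HasDerivAt (fun u ↦ normalCoord m
      (extChartAt (cotangentModel (𝓡∂ (m + 1))) (γ t) (γ u))) (normalCoord m X) t :=
    (normalCoord m).hasFDerivAt.comp_hasDerivAt t hd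
  have h0 : normalCoord m (extChartAt (cotangentModel (𝓡∂ (m + 1))) (γ t) (γ t)) = 0 :=
    (isBoundaryPoint_iff_extChartAt_eq_zero (mem_extChartAt_source (γ t).proj)).1 hb
  have hmin : IsLocalMin (fun u ↦ normalCoord m
      (extChartAt (cotangentModel (𝓡∂ (m + 1))) (γ t) (γ u))) t := by
    refine Filter.Eventually.of_forall fun u ↦ ?_
    simp only [h0]
    exact normalCoord_extChartAt_nonneg _ _
  exact (congrArg (normalCoord m) hX).trans (hmin.hasDerivAt_eq_zero hd')

end TransversalExit

/-! ### Homogeneous ray parametrisations from lens data -/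

section RayParam

variable {m : ℕ} {M : Type*} [TopologicalSpace M] [ChartedSpace (EuclideanHalfSpace (m + 1)) M]
  [IsManifold (𝓡∂ (m + 1)) ∞ M]
  {B : Type*} [TopologicalSpace B] [ChartedSpace (EuclideanSpace ℝ (Fin m)) B]

/-- The set covered by a parametrised family of curves. -/
def rayRegion {W X : Type*} (𝒲 : Set W) (ℓ : W → ℝ) (γ : W → ℝ → X) : Set X :=
  {r | ∃ w ∈ 𝒲, ∃ t ∈ Icc 0 (ℓ w), γ w t = r}

/-- The boundary covectors and energies `(q, e)` such that `q / √(2e)` belongs to `𝒰`. -/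
def lensDomain (𝒰 : Set (CotangentBundle (𝓡 m) B)) : Set (CotangentBundle (𝓡 m) B × ℝ) :=
  {w | 0 < w.2 ∧ dilation (√(2 * w.2))⁻¹ w.1 ∈ 𝒰}

/-- The homogeneous extension of the travel time to all energies. -/
def lensLength (ℓ : CotangentBundle (𝓡 m) B → ℝ) (w : CotangentBundle (𝓡 m) B × ℝ) : ℝ :=
  ℓ (dilation (√(2 * w.2))⁻¹ w.1) / √(2 * w.2)

/-- The homogeneous extension of the scattering relation to all energies. -/
def lensScattering (S : CotangentBundle (𝓡 m) B → CotangentBundle (𝓡 m) B)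
    (w : CotangentBundle (𝓡 m) B × ℝ) : CotangentBundle (𝓡 m) B :=
  dilation √(2 * w.2) (S (dilation (√(2 * w.2))⁻¹ w.1))

theorem sqrt_two_mul_sq_mul {c e : ℝ} (hc : 0 < c) : √(2 * (c ^ 2 * e)) = c * √(2 * e) := by
  rw [show 2 * (c ^ 2 * e) = c ^ 2 * (2 * e) by ring, Real.sqrt_mul (sq_nonneg c),
    Real.sqrt_sq hc.le]

theorem sqrt_two_mul_pos {e : ℝ} (he : 0 < e) : 0 < √(2 * e) := Real.sqrt_pos.2 (by linarith)

variable [IsManifold (𝓡 m) ∞ B]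

/-- The bicharacteristics `γ w` from `U` to `V`, parametrised by `w = (q, e)`, where `q` is the
restriction of the initial covector to the boundary and `e` is the energy. They have length `ℓ w`,
and `S w` is the restriction of the final covector to the boundary. -/
structure IsRayParam (ι : B → M) (F : CotangentBundle (𝓡∂ (m + 1)) M → ℝ) (U V : Set B)
    (𝒲 : Set (CotangentBundle (𝓡 m) B × ℝ))
    (S : CotangentBundle (𝓡 m) B × ℝ → CotangentBundle (𝓡 m) B)
    (ℓ : CotangentBundle (𝓡 m) B × ℝ → ℝ)
    (γ : CotangentBundle (𝓡 m) B × ℝ → ℝ → CotangentBundle (𝓡∂ (m + 1)) M) : Prop where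
  isOpen_dom : IsOpen 𝒲
  length_pos : ∀ w ∈ 𝒲, 0 < ℓ w
  bichar : ∀ w ∈ 𝒲, IsBicharacteristicOn F (γ w) (Icc 0 (ℓ w))
  interior : ∀ w ∈ 𝒲, ∀ t ∈ Ioo 0 (ℓ w), (γ w t).proj ∈ (𝓡∂ (m + 1)).interior M
  start : ∀ w ∈ 𝒲, IsRestriction ι (γ w 0) w.1
  start_mem : ∀ w ∈ 𝒲, w.1.proj ∈ U
  energy : ∀ w ∈ 𝒲, F (γ w 0) = w.2
  incoming : ∀ w ∈ 𝒲, 0 < normalCoord m (hamiltonianVectorField F (γ w 0) :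
    ModelVec (m + 1) × ModelCovec (m + 1))
  finish : ∀ w ∈ 𝒲, IsRestriction ι (γ w (ℓ w)) (S w)
  finish_mem : ∀ w ∈ 𝒲, (S w).proj ∈ V
  transversal : ∀ w ∈ 𝒲, normalCoord m (hamiltonianVectorField F (γ w (ℓ w)) :
    ModelVec (m + 1) × ModelCovec (m + 1)) ≠ 0
  unique : ∀ w₀ ∈ 𝒲, ∀ᶠ y : (CotangentBundle (𝓡 m) B × ℝ) × CotangentBundle (𝓡∂ (m + 1)) M in
    𝓝 (w₀, γ w₀ 0), y.2 ∈ nonzeroCovectors → F y.2 = y.1.2 → IsRestriction ι y.2 y.1.1 →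
      y.2 = γ y.1 0
  dilation : ∀ w ∈ 𝒲, ∀ c : ℝ, 0 < c → (dilation c w.1, c ^ 2 * w.2) ∈ 𝒲 ∧
    ℓ (dilation c w.1, c ^ 2 * w.2) = ℓ w / c ∧
    ∀ t, γ (dilation c w.1, c ^ 2 * w.2) (t / c) = dilation c (γ w t)

theorem continuousAt_dilation_inv_sqrt {n : ℕ} {A : Type*} [TopologicalSpace A]
    {I : ModelWithCorners ℝ (EuclideanSpace ℝ (Fin n)) A} {N : Type*} [TopologicalSpace N]
    [ChartedSpace A N] [IsManifold I ∞ N] {p : CotangentBundle I N} {e : ℝ} (he : 0 < e) :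
    ContinuousAt (fun y : CotangentBundle I N × ℝ ↦ dilation (√(2 * y.2))⁻¹ y.1) (p, e) := by
  refine (continuous_dilation (I := I) (M := N)).continuousAt.comp
    (f := fun y : CotangentBundle I N × ℝ ↦ ((√(2 * y.2))⁻¹, y.1)) ?_
  refine ContinuousAt.prodMk (ContinuousAt.inv₀ ?_ (sqrt_two_mul_pos he).ne') continuousAt_fst
  exact (Real.continuous_sqrt.comp (continuous_const.mul continuous_snd)).continuousAt

theorem isOpen_lensDomain {𝒰 : Set (CotangentBundle (𝓡 m) B)} (h𝒰 : IsOpen 𝒰) :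
    IsOpen (lensDomain 𝒰) := by
  refine isOpen_iff_mem_nhds.2 fun ⟨q, e⟩ ⟨he, hq⟩ ↦ ?_
  exact Filter.inter_mem (continuousAt_snd.preimage_mem_nhds (isOpen_Ioi.mem_nhds he))
    ((continuousAt_dilation_inv_sqrt he).preimage_mem_nhds (h𝒰.mem_nhds hq))

variable {ι : B → M} {ρ : M → ℝ} {F : CotangentBundle (𝓡∂ (m + 1)) M → ℝ} {U V : Set B}
  {p₀ : CotangentBundle (𝓡∂ (m + 1)) M} {𝒰 : Set (CotangentBundle (𝓡 m) B)}
  {𝒪 : Set (CotangentBundle (𝓡∂ (m + 1)) M)}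
  {S S' : CotangentBundle (𝓡 m) B → CotangentBundle (𝓡 m) B}
  {ℓ ℓ' : CotangentBundle (𝓡 m) B → ℝ}

theorem IsLensData.congr (h : IsLensData ι ρ F U V p₀ 𝒰 𝒪 S ℓ) (hS : ∀ q ∈ 𝒰, S' q = S q)
    (hℓ : ∀ q ∈ 𝒰, ℓ' q = ℓ q) : IsLensData ι ρ F U V p₀ 𝒰 𝒪 S' ℓ' :=
  { h with
    hits := fun q hq p hp hpu hpq ↦ by
      rw [hS q hq, hℓ q hq]
      exact h.hits q hq p hp hpu hpq }

/-- The unit bicharacteristics of lens data. -/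
theorem IsLensData.exists_unit_rays (h : IsLensData ι ρ F U V p₀ 𝒰 𝒪 S ℓ) :
    ∃ γ : CotangentBundle (𝓡 m) B → ℝ → CotangentBundle (𝓡∂ (m + 1)) M, ∀ q ∈ 𝒰,
      (γ q 0 ∈ 𝒪 ∧ γ q 0 ∈ unitCosphere F ∧ IsRestriction ι (γ q 0) q ∧
        0 < normalVelocity ρ F (γ q 0)) ∧
      (0 < ℓ q ∧ IsBicharacteristicOn F (γ q) (Icc 0 (ℓ q)) ∧
      (∀ t ∈ Ioo 0 (ℓ q), (γ q t).proj ∈ (𝓡∂ (m + 1)).interior M) ∧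
      (γ q (ℓ q)).proj ∈ ι '' V ∧ normalVelocity ρ F (γ q (ℓ q)) ≠ 0 ∧
      IsRestriction ι (γ q (ℓ q)) (S q)) ∧
      ∀ p ∈ 𝒪, p ∈ unitCosphere F → IsRestriction ι p q → p = γ q 0 := by
  have hex : ∀ q, ∃ γ : ℝ → CotangentBundle (𝓡∂ (m + 1)) M, q ∈ 𝒰 →
      (γ 0 ∈ 𝒪 ∧ γ 0 ∈ unitCosphere F ∧ IsRestriction ι (γ 0) q ∧
        0 < normalVelocity ρ F (γ 0)) ∧
      (0 < ℓ q ∧ IsBicharacteristicOn F γ (Icc 0 (ℓ q)) ∧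
      (∀ t ∈ Ioo 0 (ℓ q), (γ t).proj ∈ (𝓡∂ (m + 1)).interior M) ∧
      (γ (ℓ q)).proj ∈ ι '' V ∧ normalVelocity ρ F (γ (ℓ q)) ≠ 0 ∧
      IsRestriction ι (γ (ℓ q)) (S q)) ∧
      ∀ p ∈ 𝒪, p ∈ unitCosphere F → IsRestriction ι p q → p = γ 0 := by
    intro q
    by_cases hq : q ∈ 𝒰
    · obtain ⟨p, ⟨hp, hpu, hpq⟩, huniq⟩ := h.solvable q hq
      obtain ⟨hℓ, γ, rfl, hγ⟩ := h.hits q hq p hp hpu hpq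
      exact ⟨γ, fun _ ↦ ⟨⟨hp, hpu, hpq, h.incoming q hq _ hp hpu hpq⟩, ⟨hℓ, hγ⟩,
        fun p' h1 h2 h3 ↦ huniq p' ⟨h1, h2, h3⟩⟩⟩
    · exact ⟨fun _ ↦ p₀, fun h' ↦ absurd h' hq⟩
  choose γ hγ using hex
  exact ⟨γ, hγ⟩

theorem normalCoord_hamiltonianVectorField_dilation (hF : IsPositiveHamiltonian F) {c : ℝ}
    (hc : 0 < c) {p : CotangentBundle (𝓡∂ (m + 1)) M} (hp : p ∈ nonzeroCovectors) :
    normalCoord m (hamiltonianVectorField F (dilation c p) :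
      ModelVec (m + 1) × ModelCovec (m + 1)) =
    c * normalCoord m (hamiltonianVectorField F p : ModelVec (m + 1) × ModelCovec (m + 1)) := by
  rw [hF.hamiltonianVectorField_dilation hc hp, map_smul]
  rfl

theorem mul_mem_Icc_of_mem_Icc_div {c l t : ℝ} (hc : 0 < c) (ht : t ∈ Icc 0 (l / c)) :
    c * t ∈ Icc 0 l :=
  ⟨mul_nonneg hc.le ht.1, by rw [mul_comm]; exact (le_div_iff₀ hc).1 ht.2⟩

theorem mul_mem_Ioo_of_mem_Ioo_div {c l t : ℝ} (hc : 0 < c) (ht : t ∈ Ioo 0 (l / c)) :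
    c * t ∈ Ioo 0 l :=
  ⟨mul_pos hc ht.1, by rw [mul_comm]; exact (lt_div_iff₀ hc).1 ht.2⟩

/-- Lens data yield a homogeneous parametrisation of the flowout cone. -/
theorem IsLensData.exists_isRayParam [T2Space M] (hι : IsBoundaryInclusion (𝓡∂ (m + 1)) m ι)
    (hρ : IsBoundaryDefiningFunction (𝓡∂ (m + 1)) ρ) (hF : IsPositiveHamiltonian F)
    (h : IsLensData ι ρ F U V p₀ 𝒰 𝒪 S ℓ) :
    ∃ γ, IsRayParam ι F U V (lensDomain 𝒰) (lensScattering S) (lensLength ℓ) γ ∧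
      flowoutCone ι F 𝒰 𝒪 = rayRegion (lensDomain 𝒰) (lensLength ℓ) γ := by
  obtain ⟨γ, hγ⟩ := h.exists_unit_rays
  have hin : ∀ q ∈ 𝒰, ∀ t, t = 0 → 0 < normalCoord m (hamiltonianVectorField F (γ q t) :
      ModelVec (m + 1) × ModelCovec (m + 1)) := fun q hq t ht ↦ by
    subst ht
    obtain ⟨⟨-, -, h1, h2⟩, -, -⟩ := hγ q hq
    obtain ⟨a, ha, h3⟩ := exists_normalVelocity_eq hρ F (h1.mem_boundary hι)
    rw [h3] at h2
    exact (pos_iff_pos_of_mul_pos h2).1 ha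
  have hout : ∀ q ∈ 𝒰, ∀ t, t = ℓ q → normalCoord m (hamiltonianVectorField F (γ q t) :
      ModelVec (m + 1) × ModelCovec (m + 1)) ≠ 0 := fun q hq t ht ↦ by
    subst ht
    obtain ⟨-, ⟨-, -, -, -, h2, h1⟩, -⟩ := hγ q hq
    obtain ⟨a, ha, h3⟩ := exists_normalVelocity_eq hρ F (h1.mem_boundary hι)
    rw [h3] at h2
    exact right_ne_zero_of_mul h2
  -- The unit energy is 1/2, so dilation by √(2e) carries a unit ray to energy e; the same factor
  -- speeds up its time.
  refine ⟨fun w t ↦ dilation √(2 * w.2) (γ (dilation (√(2 * w.2))⁻¹ w.1) (√(2 * w.2) * t)),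
    ?_, ?_⟩
  · have hend : ∀ w ∈ lensDomain 𝒰,
        √(2 * w.2) * lensLength ℓ w = ℓ (dilation (√(2 * w.2))⁻¹ w.1) := fun w hw ↦
      mul_div_cancel₀ _ (sqrt_two_mul_pos hw.1).ne'
    refine ⟨isOpen_lensDomain h.isOpen_dom, ?_, ?_, ?_, ?_, ?_, ?_, ?_, ?_, ?_, ?_, ?_, ?_⟩
    · intro w hw
      exact div_pos (hγ _ hw.2).2.1.1 (sqrt_two_mul_pos hw.1)
    · intro w hw
      exact (IsBicharacteristicOn.dilation hF (hγ _ hw.2).2.1.2.1 (sqrt_two_mul_pos hw.1)).mono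
        fun t ht ↦ mul_mem_Icc_of_mem_Icc_div (sqrt_two_mul_pos hw.1) ht
    · intro w hw t ht
      exact (hγ _ hw.2).2.1.2.2.1 _ (mul_mem_Ioo_of_mem_Ioo_div (sqrt_two_mul_pos hw.1) ht)
    · intro w hw
      have h1 := (hγ _ hw.2).1.2.2.1.dilation √(2 * w.2)
      rwa [dilation_dilation_inv (sqrt_two_mul_pos hw.1).ne', ← mul_zero √(2 * w.2)] at h1
    · intro w hw
      exact h.dom_over (dilation (√(2 * w.2))⁻¹ w.1) hw.2
    · intro w hw
      have h1 := (hγ _ hw.2).1.2.1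
      simp only [mul_zero]
      rw [hF.homogeneous _ h1.1 _ (sqrt_two_mul_pos hw.1), h1.2,
        Real.sq_sqrt (by linarith [hw.1])]
      ring
    · intro w hw
      refine lt_of_lt_of_eq (mul_pos (sqrt_two_mul_pos hw.1) (hin _ hw.2 _ (mul_zero _)))
        (normalCoord_hamiltonianVectorField_dilation hF (sqrt_two_mul_pos hw.1) ?_).symm
      rw [mul_zero]
      exact (hγ _ hw.2).1.2.1.1
    · intro w hw
      simp only [hend w hw]
      exact (hγ _ hw.2).2.1.2.2.2.2.2.dilation _
    · intro w hw
      obtain ⟨-, ⟨-, -, -, ⟨b, hb, h1⟩, -, h2⟩, -⟩ := hγ _ hw.2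
      rw [h2.proj_eq] at h1
      have h3 := hι.embedding.isEmbedding.injective h1
      rw [h3] at hb
      exact hb
    · intro w hw
      refine ne_of_eq_of_ne
        (normalCoord_hamiltonianVectorField_dilation hF (sqrt_two_mul_pos hw.1) ?_)
        (mul_ne_zero (sqrt_two_mul_pos hw.1).ne' (hout _ hw.2 _ (hend w hw)))
      rw [hend w hw]
      exact (hγ _ hw.2).2.1.2.1.1 _ ⟨(hγ _ hw.2).2.1.1.le, le_rfl⟩
    -- A covector close to the initial one, rescaled to unit energy, lies in the open set 𝒪, where
    -- uniqueness of the solution applies.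
    · intro w₀ hw₀
      simp only [mul_zero]
      have hc : ContinuousAt (fun y : (CotangentBundle (𝓡 m) B × ℝ) ×
          CotangentBundle (𝓡∂ (m + 1)) M ↦ dilation (√(2 * y.1.2))⁻¹ y.2)
          (w₀, dilation √(2 * w₀.2) (γ (dilation (√(2 * w₀.2))⁻¹ w₀.1) 0)) :=
        ContinuousAt.comp
          (g := fun y : CotangentBundle (𝓡∂ (m + 1)) M × ℝ ↦ dilation (√(2 * y.2))⁻¹ y.1)
          (x := (w₀, dilation √(2 * w₀.2) (γ (dilation (√(2 * w₀.2))⁻¹ w₀.1) 0)))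
          (continuousAt_dilation_inv_sqrt hw₀.1)
          (f := fun y : (CotangentBundle (𝓡 m) B × ℝ) × CotangentBundle (𝓡∂ (m + 1)) M ↦
            (y.2, y.1.2)) (continuous_snd.prodMk continuous_fst.snd).continuousAt
      have h1 := hc.preimage_mem_nhds (h.isOpen_nhd.mem_nhds (by
        simp only
        rw [dilation_inv_dilation (sqrt_two_mul_pos hw₀.1).ne']
        exact (hγ _ hw₀.2).1.1))
      filter_upwards [h1, eventually_nhds_fst ((isOpen_lensDomain h.isOpen_dom).mem_nhds hw₀)]
        with ⟨w, p⟩ hp hw h2 h3 h4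
      have hs := sqrt_two_mul_pos hw.1
      simp only at h2 h3 h4
      rw [← (hγ _ hw.2).2.2 _ hp ⟨dilation_mem_nonzeroCovectors (inv_ne_zero hs.ne') h2, by
        rw [hF.homogeneous _ h2 _ (inv_pos.2 hs), h3, inv_pow, Real.sq_sqrt (by linarith [hw.1])]
        have := hw.1.ne'
        simp only at this
        field_simp⟩ (h4.dilation _)]
      exact (dilation_dilation_inv hs.ne' p).symm
    · intro w hw c hc
      have hs := sqrt_two_mul_pos hw.1
      have hq : dilation (√(2 * (c ^ 2 * w.2)))⁻¹ (dilation c w.1) =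
          dilation (√(2 * w.2))⁻¹ w.1 := by
        rw [sqrt_two_mul_sq_mul hc, dilation_dilation]
        congr 1
        field_simp
      refine ⟨⟨mul_pos (pow_pos hc 2) hw.1, hq ▸ hw.2⟩, ?_, fun t ↦ ?_⟩
      · simp only [lensLength]
        rw [hq, sqrt_two_mul_sq_mul hc, div_div, mul_comm c]
      · simp only
        rw [hq, sqrt_two_mul_sq_mul hc, dilation_dilation,
          show c * √(2 * w.2) * (t / c) = √(2 * w.2) * t by field_simp]
  · refine Subset.antisymm ?_ ?_
    · rintro r ⟨c, hc, p, hp, hpu, ⟨q, hq, hpq⟩, T, γ', hT, hγ'0, hγ', rfl⟩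
      obtain ⟨-, ⟨hℓ, hbi, hint, -, -, hend⟩, huniq⟩ := hγ q hq
      have h0 : γ' 0 = γ q 0 := hγ'0.trans (huniq p hp hpu hpq)
      -- A longer bicharacteristic would touch the boundary at the interior time ℓ q with zero
      -- normal velocity, against transversality of the exit.
      have hTℓ : T ≤ ℓ q := by
        by_contra! hlt
        have heq := IsBicharacteristicOn.eqOn hF
          (hγ'.mono (Icc_subset_Icc_right hlt.le)) hbi ⟨le_rfl, hℓ.le⟩ h0 ⟨hℓ.le, le_rfl⟩
        have h1 := hγ'.normalCoord_eq_zero ⟨hℓ, hlt⟩ (by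
          rw [heq]
          exact hend.mem_boundary hι)
        rw [heq] at h1
        exact hout q hq _ rfl h1
      have heq := IsBicharacteristicOn.eqOn hF hγ' (hbi.mono (Icc_subset_Icc_right hTℓ))
        ⟨le_rfl, hT⟩ h0 ⟨hT, le_rfl⟩
      have hs : √(2 * (c ^ 2 / 2)) = c := by
        rw [mul_div_cancel₀ _ two_ne_zero, Real.sqrt_sq hc.le]
      have hq' : dilation (√(2 * (c ^ 2 / 2)))⁻¹ (dilation c q) = q := by
        rw [hs, dilation_inv_dilation hc.ne']
      -- A unit ray dilated by c has energy c²/2 and runs through its points in time T/c.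
      refine ⟨(dilation c q, c ^ 2 / 2), ⟨by positivity, ?_⟩, T / c, ⟨by positivity, ?_⟩, ?_⟩
      · simp only
        rwa [hq']
      · simp only [lensLength]
        rw [hq', hs]
        gcongr
      · simp only
        rw [hq', hs, mul_div_cancel₀ _ hc.ne', heq]
    · rintro r ⟨w, hw, t, ht, rfl⟩
      obtain ⟨⟨h1, h2, h3, -⟩, ⟨hℓ, hbi, -⟩, -⟩ := hγ _ hw.2
      have hs := sqrt_two_mul_pos hw.1
      have ht' := mul_mem_Icc_of_mem_Icc_div hs ht
      exact ⟨√(2 * w.2), hs, _, h1, h2, ⟨_, hw.2, h3⟩, √(2 * w.2) * t, _, ht'.1, rfl,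
        hbi.mono (Icc_subset_Icc_right ht'.2), rfl⟩

end RayParam

/-! ### Injectivity and local coordinates of the ray parametrisation -/

section RayParamGeometry

variable {m : ℕ} {M : Type*} [TopologicalSpace M] [ChartedSpace (EuclideanHalfSpace (m + 1)) M]
  [IsManifold (𝓡∂ (m + 1)) ∞ M]
  {B : Type*} [TopologicalSpace B] [ChartedSpace (EuclideanSpace ℝ (Fin m)) B]
  [IsManifold (𝓡 m) ∞ B] {ι : B → M} {F : CotangentBundle (𝓡∂ (m + 1)) M → ℝ} {U V : Set B}
  {𝒲 : Set (CotangentBundle (𝓡 m) B × ℝ)}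
  {S : CotangentBundle (𝓡 m) B × ℝ → CotangentBundle (𝓡 m) B}
  {ℓ : CotangentBundle (𝓡 m) B × ℝ → ℝ}
  {γ : CotangentBundle (𝓡 m) B × ℝ → ℝ → CotangentBundle (𝓡∂ (m + 1)) M}

theorem IsRayParam.energy_eq (h : IsRayParam ι F U V 𝒲 S ℓ γ) (hF : IsPositiveHamiltonian F)
    {w : CotangentBundle (𝓡 m) B × ℝ} (hw : w ∈ 𝒲) {t : ℝ} (ht : t ∈ Icc 0 (ℓ w)) :
    F (γ w t) = w.2 :=
  ((h.bichar w hw).energy hF t ht).trans (h.energy w hw)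

theorem IsRayParam.eq_zero_or_eq_length (h : IsRayParam ι F U V 𝒲 S ℓ γ)
    {w : CotangentBundle (𝓡 m) B × ℝ} (hw : w ∈ 𝒲) {t : ℝ} (ht : t ∈ Icc 0 (ℓ w))
    (hb : (γ w t).proj ∈ (𝓡∂ (m + 1)).boundary M) : t = 0 ∨ t = ℓ w := by
  by_contra! hne
  have hi := h.interior w hw t ⟨ht.1.lt_of_ne' hne.1, ht.2.lt_of_ne hne.2⟩
  rw [← ModelWithCorners.compl_boundary] at hi
  exact hi hb

theorem IsRayParam.proj_start_mem (h : IsRayParam ι F U V 𝒲 S ℓ γ)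
    {w : CotangentBundle (𝓡 m) B × ℝ} (hw : w ∈ 𝒲) : (γ w 0).proj ∈ ι '' U :=
  ⟨_, h.start_mem w hw, (h.start w hw).proj_eq.symm⟩

theorem IsRayParam.proj_finish_mem (h : IsRayParam ι F U V 𝒲 S ℓ γ)
    {w : CotangentBundle (𝓡 m) B × ℝ} (hw : w ∈ 𝒲) : (γ w (ℓ w)).proj ∈ ι '' V :=
  ⟨_, h.finish_mem w hw, (h.finish w hw).proj_eq.symm⟩

/-- A ray meets the boundary only at its ends, and its final point lies over V, which is disjoint
from U. -/
theorem IsRayParam.proj_mem_iff_eq_zero (hι : IsBoundaryInclusion (𝓡∂ (m + 1)) m ι)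
    (hUV : Disjoint U V) (h : IsRayParam ι F U V 𝒲 S ℓ γ)
    {w : CotangentBundle (𝓡 m) B × ℝ} (hw : w ∈ 𝒲) {t : ℝ} (ht : t ∈ Icc 0 (ℓ w)) :
    (γ w t).proj ∈ ι '' U ↔ t = 0 := by
  refine ⟨fun hU ↦ ?_, fun h0 ↦ by rw [h0]; exact h.proj_start_mem hw⟩
  refine (h.eq_zero_or_eq_length hw ht ?_).resolve_right fun h1 ↦ ?_
  · rw [← hι.range_eq]
    exact image_subset_range _ _ hU
  · have hV := h.proj_finish_mem hw
    rw [← h1] at hV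
    exact ((disjoint_image_iff hι.embedding.isEmbedding.injective).2 hUV).le_bot ⟨hU, hV⟩

theorem IsRayParam.proj_mem_iff_eq_length (hι : IsBoundaryInclusion (𝓡∂ (m + 1)) m ι)
    (hUV : Disjoint U V) (h : IsRayParam ι F U V 𝒲 S ℓ γ)
    {w : CotangentBundle (𝓡 m) B × ℝ} (hw : w ∈ 𝒲) {t : ℝ} (ht : t ∈ Icc 0 (ℓ w)) :
    (γ w t).proj ∈ ι '' V ↔ t = ℓ w := by
  refine ⟨fun hV ↦ ?_, fun h0 ↦ by rw [h0]; exact h.proj_finish_mem hw⟩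
  refine (h.eq_zero_or_eq_length hw ht ?_).resolve_left fun h1 ↦ ?_
  · rw [← hι.range_eq]
    exact image_subset_range _ _ hV
  · have hU := h.proj_start_mem hw
    rw [← h1] at hU
    exact ((disjoint_image_iff hι.embedding.isEmbedding.injective).2 hUV).le_bot ⟨hU, hV⟩

/-- Followed backwards for time t, both rays pass through the initial point of the first. It lies
over U, which the second ray meets only at time 0, so t = t'; the initial covector then determines q
and e. -/
theorem IsRayParam.eq_of_le [T2Space M] (hι : IsBoundaryInclusion (𝓡∂ (m + 1)) m ι)
    (hUV : Disjoint U V) (hF : IsPositiveHamiltonian F) (h : IsRayParam ι F U V 𝒲 S ℓ γ)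
    {w w' : CotangentBundle (𝓡 m) B × ℝ} (hw : w ∈ 𝒲) (hw' : w' ∈ 𝒲) {t t' : ℝ}
    (ht : t ∈ Icc 0 (ℓ w)) (ht' : t' ∈ Icc 0 (ℓ w')) (hle : t ≤ t')
    (heq : γ w t = γ w' t') : w = w' ∧ t = t' := by
  have hshift : IsBicharacteristicOn F (γ w' ∘ (· + (t' - t))) (Icc 0 t) := by
    have h1 := h.bichar w' hw'
    have hsub : ∀ s ∈ Icc 0 t, s + (t' - t) ∈ Icc 0 (ℓ w') := fun s hs ↦
      ⟨by linarith [hs.1], by linarith [hs.2, ht'.2]⟩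
    exact ⟨fun s hs ↦ h1.1 _ (hsub s hs), (h1.2.comp_add (t' - t)).mono hsub⟩
  have h0 : γ w 0 = γ w' (t' - t) := by
    have := IsBicharacteristicOn.eqOn hF ((h.bichar w hw).mono (Icc_subset_Icc_right ht.2)) hshift
      ⟨ht.1, le_rfl⟩ (by simpa using heq) ⟨le_rfl, ht.1⟩
    simpa using this
  have htt : t' - t = 0 := by
    refine (h.proj_mem_iff_eq_zero hι hUV hw' ⟨by linarith, by linarith [ht.1, ht'.2]⟩).1 ?_
    rw [← h0]
    exact h.proj_start_mem hw
  rw [htt] at h0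
  refine ⟨Prod.ext ?_ ?_, by linarith⟩
  · refine IsRestriction.unique hι (h.start w hw) ?_
    rw [h0]
    exact h.start w' hw'
  · exact (h.energy w hw).symm.trans ((congrArg F h0).trans (h.energy _ hw'))

/-- The rays do not intersect each other. -/
theorem IsRayParam.injective [T2Space M] (hι : IsBoundaryInclusion (𝓡∂ (m + 1)) m ι)
    (hUV : Disjoint U V) (hF : IsPositiveHamiltonian F) (h : IsRayParam ι F U V 𝒲 S ℓ γ)
    {w w' : CotangentBundle (𝓡 m) B × ℝ} (hw : w ∈ 𝒲) (hw' : w' ∈ 𝒲) {t t' : ℝ}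
    (ht : t ∈ Icc 0 (ℓ w)) (ht' : t' ∈ Icc 0 (ℓ w')) (heq : γ w t = γ w' t') :
    w = w' ∧ t = t' := by
  rcases le_total t t' with hle | hle
  · exact h.eq_of_le hι hUV hF hw hw' ht ht' hle heq
  · obtain ⟨h1, h2⟩ := h.eq_of_le hι hUV hF hw' hw ht' ht hle heq.symm
    exact ⟨h1.symm, h2.symm⟩

theorem IsRayParam.overBoundary_start (hι : IsBoundaryInclusion (𝓡∂ (m + 1)) m ι)
    (hUV : Disjoint U V) (h : IsRayParam ι F U V 𝒲 S ℓ γ) :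
    overBoundary ι (rayRegion 𝒲 ℓ γ) U = (fun w ↦ γ w 0) '' 𝒲 := by
  ext p
  constructor
  · rintro ⟨⟨w, hw, t, ht, rfl⟩, hU⟩
    exact ⟨w, hw, by rw [(h.proj_mem_iff_eq_zero hι hUV hw ht).1 hU]⟩
  · rintro ⟨w, hw, rfl⟩
    exact ⟨⟨w, hw, 0, ⟨le_rfl, (h.length_pos w hw).le⟩, rfl⟩, h.proj_start_mem hw⟩

theorem IsRayParam.overBoundary_finish (hι : IsBoundaryInclusion (𝓡∂ (m + 1)) m ι)
    (hUV : Disjoint U V) (h : IsRayParam ι F U V 𝒲 S ℓ γ) :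
    overBoundary ι (rayRegion 𝒲 ℓ γ) V = (fun w ↦ γ w (ℓ w)) '' 𝒲 := by
  ext p
  constructor
  · rintro ⟨⟨w, hw, t, ht, rfl⟩, hV⟩
    exact ⟨w, hw, by rw [(h.proj_mem_iff_eq_length hι hUV hw ht).1 hV]⟩
  · rintro ⟨w, hw, rfl⟩
    exact ⟨⟨w, hw, ℓ w, ⟨(h.length_pos w hw).le, le_rfl⟩, rfl⟩, h.proj_finish_mem hw⟩

/-- The coordinates on boundary covectors and energies near `(q₀, e)`. -/
def boundaryChartSymm (q₀ : CotangentBundle (𝓡 m) B) (y : (ModelVec m × ModelCovec m) × ℝ) :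
    CotangentBundle (𝓡 m) B × ℝ :=
  ((extChartAt (cotangentModel (𝓡 m)) q₀).symm y.1, y.2)

theorem boundaryChartSymm_apply_self (w : CotangentBundle (𝓡 m) B × ℝ) :
    boundaryChartSymm w.1 (extChartAt (cotangentModel (𝓡 m)) w.1 w.1, w.2) = w :=
  Prod.ext (extChartAt_to_inv (I := cotangentModel (𝓡 m)) w.1) rfl

theorem continuousAt_boundaryChartSymm (w : CotangentBundle (𝓡 m) B × ℝ) :
    ContinuousAt (boundaryChartSymm w.1) (extChartAt (cotangentModel (𝓡 m)) w.1 w.1, w.2) :=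
  ContinuousAt.prodMk ((continuousAt_extChartAt_symm w.1).comp
    (f := fun y : (ModelVec m × ModelCovec m) × ℝ ↦ y.1) (x := (_, w.2)) continuousAt_fst)
    continuousAt_snd

theorem IsRayParam.eventually_mem (h : IsRayParam ι F U V 𝒲 S ℓ γ)
    {w : CotangentBundle (𝓡 m) B × ℝ} (hw : w ∈ 𝒲) :
    ∀ᶠ y in 𝓝 (extChartAt (cotangentModel (𝓡 m)) w.1 w.1, w.2), boundaryChartSymm w.1 y ∈ 𝒲 := by
  refine (continuousAt_boundaryChartSymm w).preimage_mem_nhds ?_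
  rw [boundaryChartSymm_apply_self]
  exact h.isOpen_dom.mem_nhds hw

/-- The initial covectors of the rays carry no regularity a priori. The local uniqueness clause
identifies them with the smooth symplectic section of `exists_initial_slice`. -/
theorem IsRayParam.isSmoothSlice (h : IsRayParam ι F U V 𝒲 S ℓ γ)
    (hι : IsBoundaryInclusion (𝓡∂ (m + 1)) m ι) (hF : IsPositiveHamiltonian F)
    {w : CotangentBundle (𝓡 m) B × ℝ} (hw : w ∈ 𝒲) {k : ℕ} (hk : 2 ≤ k) :
    IsSmoothSlice k (fun a b : (ModelVec m × ModelCovec m) × ℝ ↦ stdSymplectic a.1 b.1)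
      (extChartAt (cotangentModel (𝓡 m)) w.1 w.1, w.2)
      (fun y ↦ γ (boundaryChartSymm w.1 y) 0) (γ w 0) := by
  set e := extChartAt (cotangentModel (𝓡∂ (m + 1))) (γ w 0) with he
  set w₀ := (extChartAt (cotangentModel (𝓡 m)) w.1 w.1, w.2) with hw₀
  obtain ⟨j, hj, hj0, hjs, hjσ⟩ := exists_initial_slice hι hF hk (h.start w hw)
    ((h.bichar w hw).1 0 ⟨le_rfl, (h.length_pos w hw).le⟩) (h.incoming w hw).ne'
  rw [h.energy w hw, ← hw₀] at hj hj0 hjs hjσ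
  rw [← he] at hj0 hjs
  have hcont : ContinuousAt (fun y ↦ (boundaryChartSymm w.1 y, e.symm (j y))) w₀ := by
    refine (continuousAt_boundaryChartSymm w).prodMk ?_
    refine ContinuousAt.comp (g := e.symm) ?_ hj.continuousAt
    rw [hj0]
    exact continuousAt_extChartAt_symm _
  have huniq := hcont.eventually (p := fun y ↦ y.2 ∈ nonzeroCovectors → F y.2 = y.1.2 →
    IsRestriction ι y.2 y.1.1 → y.2 = γ y.1 0) (by
      simp only
      rw [hj0, extChartAt_to_inv, boundaryChartSymm_apply_self]
      exact h.unique w hw)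
  have hev : ∀ᶠ y in 𝓝 w₀, γ (boundaryChartSymm w.1 y) 0 ∈ e.source ∧
      e (γ (boundaryChartSymm w.1 y) 0) = j y := by
    filter_upwards [huniq, hjs] with y h1 ⟨h2, h3, h4, h5⟩
    rw [← h1 h3 h4 h5]
    exact ⟨e.map_target h2, e.right_inv h2⟩
  have heq : (fun y ↦ e (γ (boundaryChartSymm w.1 y) 0)) =ᶠ[𝓝 w₀] j := hev.mono fun y hy ↦ hy.2
  refine ⟨hj.congr_of_eventuallyEq heq, ?_⟩
  filter_upwards [hev, heq.eventuallyEq_nhds, hjσ] with y h1 h2 h3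
  refine ⟨h1.1, fun a b ↦ ?_⟩
  rw [h2.fderiv_eq]
  exact h3 a b

theorem IsRayParam.isRayFamily (h : IsRayParam ι F U V 𝒲 S ℓ γ)
    (hι : IsBoundaryInclusion (𝓡∂ (m + 1)) m ι) (hF : IsPositiveHamiltonian F)
    {w : CotangentBundle (𝓡 m) B × ℝ} (hw : w ∈ 𝒲) :
    IsRayFamily F (fun a b : (ModelVec m × ModelCovec m) × ℝ ↦ stdSymplectic a.1 b.1)
      (ContinuousLinearMap.snd ℝ (ModelVec m × ModelCovec m) ℝ)
      (fun y ↦ γ (boundaryChartSymm w.1 y)) (fun y ↦ ℓ (boundaryChartSymm w.1 y))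
      (extChartAt (cotangentModel (𝓡 m)) w.1 w.1, w.2) := by
  have hev := h.eventually_mem hw
  have hmem := hev.self_of_nhds
  refine ⟨hev.mono fun y ↦ h.length_pos _, hev.mono fun y ↦ h.bichar _,
    hev.mono fun y ↦ h.interior _, hev.mono fun y hy ↦ (h.start _ hy).mem_boundary hι,
    hev.mono fun y hy ↦ (h.finish _ hy).mem_boundary hι, hev.mono fun y hy ↦ h.energy _ hy,
    h.incoming _ hmem, h.transversal _ hmem, fun k hk ↦ ?_⟩
  have e : γ (boundaryChartSymm w.1 (extChartAt (cotangentModel (𝓡 m)) w.1 w.1, w.2)) 0 =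
      γ w 0 := by rw [boundaryChartSymm_apply_self]
  rw [e]
  exact h.isSmoothSlice hι hF hw hk

/-- The coordinates `(q, e, t)` near a point of a ray: the point moves smoothly with them, the
symplectic form is `dq - dt ∧ de`, and they are restricted only by the position of the boundary. -/
theorem IsRayParam.exists_normalForm [T2Space M] (h : IsRayParam ι F U V 𝒲 S ℓ γ)
    (hι : IsBoundaryInclusion (𝓡∂ (m + 1)) m ι) (hF : IsPositiveHamiltonian F)
    {w : CotangentBundle (𝓡 m) B × ℝ} (hw : w ∈ 𝒲) {t : ℝ} (ht : t ∈ Icc 0 (ℓ w)) {k : ℕ}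
    (hk : 2 ≤ k) :
    ∃ A : ((ModelVec m × ModelCovec m) × ℝ) × ℝ → ModelVec (m + 1) × ModelCovec (m + 1),
      ContDiffAt ℝ k A ((extChartAt (cotangentModel (𝓡 m)) w.1 w.1, w.2), t) ∧
      A ((extChartAt (cotangentModel (𝓡 m)) w.1 w.1, w.2), t) =
        extChartAt (cotangentModel (𝓡∂ (m + 1))) (γ w t) (γ w t) ∧
      (∀ᶠ y in 𝓝 ((extChartAt (cotangentModel (𝓡 m)) w.1 w.1, w.2), t),
        0 ≤ normalCoord m (A y) ↔ y.2 ∈ Icc 0 (ℓ (boundaryChartSymm w.1 y.1))) ∧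
      (∀ᶠ y in 𝓝 ((extChartAt (cotangentModel (𝓡 m)) w.1 w.1, w.2), t),
        y.2 ∈ Icc 0 (ℓ (boundaryChartSymm w.1 y.1)) → γ (boundaryChartSymm w.1 y.1) y.2 ∈
          (extChartAt (cotangentModel (𝓡∂ (m + 1))) (γ w t)).source ∧
        extChartAt (cotangentModel (𝓡∂ (m + 1))) (γ w t)
          (γ (boundaryChartSymm w.1 y.1) y.2) = A y) ∧
      ∀ᶠ y in 𝓝 ((extChartAt (cotangentModel (𝓡 m)) w.1 w.1, w.2), t), ∀ a b,
        stdSymplectic (fderiv ℝ A y a) (fderiv ℝ A y b) =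
          stdSymplectic a.1.1 b.1.1 - a.2 * b.1.2 + b.2 * a.1.2 := by
  have e : γ (boundaryChartSymm w.1 (extChartAt (cotangentModel (𝓡 m)) w.1 w.1, w.2)) t =
      γ w t := by rw [boundaryChartSymm_apply_self]
  have h1 := (h.isRayFamily hι hF hw).exists_normalForm hF hk (t := t)
    (by rwa [boundaryChartSymm_apply_self])
  rw [e] at h1
  exact h1

end RayParamGeometry

/-! ### Matching rays with the same parameters -/

section Transport

/-- The differential of a map that pulls the symplectic form back to a nondegenerate form is
injective. -/
theorem eq_zero_of_pullback_nondegenerate {m n : ℕ}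
    {D : ((ModelVec m × ModelCovec m) × ℝ) × ℝ →L[ℝ] ModelVec n × ModelCovec n}
    (hD : ∀ a b, stdSymplectic (D a) (D b) =
      stdSymplectic a.1.1 b.1.1 - a.2 * b.1.2 + b.2 * a.1.2)
    (a : ((ModelVec m × ModelCovec m) × ℝ) × ℝ) (ha : D a = 0) : a = 0 := by
  have h0 : ∀ b : ((ModelVec m × ModelCovec m) × ℝ) × ℝ,
      stdSymplectic a.1.1 b.1.1 - a.2 * b.1.2 + b.2 * a.1.2 = 0 := fun b ↦ by
    rw [← hD, ha]
    simp [stdSymplectic]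
  refine Prod.ext (Prod.ext ?_ ?_) ?_
  · refine eq_zero_of_stdSymplectic_eq_zero fun b ↦ ?_
    simpa using h0 ((b, 0), 0)
  · simpa [stdSymplectic] using h0 ((0, 0), 1)
  · simpa [stdSymplectic] using h0 ((0, 1), 0)

theorem finrank_rayCoordinates (m : ℕ) :
    Module.finrank ℝ (((ModelVec m × ModelCovec m) × ℝ) × ℝ) =
      Module.finrank ℝ (ModelVec (m + 1) × ModelCovec (m + 1)) := by
  simp only [Module.finrank_prod, finrank_modelCovec, finrank_euclideanSpace, Fintype.card_fin,
    Module.finrank_self]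
  omega

/-- Injectivity of (w, t) ↦ γ w t makes the matching well defined; outside the region the value is
arbitrary. -/
theorem exists_transport {W X X' : Type*} [Nonempty X'] {𝒲 : Set W} {ℓ : W → ℝ} {γ : W → ℝ → X}
    (γ' : W → ℝ → X') (hinj : ∀ w ∈ 𝒲, ∀ w' ∈ 𝒲, ∀ t ∈ Icc 0 (ℓ w), ∀ t' ∈ Icc 0 (ℓ w'),
      γ w t = γ w' t' → w = w' ∧ t = t') :
    ∃ κ : X → X', ∀ w ∈ 𝒲, ∀ t ∈ Icc 0 (ℓ w), κ (γ w t) = γ' w t := by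
  have hex : ∀ r, ∃ r', ∀ w ∈ 𝒲, ∀ t ∈ Icc 0 (ℓ w), γ w t = r → r' = γ' w t := by
    intro r
    by_cases hr : ∃ w ∈ 𝒲, ∃ t ∈ Icc 0 (ℓ w), γ w t = r
    · obtain ⟨w, hw, t, ht, rfl⟩ := hr
      refine ⟨γ' w t, fun w' hw' t' ht' h ↦ ?_⟩
      obtain ⟨rfl, rfl⟩ := hinj w' hw' w hw t' ht' t ht h
      rfl
    · exact ⟨Classical.arbitrary X', fun w hw t ht h ↦ absurd ⟨w, hw, t, ht, h⟩ hr⟩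
  choose κ hκ using hex
  exact ⟨κ, fun w hw t ht ↦ hκ _ w hw t ht rfl⟩

variable {m : ℕ}
  {M' : Type*} [TopologicalSpace M'] [ChartedSpace (EuclideanHalfSpace (m + 1)) M']
  [IsManifold (𝓡∂ (m + 1)) ∞ M']
  {M : Type*} [TopologicalSpace M] [ChartedSpace (EuclideanHalfSpace (m + 1)) M]
  [IsManifold (𝓡∂ (m + 1)) ∞ M]

/-- A map of cotangent bundles that extends smoothly and symplectically in charts is smooth, and
its differential is symplectic. -/
theorem contMDiffAt_and_symplectic_of_chart
    {κ : CotangentBundle (𝓡∂ (m + 1)) M → CotangentBundle (𝓡∂ (m + 1)) M'}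
    {r : CotangentBundle (𝓡∂ (m + 1)) M}
    (h : ∀ k : ℕ, 2 ≤ k → ∃ f : ModelVec (m + 1) × ModelCovec (m + 1) →
        ModelVec (m + 1) × ModelCovec (m + 1),
      ContDiffAt ℝ k f (extChartAt (cotangentModel (𝓡∂ (m + 1))) r r) ∧
      (∀ᶠ p in 𝓝 r, κ p ∈ (extChartAt (cotangentModel (𝓡∂ (m + 1))) (κ r)).source ∧
        extChartAt (cotangentModel (𝓡∂ (m + 1))) (κ r) (κ p) =
          f (extChartAt (cotangentModel (𝓡∂ (m + 1))) r p)) ∧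
      ∀ a b, stdSymplectic (fderiv ℝ f (extChartAt (cotangentModel (𝓡∂ (m + 1))) r r) a)
        (fderiv ℝ f (extChartAt (cotangentModel (𝓡∂ (m + 1))) r r) b) = stdSymplectic a b) :
    ContMDiffAt (cotangentModel (𝓡∂ (m + 1))) (cotangentModel (𝓡∂ (m + 1))) ∞ κ r ∧
      ∀ a b, symplecticForm (κ r)
        (mfderiv (cotangentModel (𝓡∂ (m + 1))) (cotangentModel (𝓡∂ (m + 1))) κ r a)
        (mfderiv (cotangentModel (𝓡∂ (m + 1))) (cotangentModel (𝓡∂ (m + 1))) κ r b) =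
        symplecticForm r a b := by
  set e := extChartAt (cotangentModel (𝓡∂ (m + 1))) r with he
  set e' := extChartAt (cotangentModel (𝓡∂ (m + 1))) (κ r) with he'
  have hcont : ContinuousAt κ r := by
    obtain ⟨f, hf, hev, -⟩ := h 2 le_rfl
    have h1 : ContinuousAt (fun p ↦ e'.symm (f (e p))) r := by
      refine ContinuousAt.comp (g := e'.symm) ?_
        (ContinuousAt.comp (g := f) hf.continuousAt (continuousAt_extChartAt r))
      rw [← hev.self_of_nhds.2]
      exact continuousAt_extChartAt_symm _
    refine h1.congr (hev.mono fun p hp ↦ ?_)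
    simp only
    rw [← hp.2, e'.left_inv hp.1]
  have hwritten : ∀ f : ModelVec (m + 1) × ModelCovec (m + 1) →
        ModelVec (m + 1) × ModelCovec (m + 1), (∀ᶠ p in 𝓝 r, κ p ∈ e'.source ∧
        e' (κ p) = f (e p)) →
      e' ∘ κ ∘ e.symm =ᶠ[𝓝[range (cotangentModel (𝓡∂ (m + 1)))] (e r)] f := by
    intro f hev
    have h1 : ∀ᶠ z in 𝓝 (e r), e' (κ (e.symm z)) = f (e (e.symm z)) := by
      refine (continuousAt_extChartAt_symm r).eventually
        (p := fun p ↦ e' (κ p) = f (e p)) ?_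
      rw [extChartAt_to_inv]
      exact hev.mono fun p hp ↦ hp.2
    filter_upwards [mem_nhdsWithin_of_mem_nhds h1,
      extChartAt_target_mem_nhdsWithin (I := cotangentModel (𝓡∂ (m + 1))) r] with z hz hz'
    simp only [Function.comp_apply]
    rw [hz, e.right_inv hz']
  have hsm : ContMDiffAt (cotangentModel (𝓡∂ (m + 1))) (cotangentModel (𝓡∂ (m + 1))) ∞ κ r := by
    -- The extension f depends on the order of differentiability but κ does not, so κ is of class
    -- C^k for every k.
    refine contMDiffAt_iff.2 ⟨hcont, contDiffWithinAt_infty.2 fun k ↦ ?_⟩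
    obtain ⟨f, hf, hev, -⟩ := h (k + 2) (by omega)
    have h2 := hwritten f hev
    exact (hf.of_le (by exact_mod_cast Nat.le_add_right k 2)).contDiffWithinAt.congr_of_eventuallyEq
      h2 (h2.self_of_nhdsWithin (mem_range_self _))
  refine ⟨hsm, ?_⟩
  obtain ⟨f, hf, hev, hσ⟩ := h 2 le_rfl
  have h2 := hwritten f hev
  obtain ⟨D, hD, hDf⟩ : ∃ D : ModelVec (m + 1) × ModelCovec (m + 1) →L[ℝ]
        ModelVec (m + 1) × ModelCovec (m + 1),
      (mfderiv (cotangentModel (𝓡∂ (m + 1))) (cotangentModel (𝓡∂ (m + 1))) κ r :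
        ModelVec (m + 1) × ModelCovec (m + 1) →L[ℝ] ModelVec (m + 1) × ModelCovec (m + 1)) = D ∧
      HasFDerivWithinAt (e' ∘ κ ∘ e.symm) D (range (cotangentModel (𝓡∂ (m + 1)))) (e r) :=
    ⟨_, rfl, (hsm.mdifferentiableAt (by simp)).hasMFDerivAt.2⟩
  have hfd : HasFDerivWithinAt (e' ∘ κ ∘ e.symm) (fderiv ℝ f (e r))
      (range (cotangentModel (𝓡∂ (m + 1)))) (e r) :=
    ((hf.differentiableAt (by simp)).hasFDerivAt.hasFDerivWithinAt).congr_of_eventuallyEq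
      h2 (h2.self_of_nhdsWithin (mem_range_self _))
  have hDeq : D = fderiv ℝ f (e r) :=
    ((cotangentModel (𝓡∂ (m + 1))).uniqueDiffOn (e r) (mem_range_self _)).eq hDf hfd
  intro a b
  refine (congrArg (fun D : ModelVec (m + 1) × ModelCovec (m + 1) →L[ℝ]
    ModelVec (m + 1) × ModelCovec (m + 1) ↦ stdSymplectic (D a) (D b)) (hD.trans hDeq)).trans ?_
  exact hσ a b

variable {B : Type*} [TopologicalSpace B] [ChartedSpace (EuclideanSpace ℝ (Fin m)) B]
  [IsManifold (𝓡 m) ∞ B] {ι : B → M} {F : CotangentBundle (𝓡∂ (m + 1)) M → ℝ} {U V : Set B}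
  {ι' : B → M'} {F' : CotangentBundle (𝓡∂ (m + 1)) M' → ℝ}
  {𝒲 : Set (CotangentBundle (𝓡 m) B × ℝ)}
  {S : CotangentBundle (𝓡 m) B × ℝ → CotangentBundle (𝓡 m) B}
  {ℓ : CotangentBundle (𝓡 m) B × ℝ → ℝ}
  {γ' : CotangentBundle (𝓡 m) B × ℝ → ℝ → CotangentBundle (𝓡∂ (m + 1)) M'}
  {γ : CotangentBundle (𝓡 m) B × ℝ → ℝ → CotangentBundle (𝓡∂ (m + 1)) M}

/-- The map that matches the rays of two parametrisations with the same data, in charts. -/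
theorem IsRayParam.exists_transport_chart [T2Space M] [T2Space M']
    (hι : IsBoundaryInclusion (𝓡∂ (m + 1)) m ι) (hι' : IsBoundaryInclusion (𝓡∂ (m + 1)) m ι')
    (hF : IsPositiveHamiltonian F) (hF' : IsPositiveHamiltonian F')
    (h : IsRayParam ι F U V 𝒲 S ℓ γ) (h' : IsRayParam ι' F' U V 𝒲 S ℓ γ')
    {κ : CotangentBundle (𝓡∂ (m + 1)) M → CotangentBundle (𝓡∂ (m + 1)) M'}
    (hκ : ∀ w ∈ 𝒲, ∀ t ∈ Icc 0 (ℓ w), κ (γ w t) = γ' w t)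
    {r : CotangentBundle (𝓡∂ (m + 1)) M} (hr : r ∈ rayRegion 𝒲 ℓ γ) {k : ℕ} (hk : 2 ≤ k) :
    ∃ f : ModelVec (m + 1) × ModelCovec (m + 1) → ModelVec (m + 1) × ModelCovec (m + 1),
      ContDiffAt ℝ k f (extChartAt (cotangentModel (𝓡∂ (m + 1))) r r) ∧
      (∀ᶠ p in 𝓝 r, p ∈ rayRegion 𝒲 ℓ γ ∧
        κ p ∈ (extChartAt (cotangentModel (𝓡∂ (m + 1))) (κ r)).source ∧
        extChartAt (cotangentModel (𝓡∂ (m + 1))) (κ r) (κ p) =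
          f (extChartAt (cotangentModel (𝓡∂ (m + 1))) r p)) ∧
      ∀ a b, stdSymplectic (fderiv ℝ f (extChartAt (cotangentModel (𝓡∂ (m + 1))) r r) a)
        (fderiv ℝ f (extChartAt (cotangentModel (𝓡∂ (m + 1))) r r) b) = stdSymplectic a b := by
  obtain ⟨w, hw, t, ht, rfl⟩ := hr
  rw [hκ w hw t ht]
  obtain ⟨A, hA, hA0, hAb, hAγ, hAσ⟩ := h.exists_normalForm hι hF hw ht hk
  obtain ⟨A', hA', -, -, hAγ', hAσ'⟩ := h'.exists_normalForm hι' hF' hw ht hk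
  set e := extChartAt (cotangentModel (𝓡∂ (m + 1))) (γ w t) with he
  set e' := extChartAt (cotangentModel (𝓡∂ (m + 1))) (γ' w t) with he'
  set y₀ := ((extChartAt (cotangentModel (𝓡 m)) w.1 w.1, w.2), t) with hy₀
  have hk1 : 1 ≤ k := by omega
  have hk0 : (k : WithTop ℕ∞) ≠ 0 := by exact_mod_cast (by omega : k ≠ 0)
  -- The normal form A is a local diffeomorphism because it pulls the symplectic form back to a
  -- nondegenerate form. With inverse g, the map A' ∘ g represents κ.
  obtain ⟨g, hg, hg0, hgA⟩ := hA.exists_local_inverse (finrank_rayCoordinates m)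
    (by exact_mod_cast hk1) (eq_zero_of_pullback_nondegenerate hAσ.self_of_nhds)
  rw [hA0] at hg hg0 hgA
  have hA'g : ContDiffAt ℝ k A' (g (e (γ w t))) := by rwa [hg0]
  refine ⟨A' ∘ g, ContDiffAt.comp (g := A') (f := g) _ hA'g hg, ?_, fun a b ↦ ?_⟩
  · have hgc : Filter.Tendsto (fun p ↦ g (e p)) (𝓝 (γ w t)) (𝓝 y₀) := by
      have h1 : ContinuousAt (fun p ↦ g (e p)) (γ w t) :=
        ContinuousAt.comp (g := g) hg.continuousAt (continuousAt_extChartAt (γ w t))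
      have h2 := h1.tendsto
      rwa [hg0] at h2
    have hmem : ∀ᶠ y in 𝓝 y₀, boundaryChartSymm w.1 y.1 ∈ 𝒲 :=
      eventually_nhds_fst (h.eventually_mem hw)
    filter_upwards [hgc.eventually hAb, hgc.eventually hAγ, hgc.eventually hAγ',
      hgc.eventually hmem, (continuousAt_extChartAt (γ w t)).eventually hgA,
      extChartAt_source_mem_nhds (I := cotangentModel (𝓡∂ (m + 1))) (γ w t)]
      with p h1 h2 h3 h4 h5 h6
    -- A point of the manifold has nonnegative normal coordinate, so its parameters satisfy 0 ≤ t ≤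
    -- ℓ. As ℓ is common to both sides, the same parameters are admissible for the second family,
    -- and p itself lies in the region.
    have ht' := h1.1 (by rw [h5]; exact normalCoord_extChartAt_nonneg _ _)
    obtain ⟨h7, h8⟩ := h2 ht'
    have hp : γ (boundaryChartSymm w.1 (g (e p)).1) (g (e p)).2 = p :=
      e.injOn h7 h6 (h8.trans h5)
    obtain ⟨h9, h10⟩ := h3 ht'
    have hκp : κ p = γ' (boundaryChartSymm w.1 (g (e p)).1) (g (e p)).2 := by
      conv_lhs => rw [← hp]
      exact hκ _ h4 _ ht'
    rw [hκp]
    exact ⟨⟨_, h4, _, ht', hp⟩, h9, h10⟩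
  · have hgd : HasFDerivAt g (fderiv ℝ g (e (γ w t))) (e (γ w t)) :=
      (hg.differentiableAt hk0).hasFDerivAt
    have hA'd : HasFDerivAt A' (fderiv ℝ A' y₀) (g (e (γ w t))) := by
      rw [hg0]; exact (hA'.differentiableAt hk0).hasFDerivAt
    have hAd : HasFDerivAt A (fderiv ℝ A y₀) (g (e (γ w t))) := by
      rw [hg0]; exact (hA.differentiableAt hk0).hasFDerivAt
    have hid : (fderiv ℝ A y₀).comp (fderiv ℝ g (e (γ w t))) =
        ContinuousLinearMap.id ℝ (ModelVec (m + 1) × ModelCovec (m + 1)) :=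
      (HasFDerivAt.comp (g := A) _ hAd hgd).unique ((hasFDerivAt_id _).congr_of_eventuallyEq hgA)
    have hid' : ∀ v, fderiv ℝ A y₀ (fderiv ℝ g (e (γ w t)) v) = v := fun v ↦
      congrArg (fun D : ModelVec (m + 1) × ModelCovec (m + 1) →L[ℝ]
        ModelVec (m + 1) × ModelCovec (m + 1) ↦ D v) hid
    rw [(HasFDerivAt.comp (g := A') _ hA'd hgd).fderiv]
    simp only [ContinuousLinearMap.comp_apply]
    -- A and A' pull the symplectic forms back to the same form in (q, e, t), so A' ∘ A⁻¹ is
    -- symplectic.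
    rw [hAσ'.self_of_nhds, ← hAσ.self_of_nhds, hid', hid']

end Transport

/-! ### The homogeneous canonical transformation -/

section CanonicalTransport

variable {m : ℕ} {M : Type*} [TopologicalSpace M] [ChartedSpace (EuclideanHalfSpace (m + 1)) M]
  [IsManifold (𝓡∂ (m + 1)) ∞ M] [T2Space M]
  {M' : Type*} [TopologicalSpace M'] [ChartedSpace (EuclideanHalfSpace (m + 1)) M']
  [IsManifold (𝓡∂ (m + 1)) ∞ M'] [T2Space M']
  {B : Type*} [TopologicalSpace B] [ChartedSpace (EuclideanSpace ℝ (Fin m)) B]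
  [IsManifold (𝓡 m) ∞ B] {ι : B → M} {F : CotangentBundle (𝓡∂ (m + 1)) M → ℝ} {U V : Set B}
  {ι' : B → M'} {F' : CotangentBundle (𝓡∂ (m + 1)) M' → ℝ}
  {𝒲 : Set (CotangentBundle (𝓡 m) B × ℝ)}
  {S : CotangentBundle (𝓡 m) B × ℝ → CotangentBundle (𝓡 m) B}
  {ℓ : CotangentBundle (𝓡 m) B × ℝ → ℝ}
  {γ : CotangentBundle (𝓡 m) B × ℝ → ℝ → CotangentBundle (𝓡∂ (m + 1)) M}
  {γ' : CotangentBundle (𝓡 m) B × ℝ → ℝ → CotangentBundle (𝓡∂ (m + 1)) M'}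
  {κ : CotangentBundle (𝓡∂ (m + 1)) M → CotangentBundle (𝓡∂ (m + 1)) M'}

theorem IsRayParam.contMDiffAt_transport
    (hι : IsBoundaryInclusion (𝓡∂ (m + 1)) m ι) (hι' : IsBoundaryInclusion (𝓡∂ (m + 1)) m ι')
    (hF : IsPositiveHamiltonian F) (hF' : IsPositiveHamiltonian F')
    (h : IsRayParam ι F U V 𝒲 S ℓ γ) (h' : IsRayParam ι' F' U V 𝒲 S ℓ γ')
    (hκ : ∀ w ∈ 𝒲, ∀ t ∈ Icc 0 (ℓ w), κ (γ w t) = γ' w t)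
    {r : CotangentBundle (𝓡∂ (m + 1)) M} (hr : r ∈ rayRegion 𝒲 ℓ γ) :
    ContMDiffAt (cotangentModel (𝓡∂ (m + 1))) (cotangentModel (𝓡∂ (m + 1))) ∞ κ r ∧
      ∀ a b, symplecticForm (κ r)
        (mfderiv (cotangentModel (𝓡∂ (m + 1))) (cotangentModel (𝓡∂ (m + 1))) κ r a)
        (mfderiv (cotangentModel (𝓡∂ (m + 1))) (cotangentModel (𝓡∂ (m + 1))) κ r b) =
        symplecticForm r a b := by
  refine contMDiffAt_and_symplectic_of_chart fun k hk ↦ ?_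
  obtain ⟨f, h1, h2, h3⟩ := h.exists_transport_chart hι hι' hF hF' h' hκ hr hk
  exact ⟨f, h1, h2.mono fun p hp ↦ hp.2, h3⟩

/-- The chart argument applied to the identity shows that all nearby points of the manifold lie on
rays. Hence the region is open in the cotangent bundle, boundary included, and derivatives within it
are full derivatives. -/
theorem IsRayParam.rayRegion_mem_nhds (hι : IsBoundaryInclusion (𝓡∂ (m + 1)) m ι)
    (hF : IsPositiveHamiltonian F) (h : IsRayParam ι F U V 𝒲 S ℓ γ)
    {r : CotangentBundle (𝓡∂ (m + 1)) M} (hr : r ∈ rayRegion 𝒲 ℓ γ) :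
    rayRegion 𝒲 ℓ γ ∈ 𝓝 r := by
  obtain ⟨f, -, h2, -⟩ := h.exists_transport_chart (κ := id) hι hι hF hF h
    (fun _ _ _ _ ↦ rfl) hr le_rfl
  exact h2.mono fun p hp ↦ hp.1

/-- Matching the rays of two parametrisations with the same data is a homogeneous canonical
transformation. -/
theorem IsRayParam.isHomogeneousCanonical
    (hι : IsBoundaryInclusion (𝓡∂ (m + 1)) m ι) (hι' : IsBoundaryInclusion (𝓡∂ (m + 1)) m ι')
    (hF : IsPositiveHamiltonian F) (hF' : IsPositiveHamiltonian F')
    (h : IsRayParam ι F U V 𝒲 S ℓ γ) (h' : IsRayParam ι' F' U V 𝒲 S ℓ γ')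
    (hκ : ∀ w ∈ 𝒲, ∀ t ∈ Icc 0 (ℓ w), κ (γ w t) = γ' w t)
    {κ' : CotangentBundle (𝓡∂ (m + 1)) M' → CotangentBundle (𝓡∂ (m + 1)) M}
    (hκ' : ∀ w ∈ 𝒲, ∀ t ∈ Icc 0 (ℓ w), κ' (γ' w t) = γ w t) :
    IsHomogeneousCanonical κ (rayRegion 𝒲 ℓ γ) (rayRegion 𝒲 ℓ γ') := by
  have hinv : InvOn κ' κ (rayRegion 𝒲 ℓ γ) (rayRegion 𝒲 ℓ γ') := by
    constructor
    · rintro _ ⟨w, hw, t, ht, rfl⟩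
      rw [hκ w hw t ht, hκ' w hw t ht]
    · rintro _ ⟨w, hw, t, ht, rfl⟩
      rw [hκ' w hw t ht, hκ w hw t ht]
  refine ⟨hinv.bijOn ?_ ?_, fun r hr ↦ ?_, ⟨κ', hinv, fun r hr ↦ ?_⟩, ?_, fun r hr a b ↦ ?_⟩
  · rintro _ ⟨w, hw, t, ht, rfl⟩
    exact ⟨w, hw, t, ht, (hκ w hw t ht).symm⟩
  · rintro _ ⟨w, hw, t, ht, rfl⟩
    exact ⟨w, hw, t, ht, (hκ' w hw t ht).symm⟩
  · exact (h.contMDiffAt_transport hι hι' hF hF' h' hκ hr).1.contMDiffWithinAt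
  · exact (h'.contMDiffAt_transport hι' hι hF' hF h hκ' hr).1.contMDiffWithinAt
  · rintro _ ⟨w, hw, t, ht, rfl⟩ c hc
    obtain ⟨h1, h2, h3⟩ := h.dilation w hw c hc
    rw [hκ w hw t ht, ← h3 t, ← (h'.dilation w hw c hc).2.2 t]
    refine hκ _ h1 _ ⟨div_nonneg ht.1 hc.le, ?_⟩
    rw [h2]
    exact div_le_div_of_nonneg_right ht.2 hc.le
  · have hm : mfderivWithin (cotangentModel (𝓡∂ (m + 1))) (cotangentModel (𝓡∂ (m + 1))) κ
        (rayRegion 𝒲 ℓ γ) r =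
        mfderiv (cotangentModel (𝓡∂ (m + 1))) (cotangentModel (𝓡∂ (m + 1))) κ r :=
      mfderivWithin_of_mem_nhds (h.rayRegion_mem_nhds hι hF hr)
    rw [hm]
    exact (h.contMDiffAt_transport hι hι' hF hF' h' hκ hr).2 a b

/-- Two ray parametrisations with the same domain, scattering relation and travel time are
conjugate by a homogeneous canonical transformation that fixes the boundary data. -/
theorem IsRayParam.exists_canonical
    (hι : IsBoundaryInclusion (𝓡∂ (m + 1)) m ι) (hι' : IsBoundaryInclusion (𝓡∂ (m + 1)) m ι')
    (hF : IsPositiveHamiltonian F) (hF' : IsPositiveHamiltonian F') (hUV : Disjoint U V)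
    [Nonempty (CotangentBundle (𝓡∂ (m + 1)) M)] [Nonempty (CotangentBundle (𝓡∂ (m + 1)) M')]
    (h : IsRayParam ι F U V 𝒲 S ℓ γ) (h' : IsRayParam ι' F' U V 𝒲 S ℓ γ') :
    ∃ κ : CotangentBundle (𝓡∂ (m + 1)) M → CotangentBundle (𝓡∂ (m + 1)) M',
      IsHomogeneousCanonical κ (rayRegion 𝒲 ℓ γ) (rayRegion 𝒲 ℓ γ') ∧
      κ '' overBoundary ι (rayRegion 𝒲 ℓ γ) U = overBoundary ι' (rayRegion 𝒲 ℓ γ') U ∧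
      κ '' overBoundary ι (rayRegion 𝒲 ℓ γ) V = overBoundary ι' (rayRegion 𝒲 ℓ γ') V ∧
      (∀ p ∈ overBoundary ι (rayRegion 𝒲 ℓ γ) U ∪ overBoundary ι (rayRegion 𝒲 ℓ γ) V,
        ∃ q : CotangentBundle (𝓡 m) B, IsRestriction ι p q ∧ IsRestriction ι' (κ p) q) ∧
      ∀ p ∈ rayRegion 𝒲 ℓ γ, F' (κ p) = F p := by
  obtain ⟨κ, hκ⟩ := exists_transport γ' fun w hw w' hw' t ht t' ht' heq ↦
    h.injective hι hUV hF hw hw' ht ht' heq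
  obtain ⟨κ', hκ'⟩ := exists_transport γ fun w hw w' hw' t ht t' ht' heq ↦
    h'.injective hι' hUV hF' hw hw' ht ht' heq
  have hκ0 : ∀ w ∈ 𝒲, κ (γ w 0) = γ' w 0 := fun w hw ↦
    hκ w hw 0 ⟨le_rfl, (h.length_pos w hw).le⟩
  have hκℓ : ∀ w ∈ 𝒲, κ (γ w (ℓ w)) = γ' w (ℓ w) := fun w hw ↦
    hκ w hw _ ⟨(h.length_pos w hw).le, le_rfl⟩
  refine ⟨κ, h.isHomogeneousCanonical hι hι' hF hF' h' hκ hκ', ?_, ?_, ?_, ?_⟩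
  · rw [h.overBoundary_start hι hUV, h'.overBoundary_start hι' hUV, image_image]
    exact image_congr hκ0
  · rw [h.overBoundary_finish hι hUV, h'.overBoundary_finish hι' hUV, image_image]
    exact image_congr hκℓ
  -- The common restriction is the parameter q over U and the value of the shared scattering map
  -- over V.
  · rw [h.overBoundary_start hι hUV, h.overBoundary_finish hι hUV]
    rintro _ (⟨w, hw, rfl⟩ | ⟨w, hw, rfl⟩)
    · refine ⟨w.1, h.start w hw, ?_⟩
      simp only [hκ0 w hw]
      exact h'.start w hw
    · refine ⟨S w, h.finish w hw, ?_⟩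
      simp only [hκℓ w hw]
      exact h'.finish w hw
  · rintro _ ⟨w, hw, t, ht, rfl⟩
    rw [hκ w hw t ht, h'.energy_eq hF' hw ht, h.energy_eq hF hw ht]

end CanonicalTransport

end

/-! ### The rigidity theorem -/

theorem theorem2p1 {m : ℕ} (hm : 1 ≤ m)
    {M : Type*} [TopologicalSpace M] [ChartedSpace (EuclideanHalfSpace (m + 1)) M]
    [IsManifold (𝓡∂ (m + 1)) ∞ M] [T2Space M] [SecondCountableTopology M]
    {M' : Type*} [TopologicalSpace M'] [ChartedSpace (EuclideanHalfSpace (m + 1)) M']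
    [IsManifold (𝓡∂ (m + 1)) ∞ M'] [T2Space M'] [SecondCountableTopology M']
    {B : Type*} [TopologicalSpace B] [ChartedSpace (EuclideanSpace ℝ (Fin m)) B]
    [IsManifold (𝓡 m) ∞ B]
    (ι : B → M) (hι : IsBoundaryInclusion (𝓡∂ (m + 1)) m ι)
    (ι' : B → M') (hι' : IsBoundaryInclusion (𝓡∂ (m + 1)) m ι')
    (ρ : M → ℝ) (hρ : IsBoundaryDefiningFunction (𝓡∂ (m + 1)) ρ)
    (ρ' : M' → ℝ) (hρ' : IsBoundaryDefiningFunction (𝓡∂ (m + 1)) ρ')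
    (H : CotangentBundle (𝓡∂ (m + 1)) M → ℝ) (hH : IsPositiveHamiltonian H)
    (H' : CotangentBundle (𝓡∂ (m + 1)) M' → ℝ) (hH' : IsPositiveHamiltonian H')
    (U V : Set B) (hU : IsOpen U) (hV : IsOpen V) (hUV : Disjoint U V)
    (x₀ : B) (hx₀ : x₀ ∈ U)
    (p₀ : CotangentBundle (𝓡∂ (m + 1)) M) (hp₀ : p₀.proj = ι x₀)
    (p₀' : CotangentBundle (𝓡∂ (m + 1)) M') (hp₀' : p₀'.proj = ι' x₀)
    (𝒰 : Set (CotangentBundle (𝓡 m) B))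
    (𝒪 : Set (CotangentBundle (𝓡∂ (m + 1)) M)) (𝒪' : Set (CotangentBundle (𝓡∂ (m + 1)) M'))
    (S S' : CotangentBundle (𝓡 m) B → CotangentBundle (𝓡 m) B)
    (ℓ ℓ' : CotangentBundle (𝓡 m) B → ℝ)
    (hlens : IsLensData ι ρ H U V p₀ 𝒰 𝒪 S ℓ)
    (hlens' : IsLensData ι' ρ' H' U V p₀' 𝒰 𝒪' S' ℓ')
    (hS : ∀ q ∈ 𝒰, S q = S' q) (hℓ : ∀ q ∈ 𝒰, ℓ q = ℓ' q) :
    ∃ κ : CotangentBundle (𝓡∂ (m + 1)) M → CotangentBundle (𝓡∂ (m + 1)) M',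
      IsHomogeneousCanonical κ (flowoutCone ι H 𝒰 𝒪) (flowoutCone ι' H' 𝒰 𝒪') ∧
      κ '' overBoundary ι (flowoutCone ι H 𝒰 𝒪) U =
        overBoundary ι' (flowoutCone ι' H' 𝒰 𝒪') U ∧
      κ '' overBoundary ι (flowoutCone ι H 𝒰 𝒪) V =
        overBoundary ι' (flowoutCone ι' H' 𝒰 𝒪') V ∧
      (∀ p ∈ overBoundary ι (flowoutCone ι H 𝒰 𝒪) U ∪ overBoundary ι (flowoutCone ι H 𝒰 𝒪) V,
        ∃ q : CotangentBundle (𝓡 m) B, IsRestriction ι p q ∧ IsRestriction ι' (κ p) q) ∧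
      ∀ p ∈ flowoutCone ι H 𝒰 𝒪, H' (κ p) = H p := by
  have := Nonempty.intro p₀
  have := Nonempty.intro p₀'
  obtain ⟨γ, hγ, hΓ⟩ := hlens.exists_isRayParam hι hρ hH
  -- Since the lens data agree on 𝒰, the second system is parametrised with S and ℓ themselves, so
  -- both parametrisations have the same domain, scattering map and lengths.
  obtain ⟨γ', hγ', hΓ'⟩ := (hlens'.congr hS hℓ).exists_isRayParam hι' hρ' hH'
  rw [hΓ, hΓ']
  exact hγ.exists_canonical hι hι' hH hH' hUV hγ'
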